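/- Let $A$ be a unital $C^*$-algebra, $Z$ a commutative $C^*$-algebra, and $\tau\colon A\to Z$ a trace, i.e. a continuous $\mathbb{C}$-linear map with $\tau(ab)=\tau(ba)$ for all $a,b\in A$. Let $M$ be a finite-dimensional (Hausdorff) smooth manifold and let $W\to M$ be a smooth finitely generated projective Hilbert $A$-module bundle: the fibres $W_x$ are right Hilbert $A$-modules, each isomorphic to the range of a projection $p=p^2=p^*\in M_n(A)$ acting on $A^n$ (with $n$ and $p$ depending on $x$), and $W$ is given by an atlas of local trivializations $W|_U\cong U\times V$ which are fibrewise isomorphisms of Hilbert $A$-modules (invertible adjointable $A$-linear maps) and whose transition functions are smooth maps into the Banach spaces $\operatorname{Hom}_A(V_1,V_2)$ of adjointable $A$-linear maps with the operator norm. A connection on $W$ is an additive map $\nabla\colon \Gamma(W)\to\Omega^1(M;W)$ with $\nabla(sf)=s\,df+\nabla(s)f$ for all $s\in\Gamma(W)$ and $f\in C^\infty(M;A)$. It is extended to $W$-valued forms by the Leibniz rule $\nabla(\alpha\otimes s)=d\alpha\otimes s+(-1)^{\deg\alpha}\alpha\wedge\nabla s$, and its curvature is the form $\Omega\in\Omega^2(M;\operatorname{End}_A(W))$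 with $\nabla(\nabla s)=\Omega s$ for all $s\in\Gamma(W)$. Put $\exp(\Omega)=\sum_{k\ge 0}\Omega^{k}/k!$, where $\Omega^k$ is the $k$-fold wedge power. Let $ev\colon\operatorname{End}_A(W_x)\cong W_x\otimes_A\operatorname{Hom}_A(W_x,A)\to A/[A,A]$ be the map induced by $v\otimes\phi\mapsto\phi(v)+[A,A]$, where $v\otimes\phi$ corresponds to the endomorphism $u\mapsto v\phi(u)$ and $[A,A]$ is the linear span of the commutators, and set $$\operatorname{ch}_\tau(\Omega):=\tau(ev(\exp(\Omega)))\in\Omega^{2*}(M;Z).$$ Then: 1. every connection $\nabla$ on $W$ has exactly one curvature form $\Omega\in\Omega^2(M;\operatorname{End}_A(W))$; 2. for the curvature $\Omega$ of any connection on $W$, the form $\operatorname{ch}_\tau(\Omega)$ is smooth and closed, i.e. its component in $\Omega^{2k}(M;Z)$ is smooth and closed for every $k\ge0$; 3. the class of $\operatorname{ch}_\tau(\Omega)$ in de Rham cohomology $H^{2*}(M;Z)$ does not depend on the connection: if $\Omega,\Omega'$ are the curvatures of two connections on $W$, then their components in $\Omega^{2k}(M;Z)$ define the same class in $H^{2k}(M;Z)$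 for every $k\ge 0$. -/

import Mathlib

open scoped Manifold ContDiff RightActions TensorProduct

noncomputable section

/-! ## Hilbert modules -/

/-- A (right) Hilbert `A`-module: a right `A`-module `V` with an `A`-valued inner product,
`A`-linear in the second variable, such that `v ↦ ‖⟪v, v⟫‖ ^ (1/2)` is a complete norm.
Right `A`-module structures are `Module Aᵐᵒᵖ V`, with `v <• a` for the action of `a` on `v`.
(Mathlib's `CStarModule` is the analogous notion for left `A`-modules.) -/
class HilbertModule (A : Type*) (V : Type*) [CStarAlgebra A] [PartialOrder A]
    [NormedAddCommGroup V] [NormedSpace ℂ V] [Module Aᵐᵒᵖ V] extends Inner A V where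
  algebraMap_smul : ∀ (v : V) (z : ℂ), v <• (algebraMap ℂ A z) = z • v
  inner_right_smul : ∀ (v w : V) (a : A), inner v (w <• a) = inner v w * a
  inner_left_add : ∀ u v w : V, inner (u + v) w = inner u w + inner v w
  star_inner : ∀ v w : V, star (inner w v) = inner v w
  inner_self_nonneg : ∀ v : V, 0 ≤ inner v v
  inner_self_eq_zero : ∀ v : V, inner v v = 0 ↔ v = 0
  norm_eq : ∀ v : V, ‖v‖ = √‖inner v v‖
  complete : CompleteSpace V

section HilbertModules

variable {A : Type*} [CStarAlgebra A] [PartialOrder A] [StarOrderedRing A]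

/-- `A` as a Hilbert module over itself, with `⟪a, b⟫ = a* b`. -/
instance : HilbertModule A A where
  inner a b := star a * b
  algebraMap_smul v z := by
    rw [op_smul_eq_mul, ← Algebra.commutes, Algebra.smul_def]
  inner_right_smul v w a := by simp [mul_assoc]
  inner_left_add u v w := by simp [add_mul]
  star_inner v w := by simp
  inner_self_nonneg v := star_mul_self_nonneg v
  inner_self_eq_zero v := CStarRing.star_mul_self_eq_zero_iff v
  norm_eq v := by rw [CStarRing.norm_star_mul_self, Real.sqrt_mul_self (norm_nonneg v)]
  complete := inferInstance

variable {V W X : Type*}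
  [NormedAddCommGroup V] [NormedSpace ℂ V] [Module Aᵐᵒᵖ V] [HilbertModule A V]
  [NormedAddCommGroup W] [NormedSpace ℂ W] [Module Aᵐᵒᵖ W] [HilbertModule A W]
  [NormedAddCommGroup X] [NormedSpace ℂ X] [Module Aᵐᵒᵖ X] [HilbertModule A X]

namespace HilbertModule

lemma norm_op_smul_le (v : V) (a : A) : ‖v <• a‖ ≤ ‖v‖ * ‖a‖ := by
  have h1 : inner A (v <• a) (v <• a) = star a * inner A v v * a := by
    rw [inner_right_smul, ← star_inner (v <• a) v, inner_right_smul, star_mul, star_inner]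
  have h2 : ‖inner A (v <• a) (v <• a)‖ ≤ ‖inner A v v‖ * ‖a‖ ^ 2 := by
    rw [h1]
    calc ‖star a * inner A v v * a‖ ≤ ‖star a‖ * ‖inner A v v‖ * ‖a‖ :=
          (norm_mul_le _ _).trans (by gcongr; exact norm_mul_le _ _)
      _ = ‖inner A v v‖ * ‖a‖ ^ 2 := by rw [norm_star]; ring
  rw [norm_eq (A := A) (v <• a), norm_eq (A := A) v]
  calc √‖inner A (v <• a) (v <• a)‖ ≤ √(‖inner A v v‖ * ‖a‖ ^ 2) := Real.sqrt_le_sqrt h2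
    _ = √‖inner A v v‖ * ‖a‖ := by
      rw [Real.sqrt_mul (norm_nonneg _), Real.sqrt_sq (norm_nonneg _)]

lemma smul_smul_right (v : V) (a b : A) : (v <• a) <• b = v <• (a * b) := by
  rw [smul_smul, MulOpposite.op_mul]

lemma complex_smul_smul (v : V) (z : ℂ) (a : A) : v <• (z • a) = z • (v <• a) := by
  rw [← algebraMap_smul (A := A) (v <• a) z, smul_smul_right, Algebra.smul_def, Algebra.commutes]

lemma smul_complex_smul (v : V) (z : ℂ) (a : A) : (z • v) <• a = z • (v <• a) := by
  rw [← algebraMap_smul (A := A) v z, smul_smul_right, ← complex_smul_smul, Algebra.smul_def]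

lemma inner_right_add (u v w : V) : inner A u (v + w) = inner A u v + inner A u w := by
  rw [← star_inner, inner_left_add, star_add, star_inner, star_inner]

lemma inner_left_smul (v w : V) (a : A) : inner A (v <• a) w = star a * inner A v w := by
  rw [← star_inner, inner_right_smul, star_mul, star_inner]

lemma inner_right_complex_smul (v w : V) (z : ℂ) : inner A v (z • w) = z • inner A v w := by
  rw [← algebraMap_smul (A := A) w z, inner_right_smul, ← Algebra.commutes, Algebra.smul_def]

lemma inner_left_complex_smul (v w : V) (z : ℂ) :
    inner A (z • v) w = (starRingEnd ℂ z) • inner A v w := by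
  rw [← star_inner, inner_right_complex_smul, star_smul, star_inner]; rfl

lemma inner_left_zero (w : V) : inner A (0 : V) w = 0 := by
  have := inner_left_complex_smul (A := A) (0 : V) w 0
  simpa using this

lemma inner_right_zero (w : V) : inner A w (0 : V) = 0 := by
  have := inner_right_complex_smul (A := A) w (0 : V) 0
  simpa using this

end HilbertModule

open HilbertModule

variable (A) in
/-- A continuous linear map is a *Hilbert `A`-module morphism* if it is `A`-linear and has an
adjoint. -/
structure IsHilbertHom (T : V →L[ℂ] W) : Prop where
  map_smul : ∀ (v : V) (a : A), T (v <• a) = T v <• a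
  exists_adjoint : ∃ S : W → V, ∀ v w, inner A (T v) w = inner A v (S w)

lemma IsHilbertHom.comp {T : W →L[ℂ] X} {S : V →L[ℂ] W} (hT : IsHilbertHom A T)
    (hS : IsHilbertHom A S) : IsHilbertHom A (T ∘L S) := by
  obtain ⟨T', hT'⟩ := hT.exists_adjoint
  obtain ⟨S', hS'⟩ := hS.exists_adjoint
  exact ⟨fun v a => by simp [hS.map_smul, hT.map_smul],
    ⟨S' ∘ T', fun v w => by simp [hT', hS']⟩⟩

lemma IsHilbertHom.add {T S : V →L[ℂ] W} (hT : IsHilbertHom A T) (hS : IsHilbertHom A S) :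
    IsHilbertHom A (T + S) := by
  obtain ⟨T', hT'⟩ := hT.exists_adjoint
  obtain ⟨S', hS'⟩ := hS.exists_adjoint
  exact ⟨fun v a => by simp [hS.map_smul, hT.map_smul],
    ⟨fun w => T' w + S' w, fun v w => by
      simp [inner_left_add, inner_right_add, hT', hS']⟩⟩

lemma IsHilbertHom.zero : IsHilbertHom A (0 : V →L[ℂ] W) :=
  ⟨fun v a => by simp, ⟨fun _ => 0, fun v w => by simp [inner_left_zero, inner_right_zero]⟩⟩

lemma IsHilbertHom.smul {T : V →L[ℂ] W} (hT : IsHilbertHom A T) (z : ℂ) :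
    IsHilbertHom A (z • T) := by
  obtain ⟨T', hT'⟩ := hT.exists_adjoint
  exact ⟨fun v a => by simp [hT.map_smul, smul_complex_smul],
    ⟨fun w => (starRingEnd ℂ z) • T' w, fun v w => by
      simp [inner_left_complex_smul, inner_right_complex_smul, hT']⟩⟩

variable (A) in
lemma IsHilbertHom.id : IsHilbertHom A (ContinuousLinearMap.id ℂ V) :=
  ⟨fun _ _ => rfl, ⟨fun w => w, fun _ _ => rfl⟩⟩

variable (A V W) in
/-- The Banach space `Hom_A(V, W)` of Hilbert `A`-module morphisms, with the operator norm. -/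
def HomA : Submodule ℂ (V →L[ℂ] W) where
  carrier := {T | IsHilbertHom A T}
  add_mem' := IsHilbertHom.add
  zero_mem' := IsHilbertHom.zero
  smul_mem' z _ h := h.smul z

variable (A V) in
/-- The algebra `End_A(V)` of Hilbert `A`-module endomorphisms, with the operator norm. -/
def EndA : Subalgebra ℂ (V →L[ℂ] V) where
  carrier := {T | IsHilbertHom A T}
  mul_mem' := IsHilbertHom.comp
  add_mem' := IsHilbertHom.add
  algebraMap_mem' z := by
    rw [Algebra.algebraMap_eq_smul_one]
    exact (IsHilbertHom.id A).smul z

instance : NormedRing (EndA A V) := Subalgebra.normedRing (EndA A V)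

instance : NormedAlgebra ℂ (EndA A V) := Subalgebra.toNormedAlgebra (EndA A V)

instance : NormedAddCommGroup (EndA A V) := NonUnitalNormedRing.toNormedAddCommGroup

instance : NormedSpace ℂ (EndA A V) := NormedAlgebra.toNormedSpace (EndA A V)

instance : NormedAlgebra ℝ (EndA A V) := NormedAlgebra.complexToReal

instance : NormedSpace ℝ (EndA A V) := NormedAlgebra.toNormedSpace (EndA A V)

variable (A V) in
/-- The inclusion of `End_A(V)` in the space of all continuous linear endomorphisms. -/
def EndA.incl : EndA A V →L[ℂ] (V →L[ℂ] V) := ⟨(EndA A V).val.toLinearMap, continuous_subtype_val⟩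

variable (A V) in
/-- `V` is a *finitely generated projective* Hilbert `A`-module: it is isomorphic as a Hilbert
`A`-module (by `j`) to the range of a projection `p = p² = p*` in `M_n(A)`, acting on `A^n`,
where `A^n` carries the inner product `⟪a, b⟫ = ∑ aᵢ* bᵢ`. -/
def IsFGP : Prop :=
  ∃ (n : ℕ) (p : Matrix (Fin n) (Fin n) A) (j : V →ₗ[Aᵐᵒᵖ] (Fin n → A)),
    p * p = p ∧ p.conjTranspose = p ∧
    (∀ v w : V, inner A v w = ∑ i, star (j v i) * j w i) ∧
    Set.range j = Set.range (fun x : Fin n → A => p.mulVec x)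

/-! ## Endomorphisms as tensors, and the evaluation map -/

/-- The morphism `a φ : x ↦ a * φ x`, which makes `Hom_A(V, A)` a left `A`-module. -/
def HomA.leftMul (a : A) (φ : HomA A V A) : HomA A V A :=
  ⟨(ContinuousLinearMap.mul ℂ A a) ∘L φ.1, by
    obtain ⟨S, hS⟩ := φ.2.exists_adjoint
    refine ⟨fun v b => ?_, ⟨fun b => S (star a * b), fun v b => ?_⟩⟩
    · simp [φ.2.map_smul, mul_assoc]
    · rw [← hS]
      simp only [inner, ContinuousLinearMap.comp_apply, ContinuousLinearMap.mul_apply', star_mul,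
        mul_assoc]⟩

variable (A V) in
/-- The relations `v a ⊗ φ = v ⊗ a φ`. -/
def balancedRel : Submodule ℂ (V ⊗[ℂ] HomA A V A) :=
  Submodule.span ℂ {t | ∃ (v : V) (a : A) (φ : HomA A V A),
    t = (v <• a) ⊗ₜ[ℂ] φ - v ⊗ₜ[ℂ] (HomA.leftMul a φ)}

variable (A V) in
/-- The (algebraic) tensor product `V ⊗_A Hom_A(V, A)` over the noncommutative algebra `A`. -/
abbrev BalancedTensor := (V ⊗[ℂ] HomA A V A) ⧸ balancedRel A V

/-- The rank one endomorphism `x ↦ v φ(x)`. -/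
def rankOne (v : V) (φ : HomA A V A) : EndA A V :=
  ⟨LinearMap.mkContinuous
    { toFun := fun x => v <• (φ.1 x)
      map_add' := fun x y => by rw [map_add, MulOpposite.op_add, add_smul]
      map_smul' := fun z x => by rw [map_smul, complex_smul_smul]; rfl }
    (‖v‖ * ‖φ.1‖) (fun x => (norm_op_smul_le v _).trans (by
      rw [mul_assoc]; gcongr; exact φ.1.le_opNorm x)), by
    obtain ⟨S, hS⟩ := φ.2.exists_adjoint
    refine ⟨fun x a => ?_, ⟨fun w => S (inner A v w), fun x w => ?_⟩⟩
    · change v <• (φ.1 (x <• a)) = (v <• (φ.1 x)) <• a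
      rw [φ.2.map_smul, smul_smul_right]; rfl
    · change inner A (v <• (φ.1 x)) w = _
      rw [inner_left_smul, ← hS]; rfl⟩

lemma rankOne_apply (v : V) (φ : HomA A V A) (x : V) :
    (rankOne v φ : V →L[ℂ] V) x = v <• (φ.1 x) := rfl

variable (A V) in
/-- The canonical map `ι : V ⊗_A Hom_A(V, A) → End_A(V)`, `v ⊗ φ ↦ (x ↦ v φ(x))`. -/
def iotaA : BalancedTensor A V →ₗ[ℂ] EndA A V :=
  (balancedRel A V).liftQ
    (TensorProduct.lift (LinearMap.mk₂ ℂ (fun (v : V) (φ : HomA A V A) => rankOne v φ)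
      (fun v w φ => by ext x; simp [rankOne_apply])
      (fun z v φ => by ext x; simp [rankOne_apply, smul_complex_smul])
      (fun v φ ψ => by ext x; simp [rankOne_apply, add_smul])
      (fun z v φ => by
        ext x
        change v <• ((z • φ.1) x) = z • (v <• (φ.1 x))
        rw [_root_.smul_apply, complex_smul_smul])))
    (by
      refine Submodule.span_le.2 ?_
      rintro _ ⟨v, a, φ, rfl⟩
      simp only [SetLike.mem_coe, LinearMap.mem_ker, map_sub, TensorProduct.lift.tmul,
        LinearMap.mk₂_apply, sub_eq_zero]
      ext x
      rw [rankOne_apply, rankOne_apply, smul_smul_right]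
      rfl)

variable (A) in
/-- The subspace `[A, A]` of `A` spanned by the commutators. -/
def commSpan : Submodule ℂ A := Submodule.span ℂ {c | ∃ a b : A, c = a * b - b * a}

variable (A V) in
/-- The map `V ⊗_A Hom_A(V, A) → A/[A, A]`, `v ⊗ φ ↦ φ(v) + [A, A]`. -/
def evTensor : BalancedTensor A V →ₗ[ℂ] A ⧸ commSpan A :=
  (balancedRel A V).liftQ
    ((commSpan A).mkQ ∘ₗ TensorProduct.lift
      (LinearMap.mk₂ ℂ (fun (v : V) (φ : HomA A V A) => φ.1 v)
        (fun v w φ => map_add _ _ _) (fun z v φ => map_smul _ _ _)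
        (fun v φ ψ => rfl) (fun z v φ => rfl)))
    (by
      refine Submodule.span_le.2 ?_
      rintro _ ⟨v, a, φ, rfl⟩
      simp only [SetLike.mem_coe, LinearMap.mem_ker, map_sub, LinearMap.comp_apply,
        TensorProduct.lift.tmul, LinearMap.mk₂_apply]
      rw [← map_sub, Submodule.mkQ_apply, Submodule.Quotient.mk_eq_zero]
      refine Submodule.subset_span ⟨φ.1 v, a, ?_⟩
      rw [φ.2.map_smul]
      rfl)

/-- A finitely generated projective module has a finite frame. -/
lemma IsFGP.exists_frame (h : IsFGP A V) : ∃ (n : ℕ) (e : Fin n → V) (φ : Fin n → HomA A V A),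
    ∀ v, ∑ i, e i <• ((φ i).1 v) = v := by
  obtain ⟨n, p, j, hpp, hps, hj, hr⟩ := h
  have hinj : Function.Injective j := by
    intro v w hvw
    have h0 : j (v - w) = 0 := by rw [map_sub, hvw, sub_self]
    have : inner A (v - w) (v - w) = 0 := by rw [hj, h0]; simp
    exact sub_eq_zero.1 ((inner_self_eq_zero _).1 this)
  have hp : ∀ v, p.mulVec (j v) = j v := by
    intro v
    obtain ⟨x, hx⟩ : j v ∈ Set.range (fun x : Fin n → A => p.mulVec x) := hr ▸ ⟨v, rfl⟩
    simp only at hx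
    rw [← hx, Matrix.mulVec_mulVec, hpp]
  have he : ∀ i, ∃ e : V, j e = p.mulVec (Pi.single i 1) := by
    intro i
    have : p.mulVec (Pi.single i 1) ∈ Set.range j := hr ▸ ⟨_, rfl⟩
    exact this
  choose e he using he
  have hje : ∀ i k, j (e i) k = p k i := by intro i k; rw [he]; simp
  have hz : ∀ (z : ℂ) (v : V), j (z • v) = z • j v := by
    intro z v
    rw [← algebraMap_smul (A := A) v z, map_smul]
    ext k
    simp [← Algebra.commutes, Algebra.smul_def]
  have hadj : ∀ i v, inner A (e i) v = j v i := by
    intro i v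
    rw [hj]
    conv_rhs => rw [← hp v]
    simp only [hje, Matrix.mulVec, dotProduct]
    refine Finset.sum_congr rfl fun k _ => ?_
    rw [← Matrix.conjTranspose_apply, hps]
  have hb : ∀ i v, ‖j v i‖ ≤ 1 * ‖v‖ := by
    intro i v
    rw [one_mul, norm_eq (A := A) v]
    refine Real.le_sqrt_of_sq_le ?_
    rw [sq, ← CStarRing.norm_star_mul_self, hj]
    refine CStarAlgebra.norm_le_norm_of_nonneg_of_le (star_mul_self_nonneg _) ?_
    exact Finset.single_le_sum (f := fun i => star (j v i) * j v i)
      (fun k _ => star_mul_self_nonneg _) (Finset.mem_univ i)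
  refine ⟨n, e, fun i => ⟨LinearMap.mkContinuous
    { toFun := fun v => j v i
      map_add' := fun v w => by simp
      map_smul' := fun z v => by simp [hz] } 1 (hb i), ?_⟩, fun v => ?_⟩
  · refine ⟨fun v a => by simp, ⟨fun a => e i <• a, fun v a => ?_⟩⟩
    rw [inner_right_smul, ← star_inner v (e i), hadj]
    rfl
  · refine hinj ?_
    rw [map_sum]
    ext k
    simp only [map_smul, Finset.sum_apply, Pi.smul_apply, hje]
    conv_rhs => rw [← hp v]
    rfl

lemma rankOne_sum_eq {n : ℕ} {e : Fin n → V} {φ : Fin n → HomA A V A}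
    (h : ∀ v, ∑ i, e i <• ((φ i).1 v) = v) (v : V) (ψ : HomA A V A) :
    (Submodule.Quotient.mk (v ⊗ₜ[ℂ] ψ) : BalancedTensor A V) =
      ∑ i, Submodule.Quotient.mk (((rankOne v ψ : EndA A V) : V →L[ℂ] V) (e i) ⊗ₜ[ℂ] φ i) := by
  have h1 : ψ = ∑ i, HomA.leftMul (ψ.1 (e i)) (φ i) := by
    ext x
    conv_lhs => rw [← h x]
    rw [map_sum, Submodule.coe_sum, _root_.sum_apply]
    refine Finset.sum_congr rfl fun i _ => ?_
    rw [ψ.2.map_smul]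
    rfl
  conv_lhs => rw [h1, TensorProduct.tmul_sum]
  rw [← Submodule.mkQ_apply, map_sum]
  refine Finset.sum_congr rfl fun i _ => ?_
  rw [Submodule.mkQ_apply, rankOne_apply, eq_comm, Submodule.Quotient.eq]
  exact Submodule.subset_span ⟨v, _, _, rfl⟩

lemma iotaA_frame {n : ℕ} {e : Fin n → V} {φ : Fin n → HomA A V A}
    (h : ∀ v, ∑ i, e i <• ((φ i).1 v) = v) (t : BalancedTensor A V) :
    ∑ i, (Submodule.Quotient.mk ((iotaA A V t : V →L[ℂ] V) (e i) ⊗ₜ[ℂ] φ i) :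
      BalancedTensor A V) = t := by
  obtain ⟨t, rfl⟩ := Submodule.Quotient.mk_surjective _ t
  induction t using TensorProduct.induction_on with
  | zero => simp
  | tmul v ψ => exact (rankOne_sum_eq h v ψ).symm
  | add s t hs ht =>
    rw [Submodule.Quotient.mk_add]
    conv_rhs => rw [← hs, ← ht]
    rw [← Finset.sum_add_distrib]
    refine Finset.sum_congr rfl fun i _ => ?_
    have h1 : (iotaA A V (Submodule.Quotient.mk s + Submodule.Quotient.mk t) : V →L[ℂ] V) (e i) =
        (iotaA A V (Submodule.Quotient.mk s) : V →L[ℂ] V) (e i) +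
          (iotaA A V (Submodule.Quotient.mk t) : V →L[ℂ] V) (e i) := by
      rw [map_add]; rfl
    rw [h1, TensorProduct.add_tmul, Submodule.Quotient.mk_add]

/-- For a finitely generated projective module, `ι` is an isomorphism. -/
lemma IsFGP.iotaA_bijective (h : IsFGP A V) : Function.Bijective (iotaA A V) := by
  obtain ⟨n, e, φ, hf⟩ := h.exists_frame
  constructor
  · intro s t hst
    rw [← iotaA_frame hf s, ← iotaA_frame hf t, hst]
  · intro T
    refine ⟨∑ i, Submodule.Quotient.mk ((T : V →L[ℂ] V) (e i) ⊗ₜ[ℂ] φ i), ?_⟩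
    rw [map_sum]
    ext x
    conv_rhs => rw [← hf x, map_sum]
    rw [AddSubmonoidClass.coe_finsetSum, _root_.sum_apply]
    refine Finset.sum_congr rfl fun i _ => ?_
    rw [T.2.map_smul]
    rfl

/-- The evaluation map `ev : End_A(V) ≅ V ⊗_A Hom_A(V, A) → A/[A, A]`. -/
def evA (h : IsFGP A V) : EndA A V →ₗ[ℂ] A ⧸ commSpan A :=
  evTensor A V ∘ₗ (LinearEquiv.ofBijective (iotaA A V) h.iotaA_bijective).symm.toLinearMap

lemma evA_eq_sum (h : IsFGP A V) {n : ℕ} {e : Fin n → V} {φ : Fin n → HomA A V A}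
    (hf : ∀ v, ∑ i, e i <• ((φ i).1 v) = v) (T : EndA A V) :
    evA h T = ∑ i, (commSpan A).mkQ ((φ i).1 ((T : V →L[ℂ] V) (e i))) := by
  obtain ⟨t, rfl⟩ := h.iotaA_bijective.2 T
  have : (LinearEquiv.ofBijective (iotaA A V) h.iotaA_bijective).symm (iotaA A V t) = t :=
    (LinearEquiv.ofBijective (iotaA A V) h.iotaA_bijective).symm_apply_apply t
  rw [evA, LinearMap.comp_apply, LinearEquiv.coe_coe, this]
  conv_lhs => rw [← iotaA_frame hf t, map_sum]
  rfl

variable {Z : Type*} [NonUnitalCommCStarAlgebra Z]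

/-- A trace factors through `A/[A, A]`. -/
def traceBar (τ : A →L[ℂ] Z) (hτ : ∀ a b : A, τ (a * b) = τ (b * a)) : A ⧸ commSpan A →ₗ[ℂ] Z :=
  (commSpan A).liftQ τ.toLinearMap (by
    refine Submodule.span_le.2 ?_
    rintro _ ⟨a, b, rfl⟩
    simp [hτ a b])

/-- The `Z`-valued trace `τ ∘ ev` on `End_A(V)`. -/
def traceEv (τ : A →L[ℂ] Z) (hτ : ∀ a b : A, τ (a * b) = τ (b * a)) (h : IsFGP A V) :
    EndA A V →L[ℂ] Z :=
  ⟨traceBar τ hτ ∘ₗ evA h, by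
    obtain ⟨n, e, φ, hf⟩ := h.exists_frame
    have : ∀ T : EndA A V, (traceBar τ hτ ∘ₗ evA h) T =
        ∑ i, τ ((φ i).1 ((T : V →L[ℂ] V) (e i))) := by
      intro T
      rw [LinearMap.comp_apply, evA_eq_sum h hf, map_sum]
      rfl
    change Continuous (fun T : EndA A V => (traceBar τ hτ ∘ₗ evA h) T)
    simp only [this]
    refine continuous_finsetSum _ fun i _ => τ.continuous.comp ((φ i).1.continuous.comp ?_)
    exact (ContinuousLinearMap.apply ℂ V (e i)).continuous.comp continuous_subtype_val⟩

end HilbertModules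

/-! ## Algebra of alternating forms -/

section Wedge

variable {T F G H : Type*} [AddCommGroup T] [Module ℝ T] [TopologicalSpace T]
  [NormedAddCommGroup F] [NormedSpace ℝ F] [NormedAddCommGroup G] [NormedSpace ℝ G]
  [NormedAddCommGroup H] [NormedSpace ℝ H]

lemma update_castAdd {p q : ℕ} (v : Fin (p + q) → T) (j : Fin p) (x : T) :
    (fun i => Function.update v (Fin.castAdd q j) x (Fin.castAdd q i)) =
      Function.update (fun i => v (Fin.castAdd q i)) j x ∧
    (fun i => Function.update v (Fin.castAdd q j) x (Fin.natAdd p i)) =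
      fun i => v (Fin.natAdd p i) := by
  refine ⟨Function.update_comp_eq_of_injective v (Fin.castAdd_injective p q) j x, ?_⟩
  funext i
  refine Function.update_of_ne (fun h => ?_) _ _
  have := congrArg Fin.val h
  simp at this
  lia

lemma update_natAdd {p q : ℕ} (v : Fin (p + q) → T) (j : Fin q) (x : T) :
    (fun i => Function.update v (Fin.natAdd p j) x (Fin.natAdd p i)) =
      Function.update (fun i => v (Fin.natAdd p i)) j x ∧
    (fun i => Function.update v (Fin.natAdd p j) x (Fin.castAdd q i)) =
      fun i => v (Fin.castAdd q i) := by
  refine ⟨Function.update_comp_eq_of_injective v (Fin.natAdd_injective q p) j x, ?_⟩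
  funext i
  refine Function.update_of_ne (fun h => ?_) _ _
  have := congrArg Fin.val h
  simp at this
  lia

/-- The multilinear map
`(v₁, …, v_{p+q}) ↦ B (α (v₁, …, v_p)) (β (v_{p+1}, …, v_{p+q}))`. -/
def formProd {p q : ℕ} (B : F →L[ℝ] G →L[ℝ] H) (α : T [⋀^Fin p]→L[ℝ] F)
    (β : T [⋀^Fin q]→L[ℝ] G) : ContinuousMultilinearMap ℝ (fun _ : Fin (p + q) => T) H where
  toFun v := B (α fun i => v (Fin.castAdd q i)) (β fun i => v (Fin.natAdd p i))
  map_update_add' := by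
    intro inst v i x y
    have : inst = instDecidableEqFin _ := Subsingleton.elim _ _
    subst this
    induction i using Fin.addCases with
    | left j => simp only [(update_castAdd v j _).1, (update_castAdd v j _).2, α.map_update_add,
        map_add, _root_.add_apply]
    | right j => simp only [(update_natAdd v j _).1, (update_natAdd v j _).2, β.map_update_add,
        map_add]
  map_update_smul' := by
    intro inst v i c x
    have : inst = instDecidableEqFin _ := Subsingleton.elim _ _
    subst this
    induction i using Fin.addCases with
    | left j => simp only [(update_castAdd v j _).1, (update_castAdd v j _).2, α.map_update_smul,
        map_smul, _root_.smul_apply]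
    | right j => simp only [(update_natAdd v j _).1, (update_natAdd v j _).2, β.map_update_smul,
        map_smul]
  cont := by
    have h1 : Continuous fun v : Fin (p + q) → T => α fun i => v (Fin.castAdd q i) :=
      α.cont.comp (continuous_pi fun i => continuous_apply _)
    have h2 : Continuous fun v : Fin (p + q) → T => β fun i => v (Fin.natAdd p i) :=
      β.cont.comp (continuous_pi fun i => continuous_apply _)
    exact (B.continuous.comp h1).clm_apply h2

/-- The wedge product of alternating forms with respect to a bilinear pairing `B`,
`(α ∧ β)(v₁, …, v_{p+q}) = 1/(p! q!) ∑_σ sgn(σ) B (α (v_{σ 1}, …)) (β (v_{σ (p+1)}, …))`. -/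
def wedge {p q : ℕ} (B : F →L[ℝ] G →L[ℝ] H) (α : T [⋀^Fin p]→L[ℝ] F)
    (β : T [⋀^Fin q]→L[ℝ] G) : T [⋀^Fin (p + q)]→L[ℝ] H :=
  ((p.factorial * q.factorial : ℝ)⁻¹) •
    ContinuousMultilinearMap.alternatization (formProd B α β)

/-- The `k`-fold wedge power of a `2`-form with values in an algebra. -/
def wedgePow {R : Type*} [NormedRing R] [NormedAlgebra ℝ R] (Ω : T [⋀^Fin 2]→L[ℝ] R) :
    (k : ℕ) → T [⋀^Fin (2 * k)]→L[ℝ] R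
  | 0 => ContinuousAlternatingMap.constOfIsEmpty ℝ T (Fin 0) (1 : R)
  | k + 1 => wedge (ContinuousLinearMap.mul ℝ R) (wedgePow Ω k) Ω

/-- The component of degree `2 k` of `exp Ω = ∑ₖ Ω^k / k!`. -/
def expForm {R : Type*} [NormedRing R] [NormedAlgebra ℝ R] (Ω : T [⋀^Fin 2]→L[ℝ] R)
    (k : ℕ) : T [⋀^Fin (2 * k)]→L[ℝ] R :=
  ((k.factorial : ℝ)⁻¹) • wedgePow Ω k

end Wedge

/-! ## Differential forms on manifolds -/

section Forms

variable {E : Type*} [NormedAddCommGroup E] [NormedSpace ℝ E]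
  {M : Type*} [TopologicalSpace M] [ChartedSpace E M]

variable (E) in
/-- Differential `k`-forms on `M` (not necessarily smooth) with values in the family `W` of
normed spaces. -/
abbrev DForm {M : Type*} [TopologicalSpace M] [ChartedSpace E M] (W : M → Type*)
    [∀ x, NormedAddCommGroup (W x)] [∀ x, NormedSpace ℝ (W x)] (k : ℕ) :=
  ∀ x : M, TangentSpace 𝓘(ℝ, E) x [⋀^Fin k]→L[ℝ] W x

/-- The expression of a form in a chart `e`: its pullback by `e⁻¹`. -/
def DForm.inChart {W : M → Type*} [∀ x, NormedAddCommGroup (W x)] [∀ x, NormedSpace ℝ (W x)]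
    {k : ℕ} (α : DForm E W k) (e : OpenPartialHomeomorph M E) (y : E) :
    E [⋀^Fin k]→L[ℝ] W (e.symm y) :=
  (α (e.symm y)).compContinuousLinearMap
    (mfderiv 𝓘(ℝ, E) 𝓘(ℝ, E) e.symm y : E →L[ℝ] TangentSpace 𝓘(ℝ, E) (e.symm y))

/-- Smoothness over `U` of a form with values in `W`, read through the trivialization
`T x : W x → V` over `U`: in all charts the coefficients are smooth. -/
def DForm.SmoothThrough {W : M → Type*} [∀ x, NormedAddCommGroup (W x)]
    [∀ x, NormedSpace ℝ (W x)] {k : ℕ} (α : DForm E W k) {V : Type*} [NormedAddCommGroup V]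
    [NormedSpace ℝ V] (U : Set M) (T : ∀ x, W x →L[ℝ] V) : Prop :=
  ∀ e ∈ atlas E M, ContDiffOn ℝ ∞
    (fun y => (T (e.symm y)).compContinuousAlternatingMap (α.inChart e y))
    (e.target ∩ e.symm ⁻¹' U)

variable {F : Type*} [NormedAddCommGroup F] [NormedSpace ℝ F]

/-- The differential `df` of a function with values in a fixed normed space. -/
def differential (f : M → F) (x : M) : TangentSpace 𝓘(ℝ, E) x →L[ℝ] F :=
  mfderiv 𝓘(ℝ, E) 𝓘(ℝ, F) f x

/-- Smooth forms with values in a fixed normed space. -/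
def DForm.IsSmooth {k : ℕ} (α : DForm E (fun _ : M => F) k) : Prop :=
  α.SmoothThrough Set.univ (fun _ => ContinuousLinearMap.id ℝ F)

/-- The exterior derivative of a form with values in a fixed normed space, computed at `x` in the
preferred chart at `x`. -/
def DForm.d {k : ℕ} (α : DForm E (fun _ : M => F) k) : DForm E (fun _ : M => F) (k + 1) :=
  fun x => (extDeriv (fun y => α.inChart (chartAt E x) y)
      (chartAt E x x)).compContinuousLinearMap
    (mfderiv 𝓘(ℝ, E) 𝓘(ℝ, E) (chartAt E x) x : TangentSpace 𝓘(ℝ, E) x →L[ℝ] E)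

lemma DForm.IsSmooth.contDiffOn {k : ℕ} {α : DForm E (fun _ : M => F) k} (h : α.IsSmooth)
    {e : OpenPartialHomeomorph M E} (he : e ∈ atlas E M) :
    ContDiffOn ℝ ∞ (fun y => α.inChart e y) e.target := by
  have := h e he
  simp only [Set.preimage_univ, Set.inter_univ] at this
  exact this

lemma DForm.IsSmooth.of_contDiffOn {k : ℕ} {α : DForm E (fun _ : M => F) k}
    (h : ∀ e ∈ atlas E M, ContDiffOn ℝ ∞ (fun y => α.inChart e y) e.target) : α.IsSmooth := by
  intro e he
  simp only [Set.preimage_univ, Set.inter_univ]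
  exact h e he

lemma DForm.IsSmooth.differentiableAt {k : ℕ} {α : DForm E (fun _ : M => F) k} (h : α.IsSmooth)
    (x : M) : DifferentiableAt ℝ (fun y => α.inChart (chartAt E x) y) (chartAt E x x) :=
  ((h.contDiffOn (chart_mem_atlas E x)).contDiffAt ((chartAt E x).open_target.mem_nhds
    (mem_chart_target E x))).differentiableAt (by simp)

lemma DForm.IsSmooth.add {k : ℕ} {α β : DForm E (fun _ : M => F) k} (hα : α.IsSmooth)
    (hβ : β.IsSmooth) : (α + β).IsSmooth :=
  .of_contDiffOn fun _ he => (hα.contDiffOn he).add (hβ.contDiffOn he)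

lemma DForm.IsSmooth.smul {k : ℕ} {α : DForm E (fun _ : M => F) k} (hα : α.IsSmooth) (c : ℝ) :
    (c • α).IsSmooth :=
  .of_contDiffOn fun _ he => (hα.contDiffOn he).const_smul c

lemma DForm.isSmooth_zero {k : ℕ} : (0 : DForm E (fun _ : M => F) k).IsSmooth :=
  .of_contDiffOn fun _ _ => contDiffOn_const (c := 0)

lemma DForm.d_add {k : ℕ} {α β : DForm E (fun _ : M => F) k} (hα : α.IsSmooth)
    (hβ : β.IsSmooth) : (α + β).d = α.d + β.d := by
  funext x
  have := extDeriv_fun_add (hα.differentiableAt x) (hβ.differentiableAt x)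
  ext v
  exact DFunLike.congr_fun this _

lemma DForm.d_smul {k : ℕ} (α : DForm E (fun _ : M => F) k) (c : ℝ) : (c • α).d = c • α.d := by
  funext x
  have := extDeriv_fun_smul c (fun y => α.inChart (chartAt E x) y) (x := chartAt E x x)
  ext v
  exact DFunLike.congr_fun this _

lemma DForm.d_zero {k : ℕ} : (0 : DForm E (fun _ : M => F) k).d = 0 := by
  have := DForm.d_smul (0 : DForm E (fun _ : M => F) k) 0
  rwa [zero_smul, zero_smul] at this

variable (E M F) in
/-- The space of closed smooth `k`-forms. -/
def closedForms (k : ℕ) : Submodule ℝ (DForm E (fun _ : M => F) k) where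
  carrier := {α | α.IsSmooth ∧ α.d = 0}
  add_mem' hα hβ := ⟨hα.1.add hβ.1, by rw [DForm.d_add hα.1 hβ.1, hα.2, hβ.2, add_zero]⟩
  zero_mem' := ⟨DForm.isSmooth_zero, DForm.d_zero⟩
  smul_mem' c _ hα := ⟨hα.1.smul c, by rw [DForm.d_smul, hα.2, smul_zero]⟩

variable (E M F) in
/-- The subspace of exact forms `dη`, with `η` smooth, of the space of closed forms. -/
def exactForms : (k : ℕ) → Submodule ℝ (closedForms E M F k)
  | 0 => ⊥
  | k + 1 =>
    { carrier := {α | ∃ η : DForm E (fun _ : M => F) k, η.IsSmooth ∧ η.d = α.1}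
      add_mem' := by
        rintro _ _ ⟨η, h, h'⟩ ⟨θ, t, t'⟩
        exact ⟨η + θ, h.add t, by rw [DForm.d_add h t, h', t']; rfl⟩
      zero_mem' := ⟨0, DForm.isSmooth_zero, DForm.d_zero⟩
      smul_mem' := by
        rintro c _ ⟨η, h, h'⟩
        exact ⟨c • η, h.smul c, by rw [DForm.d_smul, h']; rfl⟩ }

variable (E M F) in
/-- De Rham cohomology with coefficients in `F`. -/
abbrev DeRham (k : ℕ) := closedForms E M F k ⧸ exactForms E M F k

/-- The cohomology class of a closed form. -/
def deRhamClass {k : ℕ} (α : DForm E (fun _ : M => F) k) (h : α ∈ closedForms E M F k) :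
    DeRham E M F k :=
  Submodule.Quotient.mk ⟨α, h⟩

end Forms

/-! ## Hilbert module bundles, connections and curvature -/

section Bundles

variable {A : Type*} [CStarAlgebra A] [PartialOrder A] [StarOrderedRing A]
  {E : Type*} [NormedAddCommGroup E] [NormedSpace ℝ E]
  {M : Type*} [TopologicalSpace M] [ChartedSpace E M]
  {W : M → Type*} [∀ x, NormedAddCommGroup (W x)] [∀ x, NormedSpace ℂ (W x)]
  [∀ x, Module Aᵐᵒᵖ (W x)] [∀ x, HilbertModule A (W x)]
  {ι : Type*} {V : ι → Type*} [∀ i, NormedAddCommGroup (V i)] [∀ i, NormedSpace ℂ (V i)]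
  [∀ i, Module Aᵐᵒᵖ (V i)] [∀ i, HilbertModule A (V i)]

variable (A E W V) in
/-- A smooth Hilbert `A`-module bundle over `M` with fibers `W x`, given by an atlas of local
trivializations `W|_{U i} ≅ U i × V i`, which are fiberwise isomorphisms of Hilbert `A`-modules,
with smooth transition functions `U i ∩ U j → Hom_A(V i, V j)`. The maps `triv i x : W x → V i` and
`symm i x : V i → W x` are meaningful only for `x` in `U i`. -/
structure SmoothHilbertBundle where
  U : ι → Set M
  isOpen_U : ∀ i, IsOpen (U i)
  iUnion_U : ⋃ i, U i = Set.univ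
  triv : ∀ (i : ι) (x : M), W x →L[ℂ] V i
  symm : ∀ (i : ι) (x : M), V i →L[ℂ] W x
  triv_hom : ∀ i, ∀ x ∈ U i, IsHilbertHom A (triv i x)
  symm_hom : ∀ i, ∀ x ∈ U i, IsHilbertHom A (symm i x)
  symm_triv : ∀ i, ∀ x ∈ U i, ∀ w : W x, symm i x (triv i x w) = w
  triv_symm : ∀ i, ∀ x ∈ U i, ∀ v : V i, triv i x (symm i x v) = v
  smooth_transition : ∀ i j, ContMDiffOn 𝓘(ℝ, E) 𝓘(ℝ, V i →L[ℂ] V j) ∞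
    (fun x => triv j x ∘L symm i x) (U i ∩ U j)

namespace SmoothHilbertBundle

variable (B : SmoothHilbertBundle A E W V)

/-- Smooth sections of the bundle. -/
def IsSmoothSection (s : ∀ x, W x) : Prop :=
  ∀ i, ContMDiffOn 𝓘(ℝ, E) 𝓘(ℝ, V i) ∞ (fun x => B.triv i x (s x)) (B.U i)

/-- Smooth forms with values in the bundle. -/
def IsSmoothForm {k : ℕ} (α : DForm E W k) : Prop :=
  ∀ i, α.SmoothThrough (B.U i) (fun x => (B.triv i x).restrictScalars ℝ)

/-- The trivialization `Φ ↦ φ Φ φ⁻¹` of the bundle `End_A(W)` over `U i`. -/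
def endTriv (i : ι) (x : M) : EndA A (W x) →L[ℝ] (V i →L[ℂ] V i) :=
  (((ContinuousLinearMap.compL ℂ (V i) (W x) (V i) (B.triv i x)) ∘L
    ((ContinuousLinearMap.compL ℂ (V i) (W x) (W x)).flip (B.symm i x))) ∘L
      EndA.incl A (W x)).restrictScalars ℝ

/-- Smooth forms with values in `End_A(W)`. -/
def IsSmoothEndForm {k : ℕ} (α : DForm E (fun x => EndA A (W x)) k) : Prop :=
  ∀ i, α.SmoothThrough (B.U i) (B.endTriv i)

/-- A connection on the bundle: an operator `∇ : Γ(W) → Ω¹(M; W)` which is additive and satisfies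
`∇(s f) = s df + ∇(s) f` for all smooth `f : M → A` (hence is `A`-linear). The values of `toFun` on
sections that are not smooth are irrelevant. -/
structure Connection where
  toFun : (∀ x, W x) → DForm E W 1
  smooth : ∀ s, B.IsSmoothSection s → B.IsSmoothForm (toFun s)
  map_add : ∀ s t, B.IsSmoothSection s → B.IsSmoothSection t →
    toFun (fun x => s x + t x) = fun x => toFun s x + toFun t x
  leibniz : ∀ s (f : M → A), B.IsSmoothSection s → ContMDiff 𝓘(ℝ, E) 𝓘(ℝ, A) ∞ f →
    ∀ (x : M) (ξ : Fin 1 → TangentSpace 𝓘(ℝ, E) x),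
      toFun (fun x => s x <• f x) x ξ =
        s x <• differential f x (ξ 0) + toFun s x ξ <• f x

variable {B}

/-- `Θ` is the image of the `W`-valued `p`-form `θ` under the extension of `∇` to forms by the
Leibniz rule `∇(α ⊗ t) = dα ⊗ t + (-1)^p α ∧ ∇ t`: whenever `θ = ∑ⱼ αⱼ ⊗ tⱼ` on an open set `O`,
with smooth real forms `αⱼ` and smooth sections `tⱼ`, then
`Θ = ∑ⱼ (dαⱼ ⊗ tⱼ + (-1)^p αⱼ ∧ ∇ tⱼ)` on `O`. -/
def Connection.Extends (D : B.Connection) {p : ℕ} (θ : DForm E W p) (Θ : DForm E W (p + 1)) :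
    Prop :=
  ∀ (O : Set M) (n : ℕ) (α : Fin n → DForm E (fun _ : M => ℝ) p) (t : Fin n → ∀ x, W x),
    IsOpen O → (∀ j, (α j).IsSmooth) → (∀ j, B.IsSmoothSection (t j)) →
    (∀ x ∈ O, ∀ ξ, θ x ξ = ∑ j, α j x ξ • t j x) →
    ∀ x ∈ O, ∀ ξ, Θ x ξ = ∑ j, ((α j).d x ξ • t j x +
      (-1 : ℝ) ^ p • wedge (ContinuousLinearMap.lsmul ℝ ℝ) (α j x) (D.toFun (t j) x) ξ)

/-- The `W`-valued form `Ω s` obtained by applying an `End_A(W)`-valued form to a section. -/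
def endApply {p : ℕ} (Ω : DForm E (fun x => EndA A (W x)) p) (s : ∀ x, W x) : DForm E W p :=
  fun x => (((ContinuousLinearMap.apply ℂ (W x) (s x)) ∘L EndA.incl A (W x)).restrictScalars
    ℝ).compContinuousAlternatingMap (Ω x)

/-- The smooth `End_A(W)`-valued `2`-form `Ω` is the curvature `∇ ∘ ∇` of the connection: for every
smooth section `s`, the extension of `∇` to `1`-forms maps `∇ s` to `Ω s`. -/
def Connection.IsCurvature (D : B.Connection) (Ω : DForm E (fun x => EndA A (W x)) 2) : Prop :=
  B.IsSmoothEndForm Ω ∧ ∀ s, B.IsSmoothSection s →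
    D.Extends (D.toFun s) (endApply Ω s)

end SmoothHilbertBundle

/-- The component of degree `2 k` of the form `ch_τ(Ω) = τ(ev(exp Ω))`. -/
def chernForm {Z : Type*} [NonUnitalCommCStarAlgebra Z] (τ : A →L[ℂ] Z)
    (hτ : ∀ a b : A, τ (a * b) = τ (b * a)) (hW : ∀ x, IsFGP A (W x))
    (Ω : DForm E (fun x => EndA A (W x)) 2) (k : ℕ) : DForm E (fun _ : M => Z) (2 * k) :=
  fun x => ((traceEv τ hτ (hW x)).restrictScalars ℝ).compContinuousAlternatingMap
    (expForm (Ω x) k)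

end Bundles

end

/-!
A frame of the model fibre turns a connection over a trivializing open set into `d + γ`, with `γ` a
`1`-form in the Banach algebra of endomorphisms, and turns `τ ∘ ev` into a trace on that algebra.
The curvature there is `Ω = dγ + γ ∧ γ`. The Bianchi identity `dΩ = Ω ∧ γ - γ ∧ Ω` says that `dΩ` is
a commutator, so `d tr(Ωᵏ) = 0`. Along the affine path `γ + tθ` between two connections the same
computation gives `d/dt tr(Ωᵏ⁺¹) = (k + 1) d tr(Ωᵏ ∧ θ)`. Since `tr(Ωᵏ⁺¹)` is polynomial in `t`, its
increment is a fixed linear combination of values of its derivative, which replaces integration over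
`t`, and so it is exact. As `θ` is a globally defined `End_A(W)`-valued form, so is the
transgression form.
-/

noncomputable section

/-! ## Graded forms with values in a noncommutative ring -/

/-- Inhomogeneous forms: families, indexed by the degree `n`, of functions of `n` vectors in `E`
with values in `R`. No multilinearity is imposed, so that the identities of exterior calculus can be
proved by induction on the degree, contracting with the first vector. -/
def GForm (E R : Type*) := (n : ℕ) → (Fin n → E) → R

namespace GForm

variable {E R C : Type*}

@[ext] lemma ext {f g : GForm E R} (h : ∀ n w, f n w = g n w) : f = g :=
  funext fun n => funext fun w => h n w

/-- The contraction (interior product) with a vector, inserted in the first slot. -/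
def contr (v : E) (f : GForm E R) : GForm E R := fun n w => f (n + 1) (Fin.cons v w)

lemma apply_succ (f : GForm E R) (n : ℕ) (w : Fin (n + 1) → E) :
    f (n + 1) w = contr (w 0) f n (Fin.tail w) := by
  rw [contr, Fin.cons_self_tail]

section AddCommGroup

variable [AddCommGroup R] [AddCommGroup C]

instance : AddCommGroup (GForm E R) :=
  inferInstanceAs (AddCommGroup ((n : ℕ) → (Fin n → E) → R))

instance [Module ℝ R] : Module ℝ (GForm E R) :=
  inferInstanceAs (Module ℝ ((n : ℕ) → (Fin n → E) → R))

@[simp] lemma add_apply (f g : GForm E R) (n : ℕ) (w : Fin n → E) :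
    (f + g) n w = f n w + g n w := rfl
@[simp] lemma sub_apply (f g : GForm E R) (n : ℕ) (w : Fin n → E) :
    (f - g) n w = f n w - g n w := rfl
@[simp] lemma neg_apply (f : GForm E R) (n : ℕ) (w : Fin n → E) : (-f) n w = -f n w := rfl
@[simp] lemma zero_apply (n : ℕ) (w : Fin n → E) : (0 : GForm E R) n w = 0 := rfl
@[simp] lemma smul_apply [Module ℝ R] (c : ℝ) (f : GForm E R) (n : ℕ) (w : Fin n → E) :
    (c • f) n w = c • f n w := rfl

@[simp] lemma contr_add (v : E) (f g : GForm E R) : contr v (f + g) = contr v f + contr v g := rfl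
@[simp] lemma contr_neg (v : E) (f : GForm E R) : contr v (-f) = -contr v f := rfl

/-- The grading involution, which multiplies the component of degree `n` by `(-1) ^ n`. -/
def eps (f : GForm E R) : GForm E R := fun n w => (-1 : ℤ) ^ n • f n w

lemma eps_apply_zero (f : GForm E R) (w : Fin 0 → E) : eps f 0 w = f 0 w := by
  simp [eps]

@[simp] lemma eps_add (f g : GForm E R) : eps (f + g) = eps f + eps g :=
  ext fun _ _ => smul_add _ _ _

@[simp] lemma eps_eps (f : GForm E R) : eps (eps f) = f := by
  ext n w
  simp [eps, smul_smul, ← mul_pow]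

@[simp] lemma contr_eps (v : E) (f : GForm E R) : contr v (eps f) = -eps (contr v f) := by
  ext n w
  simp [contr, eps, pow_succ]

/-- The form with coefficients transformed by an additive map. -/
def map (τ : R →+ C) : GForm E R →+ GForm E C where
  toFun f n w := τ (f n w)
  map_zero' := ext fun _ _ => τ.map_zero
  map_add' _ _ := ext fun _ _ => τ.map_add _ _

lemma map_apply (τ : R →+ C) (f : GForm E R) (n : ℕ) (w : Fin n → E) :
    map τ f n w = τ (f n w) := rfl
lemma contr_map (τ : R →+ C) (v : E) (f : GForm E R) : contr v (map τ f) = map τ (contr v f) := rfl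

/-- The alternation `w ↦ ∑ᵢ (-1)ⁱ L (wᵢ) (w₀, …, ŵᵢ, …)` of a family of forms depending on a vector.
For `L v` the derivative of a form in the direction `v` this is the exterior derivative. -/
def alt (L : E → GForm E R) : GForm E R
  | 0, _ => 0
  | n + 1, w => ∑ i : Fin (n + 1), (-1 : ℤ) ^ (i : ℕ) • L (w i) n (i.removeNth w)

lemma alt_apply_zero (L : E → GForm E R) (w : Fin 0 → E) : alt L 0 w = 0 := rfl

lemma alt_apply_succ (L : E → GForm E R) (n : ℕ) (w : Fin (n + 1) → E) :
    alt L (n + 1) w = ∑ i : Fin (n + 1), (-1 : ℤ) ^ (i : ℕ) • L (w i) n (i.removeNth w) := rfl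

lemma removeNth_succ_cons {n : ℕ} (v : E) (w : Fin (n + 1) → E) (i : Fin (n + 1)) :
    i.succ.removeNth (Fin.cons v w : Fin (n + 2) → E) = Fin.cons v (i.removeNth w) := by
  funext j
  refine Fin.cases ?_ (fun j => ?_) j <;> simp [Fin.removeNth]

/-- With `L` the derivative of a form this is Cartan's formula `ι_v d = ∂_v - d ι_v`. -/
@[simp] lemma contr_alt (v : E) (L : E → GForm E R) :
    contr v (alt L) = L v - alt fun u => contr v (L u) := by
  ext n w
  rw [contr, alt_apply_succ, Fin.sum_univ_succ, sub_apply, sub_eq_add_neg]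
  congr 1
  · simp only [Fin.val_zero, pow_zero, one_smul, Fin.cons_zero]
    rfl
  · cases n with
    | zero => simp [alt_apply_zero]
    | succ n =>
      simp only [alt_apply_succ, Fin.val_succ, pow_succ, mul_neg, mul_one, neg_smul,
        Finset.sum_neg_distrib, Fin.cons_succ, removeNth_succ_cons]
      rfl

lemma alt_add (L L' : E → GForm E R) : alt (fun v => L v + L' v) = alt L + alt L' := by
  ext n w
  cases n with
  | zero => simp [alt_apply_zero]
  | succ n => simp [alt_apply_succ, Finset.sum_add_distrib]

lemma eps_alt (L : E → GForm E R) : eps (alt L) = -alt fun v => eps (L v) := by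
  ext n w
  cases n with
  | zero => simp [eps_apply_zero, alt_apply_zero]
  | succ n =>
    simp only [eps, neg_apply, alt_apply_succ, Finset.smul_sum, ← Finset.sum_neg_distrib, smul_smul,
      pow_succ', neg_mul, one_mul, mul_neg, neg_smul, mul_comm]

end AddCommGroup

section Ring

variable [Ring R]

/-- The graded product of forms, defined so that contractions are graded derivations. -/
def gmul : (n : ℕ) → GForm E R → GForm E R → (Fin n → E) → R
  | 0, f, g, w => f 0 w * g 0 w
  | n + 1, f, g, w =>
    gmul n (contr (w 0) f) g (Fin.tail w) + gmul n (eps f) (contr (w 0) g) (Fin.tail w)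

instance : Mul (GForm E R) := ⟨fun f g n w => gmul n f g w⟩

instance : One (GForm E R) := ⟨fun n _ => if n = 0 then 1 else 0⟩

lemma mul_apply_zero (f g : GForm E R) (w : Fin 0 → E) : (f * g) 0 w = f 0 w * g 0 w := rfl

@[simp] lemma contr_mul (v : E) (f g : GForm E R) :
    contr v (f * g) = contr v f * g + eps f * contr v g := by
  ext n w
  change gmul (n + 1) f g (Fin.cons v w) = gmul n (contr v f) g w + gmul n (eps f) (contr v g) w
  rw [gmul, Fin.cons_zero, Fin.tail_cons]

@[simp] lemma contr_one (v : E) : contr v (1 : GForm E R) = 0 := by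
  ext n w
  change (if n + 1 = 0 then (1 : R) else 0) = 0
  exact if_neg n.succ_ne_zero

@[simp] lemma eps_one : eps (1 : GForm E R) = 1 := by
  ext n w
  change (-1 : ℤ) ^ n • (if n = 0 then (1 : R) else 0) = if n = 0 then 1 else 0
  split_ifs with h <;> simp [h]

instance : Distrib (GForm E R) where
  left_distrib f g h := by
    ext n w
    induction n generalizing f g h with
    | zero => exact mul_add _ _ _
    | succ n ih =>
      simp only [apply_succ _ n w, contr_add, contr_mul, add_apply, ih]
      abel
  right_distrib f g h := by
    ext n w
    induction n generalizing f g h with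
    | zero => exact add_mul _ _ _
    | succ n ih =>
      simp only [apply_succ _ n w, contr_add, contr_mul, eps_add, add_apply, ih]
      abel

instance : NonUnitalNonAssocRing (GForm E R) :=
  { (inferInstance : AddCommGroup (GForm E R)), (inferInstance : Distrib (GForm E R)) with
    zero_mul := fun f => by simpa using add_mul (0 : GForm E R) 0 f
    mul_zero := fun f => by simpa using mul_add f 0 0 }

@[simp] lemma eps_mul (f g : GForm E R) : eps (f * g) = eps f * eps g := by
  ext n w
  induction n generalizing f g with
  | zero => simp [mul_apply_zero, eps_apply_zero]
  | succ n ih =>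
    simp only [apply_succ _ n w, contr_eps, contr_mul, eps_add, add_apply, neg_apply, ih, eps_eps,
      neg_mul, mul_neg]
    abel

instance : Ring (GForm E R) :=
  { (inferInstance : NonUnitalNonAssocRing (GForm E R)) with
    mul_assoc := fun f g h => by
      ext n w
      induction n generalizing f g h with
      | zero => exact mul_assoc _ _ _
      | succ n ih =>
        simp only [apply_succ _ n w, contr_mul, add_apply, eps_mul, add_mul, mul_add, ih]
        abel
    one_mul := fun f => by
      ext n w
      induction n generalizing f with
      | zero => exact one_mul _
      | succ n ih => simp only [apply_succ _ n w, contr_mul, contr_one, zero_mul, zero_add, eps_one,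
          ih]
    mul_one := fun f => by
      ext n w
      induction n generalizing f with
      | zero => exact mul_one _
      | succ n ih => simp only [apply_succ _ n w, contr_mul, contr_one, mul_zero, add_zero, ih] }

lemma eps_pow {f : GForm E R} (hf : eps f = f) (k : ℕ) : eps (f ^ k) = f ^ k := by
  induction k with
  | zero => simp
  | succ k ih => rw [pow_succ, eps_mul, ih, hf]

lemma smul_mul [Module ℝ R] [IsScalarTower ℝ R R] (c : ℝ) (f g : GForm E R) :
    (c • f) * g = c • (f * g) := by
  have contr_smul (v : E) (f : GForm E R) : contr v (c • f) = c • contr v f := rfl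
  have eps_smul (f : GForm E R) : eps (c • f) = c • eps f := ext fun _ _ => smul_comm _ _ _
  ext n w
  induction n generalizing f g with
  | zero => exact smul_mul_assoc _ _ _
  | succ n ih => simp [apply_succ _ n w, contr_smul, eps_smul, ih]

lemma alt_mul (L : E → GForm E R) (g : GForm E R) : alt (fun v => L v * g) = alt L * g := by
  ext n w
  induction n generalizing L g with
  | zero => simp [alt_apply_zero, mul_apply_zero]
  | succ n ih =>
    simp only [apply_succ _ n w, contr_alt, contr_mul, alt_add, eps_alt, sub_apply, add_apply, ih,
      sub_mul, neg_mul, neg_apply]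
    abel

lemma alt_mul_left (f : GForm E R) (L : E → GForm E R) :
    alt (fun v => f * L v) = eps f * alt L := by
  ext n w
  induction n generalizing f L with
  | zero => simp [alt_apply_zero, mul_apply_zero]
  | succ n ih =>
    simp only [apply_succ _ n w, contr_alt, contr_mul, alt_add, contr_eps, eps_eps, sub_apply,
      add_apply, ih, mul_sub, neg_mul, neg_apply]
    abel

section Trace

variable [AddCommGroup C] (τ : R →+ C) (hτ : ∀ a b, τ (a * b) = τ (b * a))
include hτ

lemma map_mul_apply_comm (n : ℕ) (w : Fin n → E) (f g : GForm E R) :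
    (eps f = f → map τ (f * g) n w = map τ (g * f) n w) ∧
    (eps f = -f → map τ (f * g) n w = map τ (eps g * f) n w) := by
  induction n generalizing f g with
  | zero => simp [map_apply, mul_apply_zero, hτ (f 0 w), eps_apply_zero]
  | succ n ih =>
    have odd_of_even (h : eps f = f) : eps (contr (w 0) f) = -contr (w 0) f := by
      rw [← neg_eq_iff_eq_neg, ← contr_eps, h]
    have even_of_odd (h : eps f = -f) : eps (contr (w 0) f) = contr (w 0) f := by
      rw [← neg_inj, ← contr_eps, h, contr_neg]
    constructor <;> intro h
    · have comm_contr_left := (ih (Fin.tail w) (contr (w 0) f) g).2 (odd_of_even h)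
      have comm_contr_right := (ih (Fin.tail w) f (contr (w 0) g)).1 h
      simp only [apply_succ _ n w, contr_map, contr_mul, map_add, add_apply, h,
        comm_contr_left, comm_contr_right]
      abel
    · have comm_contr_left := (ih (Fin.tail w) (contr (w 0) f) g).1 (even_of_odd h)
      have comm_contr_right := (ih (Fin.tail w) f (contr (w 0) g)).2 h
      simp only [apply_succ _ n w, contr_map, contr_mul, map_add, add_apply, h,
        comm_contr_left, comm_contr_right, neg_mul, map_neg, neg_apply, contr_eps, eps_eps]
      abel

lemma map_mul_comm_of_even {f : GForm E R} (hf : eps f = f) (g : GForm E R) :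
    map τ (f * g) = map τ (g * f) :=
  ext fun n w => (map_mul_apply_comm τ hτ n w f g).1 hf

lemma map_mul_comm_of_odd {f : GForm E R} (hf : eps f = -f) (g : GForm E R) :
    map τ (f * g) = map τ (eps g * f) :=
  ext fun n w => (map_mul_apply_comm τ hτ n w f g).2 hf

end Trace

end Ring

end GForm

local infixr:70 " ⋏ " => wedge (ContinuousLinearMap.mul ℝ _)

lemma sum_perm_eq_sum_cons {T X : Type*} [AddCommGroup X] {n : ℕ} (F : (Fin (n + 1) → T) → X)
    (w : Fin (n + 1) → T) :
    ∑ σ : Equiv.Perm (Fin (n + 1)), Equiv.Perm.sign σ • F (w ∘ σ) =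
      ∑ i : Fin (n + 1), (-1 : ℤ) ^ (i : ℕ) • ∑ e : Equiv.Perm (Fin n),
        Equiv.Perm.sign e • F (Fin.cons (w i) (i.removeNth w ∘ e)) := by
  let sorted : Fin (n + 1) × Equiv.Perm (Fin n) → Equiv.Perm (Fin (n + 1)) := fun a =>
    a.1.cycleRange.symm * Equiv.Perm.decomposeFin.symm (0, a.2)
  have sorted_zero (a) : sorted a 0 = a.1 := by
    simp [sorted]
  have sorted_injective : Function.Injective sorted := by
    rintro ⟨i, e⟩ ⟨j, e'⟩ h
    obtain rfl : i = j := by simpa only [sorted_zero] using congrArg (· 0) h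
    simpa using Equiv.Perm.decomposeFin.symm.injective (mul_left_cancel h)
  have sorted_bijective : Function.Bijective sorted :=
    (Fintype.bijective_iff_injective_and_card _).2
      ⟨sorted_injective, by simp [Fintype.card_perm, Nat.factorial_succ]⟩
  rw [← sorted_bijective.sum_comp, Fintype.sum_prod_type]
  refine Finset.sum_congr rfl fun i _ => ?_
  rw [Finset.smul_sum]
  refine Finset.sum_congr rfl fun e _ => ?_
  have comp_sorted : w ∘ sorted (i, e) = Fin.cons (w i) (i.removeNth w ∘ e) := by
    funext j
    refine Fin.cases ?_ (fun j => ?_) j <;> simp [sorted, Fin.removeNth]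
  have sign_sorted : Equiv.Perm.sign (sorted (i, e)) = (-1) ^ (i : ℕ) * Equiv.Perm.sign e := by
    simp [sorted, Fin.sign_cycleRange, Equiv.Perm.decomposeFin.symm_sign]
  rw [comp_sorted, sign_sorted, ← smul_smul]
  simp [Units.smul_def]

namespace GForm

variable {E F R : Type*} [NormedAddCommGroup E] [NormedSpace ℝ E] [NormedAddCommGroup F]
  [NormedSpace ℝ F] [NormedRing R] [NormedAlgebra ℝ R] {p q : ℕ}

/-- An alternating map of degree `p`, as a form which vanishes in all other degrees. -/
def hat (α : E [⋀^Fin p]→L[ℝ] F) : GForm E F :=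
  fun n w => if h : n = p then α (w ∘ Fin.cast h.symm) else 0

@[simp] lemma hat_apply (α : E [⋀^Fin p]→L[ℝ] F) (w : Fin p → E) : hat α p w = α w := by
  simp [hat]

lemma hat_apply_of_ne (α : E [⋀^Fin p]→L[ℝ] F) {n : ℕ} (h : n ≠ p) (w : Fin n → E) :
    hat α n w = 0 := dif_neg h

lemma hat_injective : Function.Injective (hat : E [⋀^Fin p]→L[ℝ] F → GForm E F) :=
  fun α β h => ContinuousAlternatingMap.ext fun w => by rw [← hat_apply α, h, hat_apply]

lemma hat_eq_iff {α : E [⋀^Fin p]→L[ℝ] F} {g : GForm E F} :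
    hat α = g ↔ (∀ w, α w = g p w) ∧ ∀ n, n ≠ p → ∀ w, g n w = 0 := by
  refine ⟨?_, fun h => ?_⟩
  · rintro rfl
    exact ⟨fun w => (hat_apply α w).symm, fun n hn w => hat_apply_of_ne α hn w⟩
  · ext n w
    obtain rfl | hn := eq_or_ne n p
    · rw [hat_apply, h.1]
    · rw [hat_apply_of_ne α hn, h.2 n hn]

lemma hat_add (α β : E [⋀^Fin p]→L[ℝ] F) : hat (α + β) = hat α + hat β :=
  hat_eq_iff.2 ⟨fun w => by simp, fun n hn w => by simp [hat_apply_of_ne _ hn]⟩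

lemma hat_smul (c : ℝ) (α : E [⋀^Fin p]→L[ℝ] F) : hat (c • α) = c • hat α :=
  hat_eq_iff.2 ⟨fun w => by simp, fun n hn w => by simp [hat_apply_of_ne _ hn]⟩

lemma hat_zero : hat (0 : E [⋀^Fin p]→L[ℝ] F) = 0 :=
  hat_eq_iff.2 ⟨fun _ => rfl, fun _ _ _ => rfl⟩

lemma eps_hat (α : E [⋀^Fin p]→L[ℝ] F) : eps (hat α) = (-1 : ℝ) ^ p • hat α := by
  ext n w
  obtain rfl | hn := eq_or_ne n p
  · simp [eps, ← Int.cast_smul_eq_zsmul ℝ]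
  · simp [eps, hat_apply_of_ne α hn]

lemma map_hat {G : Type*} [NormedAddCommGroup G] [NormedSpace ℝ G] (T : F →L[ℝ] G)
    (α : E [⋀^Fin p]→L[ℝ] F) :
    map (T : F →+ G) (hat α) = hat (T.compContinuousAlternatingMap α) :=
  (hat_eq_iff.2 ⟨fun w => by simp [map_apply],
    fun n hn w => by simp [map_apply, hat_apply_of_ne α hn]⟩).symm

lemma hat_constOfIsEmpty_one :
    hat (ContinuousAlternatingMap.constOfIsEmpty ℝ E (Fin 0) (1 : R)) = 1 :=
  hat_eq_iff.2 ⟨fun _ => rfl, fun _ hn _ => if_neg hn⟩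

lemma hat_alternatizeUncurryFin (L : E →L[ℝ] E [⋀^Fin p]→L[ℝ] F) :
    hat (ContinuousAlternatingMap.alternatizeUncurryFin L) = alt fun v => hat (L v) := by
  refine hat_eq_iff.2 ⟨fun w => ?_, fun n hn w => ?_⟩
  · simp only [alt_apply_succ, hat_apply, ContinuousAlternatingMap.alternatizeUncurryFin_apply]
  · cases n with
    | zero => rfl
    | succ n => simp [alt_apply_succ, hat_apply_of_ne _ (show n ≠ p by lia)]

lemma alt_hat_curryLeft (α : E [⋀^Fin (p + 1)]→L[ℝ] F) :
    alt (fun v => hat (α.curryLeft v)) = ((p + 1 : ℕ) : ℝ) • hat α := by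
  rw [← hat_alternatizeUncurryFin, ContinuousAlternatingMap.alternatizeUncurryFin_curryLeft,
    ← Nat.cast_smul_eq_nsmul ℝ, hat_smul]

lemma hat_wedge_apply (α : E [⋀^Fin p]→L[ℝ] R) (β : E [⋀^Fin q]→L[ℝ] R) {n : ℕ} (h : n = p + q)
    (w : Fin n → E) :
    hat (α ⋏ β) n w = (p.factorial * q.factorial : ℝ)⁻¹ • ∑ σ : Equiv.Perm (Fin n),
      Equiv.Perm.sign σ • (α (fun k => (w ∘ σ) (Fin.cast h.symm (Fin.castAdd q k))) *
        β (fun k => (w ∘ σ) (Fin.cast h.symm (Fin.natAdd p k)))) := by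
  subst h
  rw [hat_apply]
  simp only [wedge, ContinuousAlternatingMap.smul_apply,
    ContinuousMultilinearMap.alternatization_apply_apply]
  rfl

lemma hat_zero_form_mul (α : E [⋀^Fin 0]→L[ℝ] R) (g : GForm E R) (n : ℕ) (w : Fin n → E) :
    (hat α * g) n w = α Fin.elim0 * g n w := by
  have contr_hat (v : E) : contr v (hat α) = 0 := ext fun n _ => hat_apply_of_ne α n.succ_ne_zero _
  have eps_hat : eps (hat α) = hat α := by simp [eps_hat]
  induction n generalizing g with
  | zero => rw [mul_apply_zero, hat_apply, Subsingleton.elim w Fin.elim0]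
  | succ n ih =>
    simp only [apply_succ _ n w, contr_mul, contr_hat, zero_mul, zero_add, eps_hat, ih]

lemma hat_wedge_of_isEmpty (α : E [⋀^Fin 0]→L[ℝ] R) (β : E [⋀^Fin q]→L[ℝ] R) :
    hat (α ⋏ β) = hat α * hat β := by
  ext n w
  rw [hat_zero_form_mul]
  obtain rfl | hn := eq_or_ne n q
  · have right_slots (u : Fin n → E) :
        (fun k => u (Fin.cast (zero_add n) (Fin.natAdd 0 k))) = u := by
      funext k
      exact congrArg u (Fin.ext (zero_add _))
    have summand (σ : Equiv.Perm (Fin n)) : Equiv.Perm.sign σ •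
        (α (fun k => (w ∘ σ) (Fin.cast (zero_add n) (Fin.castAdd n k))) *
          β (fun k => (w ∘ σ) (Fin.cast (zero_add n) (Fin.natAdd 0 k)))) =
        α Fin.elim0 * β w := by
      have map_perm : β (w ∘ σ) = Equiv.Perm.sign σ • β w := β.toAlternatingMap.map_perm w σ
      rw [right_slots, map_perm, mul_smul_comm, smul_smul, Int.units_mul_self, one_smul,
        Subsingleton.elim (fun _ => _) Fin.elim0]
    rw [hat_wedge_apply α β (zero_add n).symm, Finset.sum_congr rfl fun σ _ => summand σ,
      Finset.sum_const, Finset.card_univ, Fintype.card_perm, Fintype.card_fin, hat_apply,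
      ← Nat.cast_smul_eq_nsmul ℝ, smul_smul, Nat.factorial_zero, Nat.cast_one, one_mul,
      inv_mul_cancel₀ (Nat.cast_ne_zero.2 n.factorial_ne_zero), one_smul]
  · rw [hat_apply_of_ne _ (by lia), hat_apply_of_ne _ hn, mul_zero]

lemma hat_wedge_succ (α : E [⋀^Fin (p + 1)]→L[ℝ] R) (β : E [⋀^Fin q]→L[ℝ] R) :
    ((p + 1 : ℕ) : ℝ) • hat (α ⋏ β) = alt fun v => hat (α.curryLeft v ⋏ β) := by
  ext n w
  obtain h | h := eq_or_ne n (p + 1 + q)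
  · obtain ⟨n, rfl⟩ : ∃ m, n = m + 1 := ⟨p + q, by lia⟩
    have h' : n = p + q := by lia
    have left_cons (v : E) (u : Fin n → E) :
        (fun k => (Fin.cons v u : Fin (n + 1) → E) (Fin.cast h.symm (Fin.castAdd q k))) =
          Fin.cons v fun k => u (Fin.cast h'.symm (Fin.castAdd q k)) := by
      funext k
      refine Fin.cases ?_ (fun k => ?_) k <;> rfl
    have right_cons (v : E) (u : Fin n → E) :
        (fun k => (Fin.cons v u : Fin (n + 1) → E) (Fin.cast h.symm (Fin.natAdd (p + 1) k))) =
          fun k => u (Fin.cast h'.symm (Fin.natAdd p k)) := by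
      funext k
      have cast_natAdd_succ : Fin.cast h.symm (Fin.natAdd (p + 1) k) =
          (Fin.cast h'.symm (Fin.natAdd p k)).succ := Fin.ext (Nat.add_right_comm p 1 k)
      rw [cast_natAdd_succ, Fin.cons_succ]
    simp only [smul_apply, alt_apply_succ, hat_wedge_apply _ _ h, hat_wedge_apply _ _ h']
    rw [sum_perm_eq_sum_cons fun u => α (fun k => u (Fin.cast h.symm (Fin.castAdd q k))) *
        β (fun k => u (Fin.cast h.symm (Fin.natAdd (p + 1) k)))]
    simp only [left_cons, right_cons]
    rw [smul_smul, Finset.smul_sum]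
    refine Finset.sum_congr rfl fun i _ => ?_
    rw [smul_comm]
    congr 2
    rw [Nat.factorial_succ]; push_cast; field_simp
  · rw [smul_apply, hat_apply_of_ne _ h, smul_zero]
    cases n with
    | zero => rfl
    | succ n => simp [alt_apply_succ, hat_apply_of_ne _ (show n ≠ p + q by lia)]

lemma hat_wedge (α : E [⋀^Fin p]→L[ℝ] R) (β : E [⋀^Fin q]→L[ℝ] R) :
    hat (α ⋏ β) = hat α * hat β := by
  induction p with
  | zero => exact hat_wedge_of_isEmpty α β
  | succ p ih =>
    refine smul_right_injective _ (Nat.cast_ne_zero.2 p.succ_ne_zero : ((p + 1 : ℕ) : ℝ) ≠ 0) ?_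
    simp only [hat_wedge_succ, ih, alt_mul, alt_hat_curryLeft, smul_mul]

lemma hat_wedgePow (Φ : E [⋀^Fin 2]→L[ℝ] R) (k : ℕ) : hat (wedgePow Φ k) = hat Φ ^ k := by
  induction k with
  | zero => rw [pow_zero]; exact hat_constOfIsEmpty_one
  | succ k ih =>
    rw [pow_succ, ← ih]
    exact hat_wedge (wedgePow Φ k) Φ

end GForm

/-! ## Wedge products -/

section Wedge

variable {T T' F G H : Type*} [AddCommGroup T] [Module ℝ T] [TopologicalSpace T]
  [AddCommGroup T'] [Module ℝ T'] [TopologicalSpace T']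
  [NormedAddCommGroup F] [NormedSpace ℝ F] [NormedAddCommGroup G] [NormedSpace ℝ G]
  [NormedAddCommGroup H] [NormedSpace ℝ H] {R : Type*} [NormedRing R] [NormedAlgebra ℝ R]
  {p q : ℕ} (B : F →L[ℝ] G →L[ℝ] H)

lemma wedge_apply (α : T [⋀^Fin p]→L[ℝ] F) (β : T [⋀^Fin q]→L[ℝ] G) (v : Fin (p + q) → T) :
    wedge B α β v = (p.factorial * q.factorial : ℝ)⁻¹ • ∑ σ : Equiv.Perm (Fin (p + q)),
      Equiv.Perm.sign σ • B (α fun i => v (σ (Fin.castAdd q i)))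
        (β fun i => v (σ (Fin.natAdd p i))) := by
  simp only [wedge, ContinuousAlternatingMap.smul_apply,
    ContinuousMultilinearMap.alternatization_apply_apply]
  rfl

/-- The wedge product with respect to a pairing `B`, as a bilinear map. -/
def wedgeₗ : T [⋀^Fin p]→L[ℝ] F →ₗ[ℝ] T [⋀^Fin q]→L[ℝ] G →ₗ[ℝ] T [⋀^Fin (p + q)]→L[ℝ] H :=
  LinearMap.mk₂ ℝ (wedge B)
    (fun α α' β => by ext v; simp [wedge_apply, Finset.sum_add_distrib])
    (fun c α β => by ext v; simp [wedge_apply, Finset.smul_sum, smul_comm c])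
    (fun α β β' => by ext v; simp [wedge_apply, Finset.sum_add_distrib])
    (fun c α β => by ext v; simp [wedge_apply, Finset.smul_sum, smul_comm c])

lemma wedge_compContinuousLinearMap (α : T [⋀^Fin p]→L[ℝ] F) (β : T [⋀^Fin q]→L[ℝ] G)
    (L : T' →L[ℝ] T) : (wedge B α β).compContinuousLinearMap L =
      wedge B (α.compContinuousLinearMap L) (β.compContinuousLinearMap L) := by
  ext v
  simp only [ContinuousAlternatingMap.compContinuousLinearMap_apply, wedge_apply]
  rfl

lemma wedgePow_compContinuousLinearMap (Φ : T [⋀^Fin 2]→L[ℝ] R) (L : T' →L[ℝ] T) (k : ℕ) :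
    (wedgePow Φ k).compContinuousLinearMap L = wedgePow (Φ.compContinuousLinearMap L) k := by
  induction k with
  | zero => rfl
  | succ k ih =>
    rw [wedgePow, wedgePow, ← ih]
    exact wedge_compContinuousLinearMap _ _ _ _

lemma wedge_apply_one_one (α : T [⋀^Fin 1]→L[ℝ] F) (β : T [⋀^Fin 1]→L[ℝ] G) (v : Fin 2 → T) :
    wedge B α β v = B (α fun _ => v 0) (β fun _ => v 1) - B (α fun _ => v 1) (β fun _ => v 0) := by
  have perms : (Finset.univ : Finset (Equiv.Perm (Fin (1 + 1)))) = {1, Equiv.swap 0 1} := by decide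
  have left_slot (σ : Equiv.Perm (Fin (1 + 1))) :
      (fun i : Fin 1 => v (σ (Fin.castAdd 1 i))) = fun _ => v (σ 0) := by
    funext i; fin_cases i; rfl
  have right_slot (σ : Equiv.Perm (Fin (1 + 1))) :
      (fun i : Fin 1 => v (σ (Fin.natAdd 1 i))) = fun _ => v (σ 1) := by
    funext i; fin_cases i; rfl
  rw [wedge_apply B α β v, perms, Finset.sum_pair (by decide), left_slot, right_slot, left_slot,
    right_slot]
  simp [sub_eq_add_neg]

end Wedge

section WedgeNormed

variable {E F G H X : Type*} [NormedAddCommGroup E] [NormedSpace ℝ E]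
  [NormedAddCommGroup F] [NormedSpace ℝ F] [NormedAddCommGroup G] [NormedSpace ℝ G]
  [NormedAddCommGroup H] [NormedSpace ℝ H] [NormedAddCommGroup X] [NormedSpace ℝ X]
  {R : Type*} [NormedRing R] [NormedAlgebra ℝ R] {p q : ℕ} (B : F →L[ℝ] G →L[ℝ] H)

lemma norm_wedge_le (α : E [⋀^Fin p]→L[ℝ] F) (β : E [⋀^Fin q]→L[ℝ] G) :
    ‖wedge B α β‖ ≤ (p.factorial * q.factorial : ℝ)⁻¹ * ((p + q).factorial * ‖B‖) * ‖α‖ * ‖β‖ := by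
  refine ContinuousAlternatingMap.opNorm_le_bound _ (by positivity) fun v => ?_
  have summand (σ : Equiv.Perm (Fin (p + q))) :
      ‖Equiv.Perm.sign σ • B (α fun i => v (σ (Fin.castAdd q i)))
        (β fun i => v (σ (Fin.natAdd p i)))‖ ≤ ‖B‖ * ‖α‖ * ‖β‖ * ∏ i, ‖v i‖ := by
    have norm_sign_smul (x : H) : ‖Equiv.Perm.sign σ • x‖ = ‖x‖ := by
      rcases Int.units_eq_one_or (Equiv.Perm.sign σ) with h | h <;> simp [h]
    have prod_slots : ∏ i, ‖v i‖ = (∏ i, ‖v (σ (Fin.castAdd q i))‖) *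
        ∏ i, ‖v (σ (Fin.natAdd p i))‖ := by
      rw [← Fin.prod_univ_add (fun i => ‖v (σ i)‖), Equiv.prod_comp σ fun i => ‖v i‖]
    rw [norm_sign_smul]
    calc _ ≤ ‖B‖ * ‖α fun i => v (σ (Fin.castAdd q i))‖ * ‖β fun i => v (σ (Fin.natAdd p i))‖ :=
          B.le_opNorm₂ _ _
      _ ≤ ‖B‖ * (‖α‖ * ∏ i, ‖v (σ (Fin.castAdd q i))‖) *
            (‖β‖ * ∏ i, ‖v (σ (Fin.natAdd p i))‖) := by
          gcongr <;> exact ContinuousAlternatingMap.le_opNorm _ _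
      _ = _ := by rw [prod_slots]; ring
  rw [wedge_apply, norm_smul, Real.norm_of_nonneg (by positivity)]
  refine (mul_le_mul_of_nonneg_left (norm_sum_le_of_le _ fun σ _ => summand σ)
    (by positivity)).trans_eq ?_
  rw [Finset.sum_const, Finset.card_univ, Fintype.card_perm, Fintype.card_fin, nsmul_eq_mul]
  ring

/-- The wedge product with respect to a pairing `B` of forms on a normed space, as a continuous
bilinear map. -/
def wedgeL : E [⋀^Fin p]→L[ℝ] F →L[ℝ] E [⋀^Fin q]→L[ℝ] G →L[ℝ] E [⋀^Fin (p + q)]→L[ℝ] H :=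
  (wedgeₗ B).mkContinuous₂ ((p.factorial * q.factorial : ℝ)⁻¹ * ((p + q).factorial * ‖B‖))
    fun α β => norm_wedge_le B α β

variable {B} {n : ℕ∞ω} {N : Set X}

lemma contDiffOn_wedge {α : X → E [⋀^Fin p]→L[ℝ] F} {β : X → E [⋀^Fin q]→L[ℝ] G}
    (hα : ContDiffOn ℝ n α N) (hβ : ContDiffOn ℝ n β N) :
    ContDiffOn ℝ n (fun y => wedge B (α y) (β y)) N := by
  have contDiff_wedgeL : ContDiff ℝ n (wedgeL (E := E) (p := p) (q := q) B) :=
    ContinuousLinearMap.contDiff _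
  exact (contDiff_wedgeL.comp_contDiffOn hα).clm_apply hβ

lemma contDiffOn_wedgePow {Φ : X → E [⋀^Fin 2]→L[ℝ] R} (hΦ : ContDiffOn ℝ n Φ N) (k : ℕ) :
    ContDiffOn ℝ n (fun y => wedgePow (Φ y) k) N := by
  induction k with
  | zero => exact contDiffOn_const
  | succ k ih => exact contDiffOn_wedge ih hΦ

lemma hasFDerivAt_wedge {α : X → E [⋀^Fin p]→L[ℝ] F} {β : X → E [⋀^Fin q]→L[ℝ] G}
    {α' : X →L[ℝ] E [⋀^Fin p]→L[ℝ] F} {β' : X →L[ℝ] E [⋀^Fin q]→L[ℝ] G} {y : X}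
    (hα : HasFDerivAt α α' y) (hβ : HasFDerivAt β β' y) :
    HasFDerivAt (fun z => wedge B (α z) (β z))
      ((wedgeL B).precompR X (α y) β' + (wedgeL B).precompL X α' (β y)) y :=
  (wedgeL B).hasFDerivAt_of_bilinear hα hβ

lemma differentiableAt_wedge {α : X → E [⋀^Fin p]→L[ℝ] F} {β : X → E [⋀^Fin q]→L[ℝ] G} {y : X}
    (hα : DifferentiableAt ℝ α y) (hβ : DifferentiableAt ℝ β y) :
    DifferentiableAt ℝ (fun z => wedge B (α z) (β z)) y :=
  (hasFDerivAt_wedge hα.hasFDerivAt hβ.hasFDerivAt).differentiableAt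

lemma hasDerivAt_wedge {α : ℝ → E [⋀^Fin p]→L[ℝ] F} {β : ℝ → E [⋀^Fin q]→L[ℝ] G}
    {α' : E [⋀^Fin p]→L[ℝ] F} {β' : E [⋀^Fin q]→L[ℝ] G} {t : ℝ}
    (hα : HasDerivAt α α' t) (hβ : HasDerivAt β β' t) :
    HasDerivAt (fun s => wedge B (α s) (β s)) (wedge B (α t) β' + wedge B α' (β t)) t :=
  (wedgeL B).hasDerivAt_of_bilinear (fun _ => hα) fun _ => hβ

lemma differentiableAt_wedgePow {Φ : X → E [⋀^Fin 2]→L[ℝ] R} {y : X}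
    (hΦ : DifferentiableAt ℝ Φ y) (k : ℕ) :
    DifferentiableAt ℝ (fun z => wedgePow (Φ z) k) y := by
  induction k with
  | zero => exact differentiableAt_const _
  | succ k ih => exact differentiableAt_wedge ih hΦ

lemma contDiffOn_extDeriv {N : Set E} (hN : IsOpen N) {α : E → E [⋀^Fin p]→L[ℝ] F}
    (hα : ContDiffOn ℝ ∞ α N) : ContDiffOn ℝ ∞ (extDeriv α) N :=
  (ContinuousAlternatingMap.alternatizeUncurryFinCLM ℝ E F).contDiff.comp_contDiffOn
    (hα.fderiv_of_isOpen hN (by simp))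

lemma extDeriv_compContinuousAlternatingMap (T : F →L[ℝ] G) {α : E → E [⋀^Fin p]→L[ℝ] F} {y : E}
    (hα : DifferentiableAt ℝ α y) :
    extDeriv (fun z => T.compContinuousAlternatingMap (α z)) y =
      T.compContinuousAlternatingMap (extDeriv α y) := by
  have fderiv_eq : fderiv ℝ (fun z => T.compContinuousAlternatingMap (α z)) y =
      (ContinuousLinearMap.compContinuousAlternatingMapCLM ℝ E F G (Fin p) T).comp
        (fderiv ℝ α y) :=
    ((ContinuousLinearMap.compContinuousAlternatingMapCLM ℝ E F G (Fin p) T).hasFDerivAt.comp y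
      hα.hasFDerivAt).fderiv
  ext v
  simp [extDeriv, fderiv_eq, ContinuousAlternatingMap.alternatizeUncurryFin_apply]

end WedgeNormed

/-! ## Chern–Weil theory in a vector space -/

namespace GForm

variable {E R Z : Type*} [NormedAddCommGroup E] [NormedSpace ℝ E] [NormedRing R] [NormedAlgebra ℝ R]
  [NormedAddCommGroup Z] [NormedSpace ℝ Z] {p q : ℕ} {y : E}

lemma hat_extDeriv (α : E → E [⋀^Fin p]→L[ℝ] R) (y : E) :
    hat (extDeriv α y) = alt fun v => hat (fderiv ℝ α y v) :=
  hat_alternatizeUncurryFin _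

lemma hat_extDeriv_wedge {α : E → E [⋀^Fin p]→L[ℝ] R} {β : E → E [⋀^Fin q]→L[ℝ] R}
    (hα : DifferentiableAt ℝ α y) (hβ : DifferentiableAt ℝ β y) :
    hat (extDeriv (fun z => α z ⋏ β z) y) =
      hat (extDeriv α y) * hat (β y) + eps (hat (α y)) * hat (extDeriv β y) := by
  have leibniz (v : E) : hat (fderiv ℝ (fun z => α z ⋏ β z) y v) =
      hat (α y) * hat (fderiv ℝ β y v) + hat (fderiv ℝ α y v) * hat (β y) := by
    rw [(hasFDerivAt_wedge hα.hasFDerivAt hβ.hasFDerivAt).fderiv, ← hat_wedge, ← hat_wedge,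
      ← hat_add]
    rfl
  rw [hat_extDeriv, hat_extDeriv, hat_extDeriv, funext leibniz, alt_add, alt_mul, alt_mul_left,
    add_comm]

end GForm

section ChernWeil

variable {E R Z : Type*} [NormedAddCommGroup E] [NormedSpace ℝ E] [NormedRing R] [NormedAlgebra ℝ R]
  [NormedAddCommGroup Z] [NormedSpace ℝ Z]

/-- The curvature `dγ + γ ∧ γ` of the connection `d + γ` on the trivial bundle over `E`. -/
def formCurvature (γ : E → E [⋀^Fin 1]→L[ℝ] R) (y : E) : E [⋀^Fin 2]→L[ℝ] R :=
  extDeriv γ y + γ y ⋏ γ y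

variable {γ θ : E → E [⋀^Fin 1]→L[ℝ] R} {y : E}

lemma differentiableAt_extDeriv {p : ℕ} {α : E → E [⋀^Fin p]→L[ℝ] R} (hα : ContDiffAt ℝ 2 α y) :
    DifferentiableAt ℝ (extDeriv α) y :=
  (ContinuousAlternatingMap.alternatizeUncurryFinCLM ℝ E R).differentiableAt.comp y
    ((hα.fderiv_right (m := 1) one_add_one_eq_two.le).differentiableAt one_ne_zero)

lemma differentiableAt_formCurvature (hγ : ContDiffAt ℝ 2 γ y) :
    DifferentiableAt ℝ (formCurvature γ) y :=
  have hγ' := hγ.differentiableAt two_ne_zero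
  (differentiableAt_extDeriv hγ).add (differentiableAt_wedge hγ' hγ')

namespace GForm

lemma eps_hat_one_form (α : E [⋀^Fin 1]→L[ℝ] R) : eps (hat α) = -hat α := by
  rw [eps_hat, pow_one, neg_one_smul]

lemma eps_hat_two_form (Φ : E [⋀^Fin 2]→L[ℝ] R) : eps (hat Φ) = hat Φ := by
  rw [eps_hat, neg_one_sq, one_smul]

lemma bianchi_identity (hγ : ContDiffAt ℝ 2 γ y) :
    hat (extDeriv (formCurvature γ) y) =
      hat (formCurvature γ y) * hat (γ y) - hat (γ y) * hat (formCurvature γ y) := by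
  have hγ' := hγ.differentiableAt two_ne_zero
  have extDeriv_eq : extDeriv (formCurvature γ) y = extDeriv (fun z => γ z ⋏ γ z) y := by
    change extDeriv (extDeriv γ + fun z => γ z ⋏ γ z) y = _
    rw [extDeriv_add (differentiableAt_extDeriv hγ) (differentiableAt_wedge hγ' hγ'),
      extDeriv_extDeriv_apply hγ (by simp), zero_add]
  rw [extDeriv_eq, hat_extDeriv_wedge hγ' hγ', eps_hat_one_form, formCurvature, hat_add,
    hat_wedge (γ y)]
  noncomm_ring

lemma hat_extDeriv_wedgePow_formCurvature (hγ : ContDiffAt ℝ 2 γ y) (k : ℕ) :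
    hat (extDeriv (fun z => wedgePow (formCurvature γ z) k) y) =
      hat (formCurvature γ y) ^ k * hat (γ y) - hat (γ y) * hat (formCurvature γ y) ^ k := by
  induction k with
  | zero =>
    have extDeriv_one : extDeriv (fun z => wedgePow (formCurvature γ z) 0) y = 0 := by
      ext v
      simp [wedgePow, extDeriv, ContinuousAlternatingMap.alternatizeUncurryFin_apply]
    rw [extDeriv_one, hat_zero]
    simp
  | succ k ih =>
    have hΦ := differentiableAt_formCurvature hγ
    have leibniz := hat_extDeriv_wedge (differentiableAt_wedgePow hΦ k) hΦ
    rw [ih, hat_wedgePow, eps_pow (eps_hat_two_form _), bianchi_identity hγ] at leibniz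
    refine leibniz.trans ?_
    noncomm_ring

end GForm

variable (T : R →L[ℝ] Z)

open GForm in
/-- By the Bianchi identity the differential of a power of the curvature is a commutator with
`γ`. -/
theorem extDeriv_trace_wedgePow_formCurvature (hT : ∀ a b, T (a * b) = T (b * a))
    (hγ : ContDiffAt ℝ 2 γ y) (k : ℕ) :
    extDeriv (fun z => T.compContinuousAlternatingMap (wedgePow (formCurvature γ z) k)) y = 0 := by
  refine hat_injective ?_
  rw [extDeriv_compContinuousAlternatingMap T
      (differentiableAt_wedgePow (differentiableAt_formCurvature hγ) k), ← map_hat,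
    hat_extDeriv_wedgePow_formCurvature hγ, map_sub,
    map_mul_comm_of_even (T : R →+ Z) hT (eps_pow (eps_hat_two_form _) k), sub_self, hat_zero]

open GForm in
/-- The form on the right is the product of `Φᵏ` with the covariant derivative of `θ`. -/
theorem extDeriv_trace_wedgePow_formCurvature_wedge (hT : ∀ a b, T (a * b) = T (b * a))
    (hγ : ContDiffAt ℝ 2 γ y) (hθ : DifferentiableAt ℝ θ y) (k : ℕ) :
    extDeriv (fun z => T.compContinuousAlternatingMap
        (wedgePow (formCurvature γ z) k ⋏ θ z)) y =
      T.compContinuousAlternatingMap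
        (wedgePow (formCurvature γ y) k ⋏ (extDeriv θ y + γ y ⋏ θ y + θ y ⋏ γ y)) := by
  have hΦ := differentiableAt_wedgePow (differentiableAt_formCurvature hγ) k
  have swap := map_mul_comm_of_odd (T : R →+ Z) hT (eps_hat_one_form (γ y))
    (hat (formCurvature γ y) ^ k * hat (θ y))
  rw [eps_mul, eps_pow (eps_hat_two_form _) k, eps_hat_one_form, mul_neg, neg_mul, map_neg] at swap
  refine hat_injective ?_
  rw [extDeriv_compContinuousAlternatingMap T (differentiableAt_wedge hΦ hθ), ← map_hat, ← map_hat,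
    hat_extDeriv_wedge hΦ hθ, hat_extDeriv_wedgePow_formCurvature hγ, hat_wedgePow,
    eps_pow (eps_hat_two_form _) k, hat_wedge, hat_wedgePow, hat_add, hat_add, hat_wedge,
    hat_wedge, sub_mul, mul_assoc (hat (γ y)), map_add, map_sub, swap, mul_add, mul_add, map_add,
    map_add, ← mul_assoc, ← mul_assoc]
  abel

open GForm in
lemma exists_hasDerivAt_wedgePow {Φ : ℝ → E [⋀^Fin 2]→L[ℝ] R} {Φ' : E [⋀^Fin 2]→L[ℝ] R} {t : ℝ}
    (hΦ : HasDerivAt Φ Φ' t) (k : ℕ) : ∃ D, HasDerivAt (fun s => wedgePow (Φ s) k) D t ∧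
      hat D = ∑ i ∈ Finset.range k, hat (Φ t) ^ i * hat Φ' * hat (Φ t) ^ (k - 1 - i) := by
  induction k with
  | zero => exact ⟨0, hasDerivAt_const _ _, by simpa using hat_zero⟩
  | succ k ih =>
    obtain ⟨D, hD, hat_D⟩ := ih
    refine ⟨_, hasDerivAt_wedge hD hΦ, ?_⟩
    rw [hat_add, hat_wedge, hat_wedge, hat_wedgePow, hat_D, Finset.sum_range_succ, Finset.sum_mul,
      add_comm]
    congr 1
    · refine Finset.sum_congr rfl fun i hi => ?_
      rw [mul_assoc _ _ (hat (Φ t)), ← pow_succ]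
      congr 2
      have := Finset.mem_range.1 hi
      lia
    · simp

open GForm in
lemma hasDerivAt_trace_wedgePow (hT : ∀ a b, T (a * b) = T (b * a))
    {Φ : ℝ → E [⋀^Fin 2]→L[ℝ] R} {Φ' : E [⋀^Fin 2]→L[ℝ] R} {t : ℝ}
    (hΦ : HasDerivAt Φ Φ' t) (k : ℕ) :
    HasDerivAt (fun s => T.compContinuousAlternatingMap (wedgePow (Φ s) (k + 1)))
      (((k + 1 : ℕ) : ℝ) • T.compContinuousAlternatingMap (wedgePow (Φ t) k ⋏ Φ')) t := by
  obtain ⟨D, hD, hat_D⟩ := exists_hasDerivAt_wedgePow hΦ (k + 1)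
  have cyclic : ∀ i ∈ Finset.range (k + 1),
      map (T : R →+ Z) (hat (Φ t) ^ i * hat Φ' * hat (Φ t) ^ (k + 1 - 1 - i)) =
        map (T : R →+ Z) (hat (Φ t) ^ k * hat Φ') := by
    intro i hi
    have := Finset.mem_range.1 hi
    rw [mul_assoc, map_mul_comm_of_even _ hT (eps_pow (eps_hat_two_form _) i), mul_assoc, ← pow_add,
      map_mul_comm_of_even _ hT (eps_pow (eps_hat_two_form _) k)]
    congr 3
    lia
  have trace_D : T.compContinuousAlternatingMap D =
      ((k + 1 : ℕ) : ℝ) • T.compContinuousAlternatingMap (wedgePow (Φ t) k ⋏ Φ') := by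
    refine hat_injective ?_
    rw [← map_hat, hat_D, hat_smul, ← map_hat, hat_wedge, hat_wedgePow, map_sum,
      Finset.sum_congr rfl cyclic, Finset.sum_const, Finset.card_range, Nat.cast_smul_eq_nsmul]
  rw [← trace_D]
  exact (ContinuousLinearMap.compContinuousAlternatingMapCLM ℝ E R Z (Fin _)
    T).hasFDerivAt.comp_hasDerivAt t hD

end ChernWeil

namespace DForm

lemma chartAt_mem_target_inter_preimage {E M : Type*} [TopologicalSpace E] [TopologicalSpace M]
    [ChartedSpace E M] {U : Set M} {x : M} (hx : x ∈ U) :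
    chartAt E x x ∈ (chartAt E x).target ∩ (chartAt E x).symm ⁻¹' U :=
  ⟨mem_chart_target E x, by rwa [Set.mem_preimage, (chartAt E x).left_inv (mem_chart_source E x)]⟩

section SmoothOn

variable {E : Type*} [NormedAddCommGroup E] [NormedSpace ℝ E]
  {M : Type*} [TopologicalSpace M] [ChartedSpace E M]
  {F G H : Type*} [NormedAddCommGroup F] [NormedSpace ℝ F] [NormedAddCommGroup G] [NormedSpace ℝ G]
  [NormedAddCommGroup H] [NormedSpace ℝ H] {R : Type*} [NormedRing R] [NormedAlgebra ℝ R]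
  {p q : ℕ} {U : Set M} {α β : DForm E (fun _ : M => F) p}

lemma inChart_add (α β : DForm E (fun _ : M => F) p) (e : OpenPartialHomeomorph M E) (y : E) :
    (α + β).inChart e y = α.inChart e y + β.inChart e y := rfl

lemma inChart_comp_clm (T : F →L[ℝ] G) (α : DForm E (fun _ : M => F) p)
    (e : OpenPartialHomeomorph M E) (y : E) :
    inChart (fun x => T.compContinuousAlternatingMap (α x) : DForm E (fun _ : M => G) p) e y =
      T.compContinuousAlternatingMap (α.inChart e y) := rfl

lemma inChart_wedge (B : F →L[ℝ] G →L[ℝ] H) (α : DForm E (fun _ : M => F) p)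
    (β : DForm E (fun _ : M => G) q) (e : OpenPartialHomeomorph M E) (y : E) :
    inChart (fun x => wedge B (α x) (β x) : DForm E (fun _ : M => H) (p + q)) e y =
      wedge B (α.inChart e y) (β.inChart e y) :=
  wedge_compContinuousLinearMap B _ _ _

lemma inChart_wedgePow (Φ : DForm E (fun _ : M => R) 2) (k : ℕ) (e : OpenPartialHomeomorph M E)
    (y : E) : inChart (fun x => wedgePow (Φ x) k : DForm E (fun _ : M => R) (2 * k)) e y =
      wedgePow (Φ.inChart e y) k :=
  wedgePow_compContinuousLinearMap _ _ k

/-- Smoothness over `U` of a form with values in a fixed normed space. -/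
def SmoothOn (α : DForm E (fun _ : M => F) p) (U : Set M) : Prop :=
  ∀ e ∈ atlas E M, ContDiffOn ℝ ∞ (fun y => α.inChart e y) (e.target ∩ e.symm ⁻¹' U)

lemma isSmooth_iff_smoothOn_univ : α.IsSmooth ↔ α.SmoothOn Set.univ := Iff.rfl

lemma SmoothOn.mono {U' : Set M} (hα : α.SmoothOn U) (hU : U' ⊆ U) : α.SmoothOn U' :=
  fun e he => (hα e he).mono (Set.inter_subset_inter_right _ (Set.preimage_mono hU))

lemma SmoothOn.congr (hα : α.SmoothOn U) (h : ∀ x ∈ U, α x = β x) : β.SmoothOn U :=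
  fun e he => (hα e he).congr fun y hy => by rw [inChart, inChart, h _ hy.2]

lemma SmoothOn.contDiffAt (hα : α.SmoothOn U) (hU : IsOpen U) {e : OpenPartialHomeomorph M E}
    (he : e ∈ atlas E M) {y : E} (hy : y ∈ e.target ∩ e.symm ⁻¹' U) :
    ContDiffAt ℝ ∞ (fun z => α.inChart e z) y :=
  (hα e he).contDiffAt ((e.symm.isOpen_inter_preimage hU).mem_nhds hy)

lemma smoothOn_of_locally (h : ∀ x ∈ U, ∃ O, IsOpen O ∧ x ∈ O ∧ α.SmoothOn O) :
    α.SmoothOn U := by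
  intro e he y hy
  obtain ⟨O, hO, hx, hα⟩ := h _ hy.2
  exact (hα.contDiffAt hO he ⟨hy.1, hx⟩).contDiffWithinAt

lemma SmoothOn.add (hα : α.SmoothOn U) (hβ : β.SmoothOn U) : (α + β).SmoothOn U :=
  fun e he => (hα e he).add (hβ e he)

lemma SmoothOn.const_smul (hα : α.SmoothOn U) (c : ℝ) : (c • α).SmoothOn U :=
  fun e he => (hα e he).const_smul c

lemma SmoothOn.sub (hα : α.SmoothOn U) (hβ : β.SmoothOn U) : (α - β).SmoothOn U :=
  fun e he => (hα e he).sub (hβ e he)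

lemma SmoothOn.sum {κ : Type*} {S : Finset κ} {α : κ → DForm E (fun _ : M => F) p}
    (hα : ∀ a ∈ S, (α a).SmoothOn U) : (∑ a ∈ S, α a).SmoothOn U := by
  classical
  induction S using Finset.induction_on with
  | empty => exact fun e _ => contDiffOn_const (c := 0)
  | insert a S ha ih =>
    rw [Finset.sum_insert ha]
    exact (hα a (S.mem_insert_self a)).add (ih fun b hb => hα b (Finset.mem_insert_of_mem hb))

lemma SmoothOn.comp_clm (T : F →L[ℝ] G) (hα : α.SmoothOn U) :
    SmoothOn (fun x => T.compContinuousAlternatingMap (α x) : DForm E (fun _ : M => G) p) U :=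
  fun e he => (ContinuousLinearMap.compContinuousAlternatingMapCLM ℝ E F G (Fin p)
    T).contDiff.comp_contDiffOn (hα e he)

lemma SmoothOn.wedge (B : F →L[ℝ] G →L[ℝ] H) {β : DForm E (fun _ : M => G) q}
    (hα : α.SmoothOn U) (hβ : β.SmoothOn U) :
    SmoothOn (fun x => _root_.wedge B (α x) (β x) : DForm E (fun _ : M => H) (p + q)) U :=
  fun e he => (contDiffOn_wedge (hα e he) (hβ e he)).congr fun y _ => inChart_wedge B α β e y

lemma SmoothOn.wedgePow {Φ : DForm E (fun _ : M => R) 2} (hΦ : Φ.SmoothOn U) (k : ℕ) :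
    SmoothOn (fun x => _root_.wedgePow (Φ x) k : DForm E (fun _ : M => R) (2 * k)) U :=
  fun e he => (contDiffOn_wedgePow (hΦ e he) k).congr fun y _ => inChart_wedgePow Φ k e y

lemma inChart_eventuallyEq (hU : IsOpen U) (h : ∀ x ∈ U, α x = β x)
    {e : OpenPartialHomeomorph M E} {y : E} (hy : y ∈ e.target ∩ e.symm ⁻¹' U) :
    (fun z => α.inChart e z) =ᶠ[nhds y] fun z => β.inChart e z := by
  filter_upwards [(e.symm.isOpen_inter_preimage hU).mem_nhds hy] with z hz
  rw [inChart, inChart, h _ hz.2]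

lemma d_congr (hU : IsOpen U) (h : ∀ x ∈ U, α x = β x) {x : M} (hx : x ∈ U) :
    α.d x = β.d x := by
  rw [d, d, (inChart_eventuallyEq hU h (chartAt_mem_target_inter_preimage hx)).extDeriv_eq]

lemma d_add_apply (hU : IsOpen U) (hα : α.SmoothOn U) (hβ : β.SmoothOn U) {x : M} (hx : x ∈ U) :
    (α + β).d x = α.d x + β.d x := by
  have hx' := chartAt_mem_target_inter_preimage (E := E) hx
  have extDeriv_add_eq := extDeriv_fun_add
    ((hα.contDiffAt hU (chart_mem_atlas E x) hx').differentiableAt (by simp))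
    ((hβ.contDiffAt hU (chart_mem_atlas E x) hx').differentiableAt (by simp))
  exact congrArg (·.compContinuousLinearMap (mfderiv 𝓘(ℝ, E) 𝓘(ℝ, E) (chartAt E x) x))
    extDeriv_add_eq

end SmoothOn

section ChangeOfChart

variable {E : Type*} [NormedAddCommGroup E] [NormedSpace ℝ E]
  {M : Type*} [TopologicalSpace M] [ChartedSpace E M] [IsManifold 𝓘(ℝ, E) ∞ M]
  {F : Type*} [NormedAddCommGroup F] [NormedSpace ℝ F] {p : ℕ} {U : Set M}
  {e e' : OpenPartialHomeomorph M E} {α β : DForm E (fun _ : M => F) p}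

lemma mdifferentiable_chart (he : e ∈ atlas E M) : e.MDifferentiable 𝓘(ℝ, E) 𝓘(ℝ, E) :=
  haveI : IsManifold 𝓘(ℝ, E) 1 M := IsManifold.of_le (n := ∞) (by simp)
  mdifferentiable_of_mem_atlas he

lemma fderiv_transition (he : e ∈ atlas E M) (he' : e' ∈ atlas E M) {y : E} (hy : y ∈ e.target)
    (hy' : e.symm y ∈ e'.source) :
    fderiv ℝ (e' ∘ e.symm) y = (mfderiv 𝓘(ℝ, E) 𝓘(ℝ, E) e' (e.symm y)).comp
      (mfderiv 𝓘(ℝ, E) 𝓘(ℝ, E) e.symm y) := by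
  rw [← mfderiv_eq_fderiv]
  exact mfderiv_comp y ((mdifferentiable_chart he').mdifferentiableAt hy')
    ((mdifferentiable_chart he).mdifferentiableAt_symm hy)

lemma contDiffAt_transition (he : e ∈ atlas E M) (he' : e' ∈ atlas E M) {y : E}
    (hy : y ∈ e.target) (hy' : e.symm y ∈ e'.source) : ContDiffAt ℝ ∞ (e' ∘ e.symm) y := by
  have smooth_e' : ContMDiffAt 𝓘(ℝ, E) 𝓘(ℝ, E) ∞ e' (e.symm y) :=
    contMDiffAt_of_mem_maximalAtlas (IsManifold.subset_maximalAtlas he') hy'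
  have smooth_symm : ContMDiffAt 𝓘(ℝ, E) 𝓘(ℝ, E) ∞ e.symm y :=
    (contMDiffOn_symm_of_mem_maximalAtlas (IsManifold.subset_maximalAtlas he)).contMDiffAt
      (e.open_target.mem_nhds hy)
  exact (smooth_e'.comp y smooth_symm).contDiffAt

lemma inChart_compContinuousLinearMap_mfderiv (α : DForm E (fun _ : M => F) p)
    (he : e ∈ atlas E M) {x : M} (hx : x ∈ e.source) :
    (α.inChart e (e x)).compContinuousLinearMap (mfderiv 𝓘(ℝ, E) 𝓘(ℝ, E) e x) = α x := by
  have symm_deriv (v) : mfderiv 𝓘(ℝ, E) 𝓘(ℝ, E) e.symm (e x)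
      (mfderiv 𝓘(ℝ, E) 𝓘(ℝ, E) e x v) = v :=
    DFunLike.congr_fun ((mdifferentiable_chart he).symm_comp_deriv hx) v
  ext v
  change α (e.symm (e x)) (fun i => mfderiv 𝓘(ℝ, E) 𝓘(ℝ, E) e.symm (e x)
      (mfderiv 𝓘(ℝ, E) 𝓘(ℝ, E) e x (v i))) = α x v
  simp only [symm_deriv]
  rw [e.left_inv hx]

lemma eq_of_inChart_eq {x : M}
    (h : α.inChart (chartAt E x) (chartAt E x x) = β.inChart (chartAt E x) (chartAt E x x)) :
    α x = β x := by
  rw [← inChart_compContinuousLinearMap_mfderiv α (chart_mem_atlas E x) (mem_chart_source E x),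
    ← inChart_compContinuousLinearMap_mfderiv β (chart_mem_atlas E x) (mem_chart_source E x), h]

lemma inChart_eq_pullback (α : DForm E (fun _ : M => F) p) (he : e ∈ atlas E M)
    (he' : e' ∈ atlas E M) {y : E} (hy : y ∈ e.target) (hy' : e.symm y ∈ e'.source) :
    α.inChart e y = (α.inChart e' ((e' ∘ e.symm) y)).compContinuousLinearMap
      (fderiv ℝ (e' ∘ e.symm) y) := by
  rw [fderiv_transition he he' hy hy', inChart,
    ← inChart_compContinuousLinearMap_mfderiv α he' hy']
  rfl

lemma inChart_d (hU : IsOpen U) (hα : α.SmoothOn U) (he : e ∈ atlas E M) {y : E}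
    (hy : y ∈ e.target ∩ e.symm ⁻¹' U) :
    α.d.inChart e y = extDeriv (fun z => α.inChart e z) y := by
  obtain ⟨c, hc⟩ : ∃ c, c = chartAt E (e.symm y) := ⟨_, rfl⟩
  have hcs : e.symm y ∈ c.source := hc ▸ mem_chart_source E _
  have hca : c ∈ atlas E M := hc ▸ chart_mem_atlas E _
  have change_of_chart : (fun z => α.inChart e z) =ᶠ[nhds y] fun z =>
      (α.inChart c ((c ∘ e.symm) z)).compContinuousLinearMap (fderiv ℝ (c ∘ e.symm) z) := by
    filter_upwards [(e.symm.isOpen_inter_preimage c.open_source).mem_nhds ⟨hy.1, hcs⟩] with z hz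
    exact inChart_eq_pullback α he hca hz.1 hz.2
  have differentiable_in_c : DifferentiableAt ℝ (fun z => α.inChart c z) ((c ∘ e.symm) y) :=
    (hα.contDiffAt hU hca ⟨c.map_source hcs, by
      rw [Set.mem_preimage, c.left_inv hcs]
      exact hy.2⟩).differentiableAt (by simp)
  rw [change_of_chart.extDeriv_eq, extDeriv_pullback differentiable_in_c
    (contDiffAt_transition he hca hy.1 hcs)
    (by simpa using ENat.LEInfty.out),
    fderiv_transition he hca hy.1 hcs, inChart, d, ← hc]
  rfl

lemma SmoothOn.d (hU : IsOpen U) (hα : α.SmoothOn U) : α.d.SmoothOn U :=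
  fun e he => (contDiffOn_extDeriv (e.symm.isOpen_inter_preimage hU) (hα e he)).congr
    fun _ hy => inChart_d hU hα he hy

end ChangeOfChart

section Curvature

variable {E : Type*} [NormedAddCommGroup E] [NormedSpace ℝ E]
  {M : Type*} [TopologicalSpace M] [ChartedSpace E M]
  {F : Type*} [NormedAddCommGroup F] [NormedSpace ℝ F] {R : Type*} [NormedRing R]
  [NormedAlgebra ℝ R] {U : Set M} {γ θ : DForm E (fun _ : M => R) 1}

/-- The curvature `dγ + γ ∧ γ` of the connection `d + γ` on a trivial bundle over `M`. -/
def curvature (γ : DForm E (fun _ : M => R) 1) : DForm E (fun _ : M => R) 2 :=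
  fun x => γ.d x + γ x ⋏ γ x

variable [IsManifold 𝓘(ℝ, E) ∞ M]

lemma SmoothOn.curvature (hU : IsOpen U) (hγ : γ.SmoothOn U) : γ.curvature.SmoothOn U :=
  (hγ.d hU).add (hγ.wedge (ContinuousLinearMap.mul ℝ R) hγ)

lemma inChart_curvature (hU : IsOpen U) (hγ : γ.SmoothOn U) {e : OpenPartialHomeomorph M E}
    (he : e ∈ atlas E M) {y : E} (hy : y ∈ e.target ∩ e.symm ⁻¹' U) :
    γ.curvature.inChart e y = formCurvature (fun z => γ.inChart e z) y := by
  rw [formCurvature, ← inChart_d hU hγ he hy, ← inChart_wedge, ← inChart_add]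
  rfl

lemma inChart_curvature_eventuallyEq (hU : IsOpen U) (hγ : γ.SmoothOn U)
    {e : OpenPartialHomeomorph M E} (he : e ∈ atlas E M) {y : E}
    (hy : y ∈ e.target ∩ e.symm ⁻¹' U) :
    (fun z => γ.curvature.inChart e z) =ᶠ[nhds y] formCurvature fun z => γ.inChart e z := by
  filter_upwards [(e.symm.isOpen_inter_preimage hU).mem_nhds hy] with z hz
  exact inChart_curvature hU hγ he hz

variable (T : R →L[ℝ] F) (hT : ∀ a b, T (a * b) = T (b * a))
include hT

theorem d_trace_wedgePow_curvature (hU : IsOpen U) (hγ : γ.SmoothOn U) (k : ℕ) {x : M}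
    (hx : x ∈ U) :
    d (fun x => T.compContinuousAlternatingMap (wedgePow (γ.curvature x) k) :
      DForm E (fun _ : M => F) (2 * k)) x = 0 := by
  have hx' := chartAt_mem_target_inter_preimage (E := E) hx
  have he := chart_mem_atlas E x
  refine eq_of_inChart_eq (β := (0 : DForm E (fun _ : M => F) (2 * k + 1))) ?_
  rw [inChart_d hU (((hγ.curvature hU).wedgePow k).comp_clm T) he hx']
  refine Eq.trans (Filter.EventuallyEq.extDeriv_eq ?_) (extDeriv_trace_wedgePow_formCurvature T hT
    ((hγ.contDiffAt hU he hx').of_le (ENat.LEInfty.out)) k)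
  filter_upwards [inChart_curvature_eventuallyEq hU hγ he hx'] with z hz
  rw [inChart_comp_clm, inChart_wedgePow, hz]

/-- For a path of connection forms with derivative `θ`, the last factor is the derivative of the
curvature, so this computes the differential of the transgression form. -/
theorem d_trace_wedgePow_curvature_wedge (hU : IsOpen U) (hγ : γ.SmoothOn U) (hθ : θ.SmoothOn U)
    (k : ℕ) {x : M} (hx : x ∈ U) :
    d (fun x => T.compContinuousAlternatingMap (wedgePow (γ.curvature x) k ⋏ θ x) :
        DForm E (fun _ : M => F) (2 * k + 1)) x =
      T.compContinuousAlternatingMap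
        (wedgePow (γ.curvature x) k ⋏ (θ.d x + γ x ⋏ θ x + θ x ⋏ γ x)) := by
  have hx' := chartAt_mem_target_inter_preimage (E := E) hx
  have he := chart_mem_atlas E x
  refine eq_of_inChart_eq (β := (fun x => T.compContinuousAlternatingMap
    (wedgePow (γ.curvature x) k ⋏ (θ.d x + γ x ⋏ θ x + θ x ⋏ γ x)) :
      DForm E (fun _ : M => F) (2 * k + 2))) ?_
  rw [inChart_d hU ((((hγ.curvature hU).wedgePow k).wedge _ hθ).comp_clm T) he hx']
  refine Eq.trans (Filter.EventuallyEq.extDeriv_eq ?_)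
    ((extDeriv_trace_wedgePow_formCurvature_wedge T hT
      ((hγ.contDiffAt hU he hx').of_le (ENat.LEInfty.out))
      ((hθ.contDiffAt hU he hx').differentiableAt (by simp)) k).trans ?_)
  · filter_upwards [inChart_curvature_eventuallyEq hU hγ he hx'] with z hz
    rw [inChart_comp_clm, inChart_wedge, inChart_wedgePow, hz]
  · rw [← inChart_curvature hU hγ he hx', ← inChart_d hU hθ he hx']
    rw [inChart_comp_clm, inChart_wedge, inChart_wedgePow, ← inChart_wedge, ← inChart_wedge,
      ← inChart_add, ← inChart_add]
    rfl

end Curvature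

end DForm

section HilbertModuleEndomorphisms

variable {A : Type*} [CStarAlgebra A] [PartialOrder A] [StarOrderedRing A]
  {V W : Type*}
  [NormedAddCommGroup V] [NormedSpace ℂ V] [Module Aᵐᵒᵖ V] [HilbertModule A V]
  [NormedAddCommGroup W] [NormedSpace ℂ W] [Module Aᵐᵒᵖ W] [HilbertModule A W]

open HilbertModule

lemma isBoundedBilinearMap_op_smul :
    IsBoundedBilinearMap ℝ (fun p : V × A => p.1 <• p.2) where
  add_left v w a := smul_add _ _ _
  smul_left c v a := by
    simpa only [Complex.coe_smul] using smul_complex_smul (A := A) v (c : ℂ) a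
  add_right v a b := by rw [MulOpposite.op_add, add_smul]
  smul_right c v a := by
    simpa only [Complex.coe_smul] using complex_smul_smul (A := A) v (c : ℂ) a
  bound := ⟨1, one_pos, fun v a => by simpa using norm_op_smul_le v a⟩

namespace EndA

@[ext] lemma ext {S T : EndA A V} (h : ∀ v, S.1 v = T.1 v) : S = T :=
  Subtype.ext (ContinuousLinearMap.ext h)

variable (A V) in
/-- The action of `End_A(V)` on `V`, as a pairing with respect to which forms can be wedged. -/
def action : EndA A V →L[ℝ] V →L[ℝ] V :=
  (ContinuousLinearMap.restrictScalarsL ℂ V V ℝ ℝ) ∘L (incl A V).restrictScalars ℝ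

lemma action_apply (T : EndA A V) (v : V) : action A V T v = T.1 v := rfl

/-- The rank one endomorphism `x ↦ v φ(x)`, as a continuous linear function of `v`. -/
def rankOneL (φ : HomA A V A) : V →L[ℝ] EndA A V :=
  LinearMap.mkContinuous
    { toFun := fun v => rankOne v φ
      map_add' := fun v w => ext fun x => smul_add _ _ _
      map_smul' := fun c v => ext fun x => smul_complex_smul (A := A) v (c : ℂ) (φ.1 x) }
    ‖φ.1‖ fun v => by
      refine ContinuousLinearMap.opNorm_le_bound _ (by positivity) fun x => ?_
      refine (norm_op_smul_le v (φ.1 x)).trans ?_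
      rw [mul_comm, mul_right_comm]
      gcongr
      exact φ.1.le_opNorm x

/-- The map `T ↦ g T f` from `End_A(W)` to `End_A(V)`, for `f : V → W` and `g : W → V`. -/
def conj {f : V →L[ℂ] W} {g : W →L[ℂ] V} (hf : IsHilbertHom A f) (hg : IsHilbertHom A g) :
    EndA A W →L[ℝ] EndA A V :=
  LinearMap.mkContinuous
    { toFun := fun T => ⟨g ∘L T.1 ∘L f, hg.comp (IsHilbertHom.comp T.2 hf)⟩
      map_add' := fun S T => ext fun v => map_add g _ _
      map_smul' := fun c T => ext fun v => g.map_smul_of_tower c _ }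
    (‖g‖ * ‖f‖) fun T => by
      calc ‖g ∘L T.1 ∘L f‖ ≤ ‖g‖ * (‖T.1‖ * ‖f‖) :=
            (g.opNorm_comp_le _).trans (by gcongr; exact T.1.opNorm_comp_le f)
        _ = ‖g‖ * ‖f‖ * ‖T‖ := by rw [mul_comm ‖T.1‖, mul_assoc]; rfl

section Conj

variable {f : V →L[ℂ] W} {g : W →L[ℂ] V} (hf : IsHilbertHom A f) (hg : IsHilbertHom A g)

lemma conj_apply (T : EndA A W) (v : V) : (conj hf hg T).1 v = g (T.1 (f v)) := rfl

lemma conj_mul (hfg : ∀ w, f (g w) = w) (S T : EndA A W) :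
    conj hf hg (S * T) = conj hf hg S * conj hf hg T := by
  ext v
  change g (S.1 (T.1 (f v))) = g (S.1 (f (g (T.1 (f v)))))
  rw [hfg]

lemma conj_one (hgf : ∀ v, g (f v) = v) : conj hf hg (1 : EndA A W) = 1 :=
  ext hgf

lemma conj_conj (hgf : ∀ v, g (f v) = v) (T : EndA A V) : conj hf hg (conj hg hf T) = T := by
  ext v
  rw [conj_apply, conj_apply, hgf, hgf]

lemma conj_injective (hfg : ∀ w, f (g w) = w) : Function.Injective (conj hf hg) :=
  Function.LeftInverse.injective (g := conj hg hf) (conj_conj hg hf hfg)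

end Conj

end EndA

/-- The morphism `φ ∘ g : W → A`, for `φ : V → A` and `g : W → V`. -/
def HomA.compHom (φ : HomA A V A) {g : W →L[ℂ] V} (hg : IsHilbertHom A g) : HomA A W A :=
  ⟨φ.1 ∘L g, IsHilbertHom.comp φ.2 hg⟩

variable {n : ℕ} {e : Fin n → V} {φ : Fin n → HomA A V A}

lemma frame_compHom (hframe : ∀ v, ∑ a, e a <• ((φ a).1 v) = v) {f : V →L[ℂ] W} {g : W →L[ℂ] V}
    (hf : IsHilbertHom A f) (hg : IsHilbertHom A g) (hfg : ∀ w, f (g w) = w) (w : W) :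
    ∑ a, f (e a) <• ((HomA.compHom (φ a) hg).1 w) = w := by
  conv_rhs => rw [← hfg w, ← hframe (g w), map_sum]
  exact Finset.sum_congr rfl fun a _ => (hf.map_smul _ _).symm

variable {Z : Type*} [NonUnitalCommCStarAlgebra Z] (τ : A →L[ℂ] Z)

/-- The map `T ↦ ∑ₐ τ(φₐ(T eₐ))` on `End_A(V)`; for a frame `(e, φ)` of `V` it computes
`τ ∘ ev`. -/
def frameTrace (e : Fin n → V) (φ : Fin n → HomA A V A) : EndA A V →L[ℝ] Z :=
  ∑ a, (τ ∘L (φ a).1 ∘L ContinuousLinearMap.apply ℂ V (e a) ∘L EndA.incl A V).restrictScalars ℝ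

lemma frameTrace_apply (T : EndA A V) :
    frameTrace τ e φ T = ∑ a, τ ((φ a).1 (T.1 (e a))) := by
  rw [frameTrace, _root_.sum_apply]
  rfl

lemma frameTrace_mul_comm (hτ : ∀ a b : A, τ (a * b) = τ (b * a))
    (hframe : ∀ v, ∑ a, e a <• ((φ a).1 v) = v) (S T : EndA A V) :
    frameTrace τ e φ (S * T) = frameTrace τ e φ (T * S) := by
  have trace_mul (S T : EndA A V) : frameTrace τ e φ (S * T) = ∑ a, ∑ b,
      τ ((φ a).1 (S.1 (e b)) * (φ b).1 (T.1 (e a))) := by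
    rw [frameTrace_apply]
    refine Finset.sum_congr rfl fun a _ => ?_
    change τ ((φ a).1 (S.1 (T.1 (e a)))) = _
    conv_lhs => rw [← hframe (T.1 (e a)), map_sum, map_sum, map_sum]
    exact Finset.sum_congr rfl fun b _ => congrArg τ
      ((congrArg (φ a).1 (S.2.map_smul _ _)).trans ((φ a).2.map_smul _ _))
  rw [trace_mul, trace_mul, Finset.sum_comm]
  exact Finset.sum_congr rfl fun a _ => Finset.sum_congr rfl fun b _ => hτ _ _

lemma traceEv_eq_frameTrace_conj (hτ : ∀ a b : A, τ (a * b) = τ (b * a)) (hW : IsFGP A W)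
    (hframe : ∀ v, ∑ a, e a <• ((φ a).1 v) = v) {f : V →L[ℂ] W} {g : W →L[ℂ] V}
    (hf : IsHilbertHom A f) (hg : IsHilbertHom A g) (hfg : ∀ w, f (g w) = w) (T : EndA A W) :
    traceEv τ hτ hW T = frameTrace τ e φ (EndA.conj hf hg T) := by
  rw [frameTrace_apply]
  change traceBar τ hτ (evA hW T) = _
  rw [evA_eq_sum hW (frame_compHom hframe hf hg hfg), map_sum]
  rfl

end HilbertModuleEndomorphisms

section PolynomialCurves

variable {X Y Z : Type*} [AddCommGroup X] [Module ℝ X] [AddCommGroup Y] [Module ℝ Y]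
  [AddCommGroup Z] [Module ℝ Z]

variable (X) in
/-- The curves `t ↦ ∑ₘ tᵐ cₘ` in `X` of degree at most `N`. -/
def polynomialCurves (N : ℕ) : Submodule ℝ (ℝ → X) :=
  Submodule.span ℝ {f | ∃ m ≤ N, ∃ c : X, f = fun t => t ^ m • c}

lemma monomial_mem_polynomialCurves {N m : ℕ} (hm : m ≤ N) (c : X) :
    (fun t : ℝ => t ^ m • c) ∈ polynomialCurves X N :=
  Submodule.subset_span ⟨m, hm, c, rfl⟩

lemma const_mem_polynomialCurves (N : ℕ) (c : X) : (fun _ : ℝ => c) ∈ polynomialCurves X N := by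
  simpa only [pow_zero, one_smul] using monomial_mem_polynomialCurves N.zero_le c

lemma add_smul_mem_polynomialCurves {N : ℕ} (hN : 1 ≤ N) (a b : X) :
    (fun t : ℝ => a + t • b) ∈ polynomialCurves X N := by
  simpa only [pow_one] using! Submodule.add_mem _ (const_mem_polynomialCurves N a)
    (monomial_mem_polynomialCurves hN b)

lemma linearMap_mem_polynomialCurves (b : X →ₗ[ℝ] Y) {N : ℕ} {f : ℝ → X}
    (hf : f ∈ polynomialCurves X N) : (fun t => b (f t)) ∈ polynomialCurves Y N := by
  have le_comap : polynomialCurves X N ≤ (polynomialCurves Y N).comap (b.compLeft ℝ) := by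
    refine Submodule.span_le.2 ?_
    rintro _ ⟨m, hm, c, rfl⟩
    change (fun t : ℝ => b (t ^ m • c)) ∈ polynomialCurves Y N
    simp only [map_smul]
    exact monomial_mem_polynomialCurves hm (b c)
  exact le_comap hf

lemma pow_smul_mem_polynomialCurves {N : ℕ} {f : ℝ → X} (hf : f ∈ polynomialCurves X N) (m : ℕ) :
    (fun t => t ^ m • f t) ∈ polynomialCurves X (m + N) := by
  induction hf using Submodule.span_induction with
  | mem f hf =>
    obtain ⟨l, hl, c, rfl⟩ := hf
    simp only [smul_smul, ← pow_add]
    exact monomial_mem_polynomialCurves (by lia) c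
  | zero => simpa only [Pi.zero_apply, smul_zero] using! Submodule.zero_mem _
  | add f g _ _ hf hg => simpa only [Pi.add_apply, smul_add] using! Submodule.add_mem _ hf hg
  | smul a f _ hf =>
    convert Submodule.smul_mem _ a hf using 1
    exact funext fun t => smul_comm _ _ _

lemma bilinear_mem_polynomialCurves (b : X →ₗ[ℝ] Y →ₗ[ℝ] Z) {N K : ℕ} {f : ℝ → X} {g : ℝ → Y}
    (hf : f ∈ polynomialCurves X N) (hg : g ∈ polynomialCurves Y K) :
    (fun t => b (f t) (g t)) ∈ polynomialCurves Z (N + K) := by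
  induction hf using Submodule.span_induction with
  | mem f hf =>
    obtain ⟨m, hm, c, rfl⟩ := hf
    simp only [map_smul, LinearMap.smul_apply]
    refine Submodule.span_mono ?_
      (pow_smul_mem_polynomialCurves (linearMap_mem_polynomialCurves (b c) hg) m)
    rintro _ ⟨l, hl, d, rfl⟩
    exact ⟨l, by lia, d, rfl⟩
  | zero => simpa only [Pi.zero_apply, map_zero] using! Submodule.zero_mem _
  | add f f' _ _ hf hf' =>
    simpa only [Pi.add_apply, map_add, LinearMap.add_apply] using! Submodule.add_mem _ hf hf'
  | smul a f _ hf =>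
    simpa only [Pi.smul_apply, map_smul, LinearMap.smul_apply] using! Submodule.smul_mem _ a hf

lemma wedgePow_mem_polynomialCurves {T R : Type*} [AddCommGroup T] [Module ℝ T]
    [TopologicalSpace T] [NormedRing R] [NormedAlgebra ℝ R] {Φ : ℝ → T [⋀^Fin 2]→L[ℝ] R} {N : ℕ}
    (hΦ : Φ ∈ polynomialCurves _ N) (k : ℕ) :
    (fun t => wedgePow (Φ t) k) ∈ polynomialCurves (T [⋀^Fin (2 * k)]→L[ℝ] R) (k * N) := by
  induction k with
  | zero => exact const_mem_polynomialCurves _ _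
  | succ k ih =>
    refine (Nat.succ_mul k N).symm ▸ ?_
    exact bilinear_mem_polynomialCurves (wedgeₗ (ContinuousLinearMap.mul ℝ R)) ih hΦ

lemma exists_weights_sum_mul_pow_eq_integral (N : ℕ) :
    ∃ w : Fin N → ℝ, ∀ k < N, ∑ j, w j * (j : ℝ) ^ k = ((k : ℝ) + 1)⁻¹ := by
  have isUnit_vandermonde : IsUnit (Matrix.vandermonde fun j : Fin N => (j : ℝ)) := by
    rw [Matrix.isUnit_iff_isUnit_det, isUnit_iff_ne_zero, Matrix.det_vandermonde_ne_zero_iff]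
    exact Nat.cast_injective.comp Fin.val_injective
  obtain ⟨w, hw⟩ := Matrix.vecMul_surjective_iff_isUnit.2 isUnit_vandermonde
    fun k => (((k : ℕ) : ℝ) + 1)⁻¹
  exact ⟨w, fun k hk => congrFun hw ⟨k, hk⟩⟩

/-- A quadrature rule turns the integral of the derivative into a finite sum. -/
lemma exists_weights_sub_eq_sum_deriv (F : Type*) [NormedAddCommGroup F] [NormedSpace ℝ F]
    (N : ℕ) : ∃ w : Fin N → ℝ, ∀ f ∈ polynomialCurves F N, f 1 - f 0 = ∑ j, w j • deriv f j := by
  obtain ⟨w, hw⟩ := exists_weights_sum_mul_pow_eq_integral N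
  have hasDerivAt_monomial (m : ℕ) (c : F) (t : ℝ) :
      HasDerivAt (fun t : ℝ => t ^ m • c) ((m * t ^ (m - 1)) • c) t :=
    (hasDerivAt_pow m t).smul_const c
  suffices h : ∀ f ∈ polynomialCurves F N,
      Differentiable ℝ f ∧ f 1 - f 0 = ∑ j, w j • deriv f j from ⟨w, fun f hf => (h f hf).2⟩
  intro f hf
  induction hf using Submodule.span_induction with
  | mem f hf =>
    obtain ⟨m, hm, c, rfl⟩ := hf
    refine ⟨fun t => (hasDerivAt_monomial m c t).differentiableAt, ?_⟩
    simp only [(hasDerivAt_monomial m c _).deriv, one_pow, one_smul, smul_smul, ← Finset.sum_smul]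
    rcases m with _ | m
    · simp
    · have weights_m : ∑ j, w j * (((m + 1 : ℕ) : ℝ) * (j : ℝ) ^ (m + 1 - 1)) = 1 := by
        simp only [Nat.add_sub_cancel, mul_left_comm (w _), ← Finset.mul_sum, hw m hm]
        push_cast
        exact mul_inv_cancel₀ (by positivity)
      rw [weights_m, zero_pow m.succ_ne_zero, zero_smul, sub_zero, one_smul]
  | zero => simp
  | add f g _ _ hf hg =>
    refine ⟨hf.1.add hg.1, ?_⟩
    simp only [deriv_add (hf.1 _) (hg.1 _), smul_add, Finset.sum_add_distrib, ← hf.2, ← hg.2,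
      Pi.add_apply]
    abel
  | smul a f _ hf =>
    refine ⟨hf.1.const_smul a, ?_⟩
    simp only [deriv_const_smul a (hf.1 _), smul_comm _ a, ← Finset.smul_sum, ← hf.2, ← smul_sub,
      Pi.smul_apply]

end PolynomialCurves

section BumpFunctions

variable {E : Type*} [NormedAddCommGroup E] [NormedSpace ℝ E]
  {M : Type*} [TopologicalSpace M] [ChartedSpace E M]

lemma exists_contMDiff_tsupport_subset_eventuallyEq_one [FiniteDimensional ℝ E] [T2Space M]
    [IsManifold 𝓘(ℝ, E) ∞ M] {O : Set M} (hO : IsOpen O) {x : M} (hx : x ∈ O) :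
    ∃ χ : M → ℝ, ContMDiff 𝓘(ℝ, E) 𝓘(ℝ, ℝ) ∞ χ ∧ tsupport χ ⊆ O ∧ ∀ᶠ y in nhds x, χ y = 1 := by
  obtain ⟨χ, -, tsupport_subset⟩ :=
    (SmoothBumpFunction.nhds_basis_tsupport (I := 𝓘(ℝ, E)) x).mem_iff.1 (hO.mem_nhds hx)
  exact ⟨χ, χ.contMDiff, tsupport_subset, χ.eventuallyEq_one⟩

lemma contMDiffAt_smul_of_tsupport {F : Type*} [NormedAddCommGroup F] [NormedSpace ℝ F]
    {χ : M → ℝ} (hχ : ContMDiff 𝓘(ℝ, E) 𝓘(ℝ, ℝ) ∞ χ) {f : M → F} {x : M}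
    (hf : x ∈ tsupport χ → ContMDiffAt 𝓘(ℝ, E) 𝓘(ℝ, F) ∞ f x) :
    ContMDiffAt 𝓘(ℝ, E) 𝓘(ℝ, F) ∞ (fun y => χ y • f y) x := by
  by_cases hx : x ∈ tsupport χ
  · exact hχ.contMDiffAt.smul (hf hx)
  · refine contMDiffAt_const (c := (0 : F)).congr_of_eventuallyEq ?_
    filter_upwards [(isClosed_tsupport χ).isOpen_compl.mem_nhds hx] with y hy
    rw [image_eq_zero_of_notMem_tsupport hy, zero_smul]

end BumpFunctions

section Sections

variable {A : Type*} [CStarAlgebra A] [PartialOrder A]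
  {E : Type*} [NormedAddCommGroup E] [NormedSpace ℝ E]
  {M : Type*} [TopologicalSpace M] [ChartedSpace E M]
  {W : M → Type*} [∀ x, NormedAddCommGroup (W x)] [∀ x, NormedSpace ℂ (W x)]
  [∀ x, Module Aᵐᵒᵖ (W x)] [∀ x, HilbertModule A (W x)]
  {ι : Type*} {V : ι → Type*} [∀ i, NormedAddCommGroup (V i)] [∀ i, NormedSpace ℂ (V i)]
  [∀ i, Module Aᵐᵒᵖ (V i)] [∀ i, HilbertModule A (V i)]

namespace SmoothHilbertBundle

variable {B : SmoothHilbertBundle A E W V}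

lemma exists_mem_U (B : SmoothHilbertBundle A E W V) (x : M) : ∃ i, x ∈ B.U i :=
  Set.iUnion_eq_univ_iff.1 B.iUnion_U x

lemma isSmoothSection_zero : B.IsSmoothSection (fun _ => 0) := fun i => by
  simpa only [_root_.map_zero] using contMDiffOn_const

lemma IsSmoothSection.add {s t : ∀ x, W x} (hs : B.IsSmoothSection s) (ht : B.IsSmoothSection t) :
    B.IsSmoothSection (fun x => s x + t x) := fun i => by
  simpa only [_root_.map_add] using! (hs i).add (ht i)

lemma IsSmoothSection.sub {s t : ∀ x, W x} (hs : B.IsSmoothSection s) (ht : B.IsSmoothSection t) :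
    B.IsSmoothSection (fun x => s x - t x) := fun i => by
  simpa only [_root_.map_sub] using! (hs i).sub (ht i)

lemma IsSmoothSection.sum {κ : Type*} (S : Finset κ) {s : κ → ∀ x, W x}
    (hs : ∀ a, B.IsSmoothSection (s a)) : B.IsSmoothSection (fun x => ∑ a ∈ S, s a x) := by
  classical
  induction S using Finset.induction_on with
  | empty => simpa only [Finset.sum_empty] using isSmoothSection_zero
  | insert a S ha ih =>
    simp only [Finset.sum_insert ha]
    exact (hs a).add ih

lemma isSmoothSection_smul_symm {i : ι} {χ : M → ℝ} (hχ : ContMDiff 𝓘(ℝ, E) 𝓘(ℝ, ℝ) ∞ χ)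
    (hχU : tsupport χ ⊆ B.U i) {σ : M → V i}
    (hσ : ∀ x ∈ tsupport χ, ContMDiffAt 𝓘(ℝ, E) 𝓘(ℝ, V i) ∞ σ x) :
    B.IsSmoothSection (fun x => χ x • B.symm i x (σ x)) := by
  intro j x hxj
  have smooth_symm (hx : x ∈ tsupport χ) :
      ContMDiffAt 𝓘(ℝ, E) 𝓘(ℝ, V j) ∞ (fun y => B.triv j y (B.symm i y (σ y))) x :=
    (isBoundedBilinearMap_apply.contDiff.restrict_scalars ℝ).contMDiff.contMDiffAt.comp x
      (((B.smooth_transition i j).contMDiffAt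
        (((B.isOpen_U i).inter (B.isOpen_U j)).mem_nhds ⟨hχU hx, hxj⟩)).prodMk_space (hσ x hx))
  refine ((contMDiffAt_smul_of_tsupport hχ smooth_symm).congr_of_eventuallyEq
    (Filter.Eventually.of_forall fun y => ?_)).contMDiffWithinAt
  exact (B.triv j y).map_smul_of_tower _ _

lemma Connection.map_zero (D : B.Connection) : D.toFun (fun _ => 0) = 0 := by
  have map_add := D.map_add _ _ isSmoothSection_zero isSmoothSection_zero
  simp only [add_zero] at map_add
  exact left_eq_add.1 map_add

lemma Connection.map_sum (D : B.Connection) {κ : Type*} (S : Finset κ) {s : κ → ∀ x, W x}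
    (hs : ∀ a, B.IsSmoothSection (s a)) (x : M) :
    D.toFun (fun x => ∑ a ∈ S, s a x) x = ∑ a ∈ S, D.toFun (s a) x := by
  classical
  induction S using Finset.induction_on with
  | empty => simp only [Finset.sum_empty, D.map_zero, Pi.zero_apply]
  | insert a S ha ih =>
    simp only [Finset.sum_insert ha]
    rw [D.map_add _ _ (hs a) (.sum S hs), ← ih]

lemma IsSmoothSection.op_smul [StarOrderedRing A] {s : ∀ x, W x} (hs : B.IsSmoothSection s)
    {f : M → A} (hf : ContMDiff 𝓘(ℝ, E) 𝓘(ℝ, A) ∞ f) :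
    B.IsSmoothSection (fun x => s x <• f x) := fun i =>
  ((isBoundedBilinearMap_op_smul (A := A) (V := V i)).contDiff.contMDiff.comp_contMDiffOn
    ((hs i).prodMk_space hf.contMDiffOn)).congr fun x hx => (B.triv_hom i x hx).map_smul _ _

variable [FiniteDimensional ℝ E] [T2Space M] [IsManifold 𝓘(ℝ, E) ∞ M]

lemma exists_isSmoothSection_eventuallyEq_symm {i : ι} {O : Set M} (hO : IsOpen O)
    (hOU : O ⊆ B.U i) {x : M} (hx : x ∈ O) {σ : M → V i}
    (hσ : ContMDiffOn 𝓘(ℝ, E) 𝓘(ℝ, V i) ∞ σ O) :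
    ∃ s, B.IsSmoothSection s ∧ ∀ᶠ y in nhds x, s y = B.symm i y (σ y) := by
  obtain ⟨χ, hχ, hχO, χ_eq_one⟩ :=
    exists_contMDiff_tsupport_subset_eventuallyEq_one (E := E) hO hx
  refine ⟨_, isSmoothSection_smul_symm hχ (hχO.trans hOU) fun y hy =>
    hσ.contMDiffAt (hO.mem_nhds (hχO hy)), ?_⟩
  filter_upwards [χ_eq_one] with y hy
  rw [hy, one_smul]

open Classical in
variable (B) in
/-- A smooth section which is constant, with value `v`, in the trivialization `i` near `x ∈ U i`;
the zero section if `x ∉ U i`. -/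
def localSection (i : ι) (x : M) (v : V i) : ∀ x, W x :=
  if hx : x ∈ B.U i then (exists_isSmoothSection_eventuallyEq_symm (B.isOpen_U i) subset_rfl hx
    (contMDiffOn_const (c := v))).choose else fun _ => 0

lemma isSmoothSection_localSection (i : ι) (x : M) (v : V i) :
    B.IsSmoothSection (B.localSection i x v) := by
  rw [localSection]
  split_ifs with hx
  · exact (exists_isSmoothSection_eventuallyEq_symm (B.isOpen_U i) subset_rfl hx
    (contMDiffOn_const (c := v))).choose_spec.1
  · exact isSmoothSection_zero

lemma localSection_eventuallyEq {i : ι} {x : M} (hx : x ∈ B.U i) (v : V i) :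
    ∀ᶠ y in nhds x, B.localSection i x v y = B.symm i y v := by
  rw [localSection, dif_pos hx]
  exact (exists_isSmoothSection_eventuallyEq_symm (B.isOpen_U i) subset_rfl hx
    (contMDiffOn_const (c := v))).choose_spec.2

lemma exists_isSmoothSection_apply_eq (x : M) (w : W x) : ∃ s, B.IsSmoothSection s ∧ s x = w := by
  obtain ⟨i, hi⟩ := B.exists_mem_U x
  refine ⟨B.localSection i x (B.triv i x w), isSmoothSection_localSection _ _ _, ?_⟩
  rw [(localSection_eventuallyEq hi _).self_of_nhds, B.symm_triv i x hi]

lemma Connection.toFun_eq_zero_of_eventuallyEq_zero (D : B.Connection) {s : ∀ x, W x}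
    (hs : B.IsSmoothSection s) {x : M} (hsx : ∀ᶠ y in nhds x, s y = 0) : D.toFun s x = 0 := by
  obtain ⟨O, hsO, hO, hxO⟩ := eventually_nhds_iff.1 hsx
  obtain ⟨χ, hχ, hχO, χ_eq_one⟩ :=
    exists_contMDiff_tsupport_subset_eventuallyEq_one (E := E) hO hxO
  have smooth_cutoff : ContMDiff 𝓘(ℝ, E) 𝓘(ℝ, A) ∞ (fun y => χ y • (1 : A)) :=
    hχ.smul contMDiff_const
  have cutoff_eq_zero : (fun y => s y <• (χ y • (1 : A))) = fun _ => 0 := by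
    funext y
    by_cases hy : y ∈ O
    · rw [hsO y hy, smul_zero]
    · rw [image_eq_zero_of_notMem_tsupport (fun hyχ => hy (hχO hyχ)), zero_smul,
        MulOpposite.op_zero, zero_smul]
  ext ξ
  have leibniz := D.leibniz _ _ hs smooth_cutoff x ξ
  rw [cutoff_eq_zero, D.map_zero, hsx.self_of_nhds, smul_zero, zero_add, χ_eq_one.self_of_nhds,
    one_smul, MulOpposite.op_one, one_smul] at leibniz
  exact leibniz.symm

lemma Connection.toFun_congr (D : B.Connection) {s t : ∀ x, W x} (hs : B.IsSmoothSection s)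
    (ht : B.IsSmoothSection t) {x : M} (hst : ∀ᶠ y in nhds x, s y = t y) :
    D.toFun s x = D.toFun t x := by
  have map_add := congrFun (D.map_add _ _ (hs.sub ht) ht) x
  simp only [sub_add_cancel] at map_add
  rw [map_add, D.toFun_eq_zero_of_eventuallyEq_zero (hs.sub ht)
    (hst.mono fun y hy => sub_eq_zero.2 hy), zero_add]

end SmoothHilbertBundle

end Sections

section ConnectionForm

variable {A : Type*} [CStarAlgebra A] [PartialOrder A]
  {E : Type*} [NormedAddCommGroup E] [NormedSpace ℝ E]
  {M : Type*} [TopologicalSpace M] [ChartedSpace E M]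
  {W : M → Type*} [∀ x, NormedAddCommGroup (W x)] [∀ x, NormedSpace ℂ (W x)]
  [∀ x, Module Aᵐᵒᵖ (W x)] [∀ x, HilbertModule A (W x)]
  {ι : Type*} {V : ι → Type*} [∀ i, NormedAddCommGroup (V i)] [∀ i, NormedSpace ℂ (V i)]
  [∀ i, Module Aᵐᵒᵖ (V i)] [∀ i, HilbertModule A (V i)]

lemma differential_clm_comp {F G : Type*} [NormedAddCommGroup F] [NormedSpace ℝ F]
    [NormedAddCommGroup G] [NormedSpace ℝ G] (T : F →L[ℝ] G) {f : M → F} {x : M}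
    (hf : MDifferentiableAt 𝓘(ℝ, E) 𝓘(ℝ, F) f x) (v : TangentSpace 𝓘(ℝ, E) x) :
    differential (E := E) (fun y => T (f y)) x v = T (differential f x v) := by
  have chain_rule := mfderiv_comp x T.mdifferentiableAt hf
  rw [ContinuousLinearMap.mfderiv_eq] at chain_rule
  exact DFunLike.congr_fun chain_rule v

namespace SmoothHilbertBundle

/-- A form with values in the bundle, read in the trivialization `i`. -/
def trivForm (B : SmoothHilbertBundle A E W V) (i : ι) {p : ℕ} (α : DForm E W p) :
    DForm E (fun _ : M => V i) p :=
  fun x => ((B.triv i x).restrictScalars ℝ).compContinuousAlternatingMap (α x)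

variable {B : SmoothHilbertBundle A E W V} {i : ι} {s : ∀ x, W x} {x : M}

lemma IsSmoothSection.mdifferentiableAt_triv (hs : B.IsSmoothSection s) (hx : x ∈ B.U i) :
    MDifferentiableAt 𝓘(ℝ, E) 𝓘(ℝ, V i) (fun y => B.triv i y (s y)) x :=
  ((hs i).contMDiffAt ((B.isOpen_U i).mem_nhds hx)).mdifferentiableAt (by simp)

variable [StarOrderedRing A] [FiniteDimensional ℝ E] [T2Space M] [IsManifold 𝓘(ℝ, E) ∞ M]
  {n : ℕ} {e : Fin n → V i} {φ : Fin n → HomA A (V i) A}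

lemma IsSmoothSection.exists_frame_expansion (hframe : ∀ v, ∑ a, e a <• ((φ a).1 v) = v)
    (hs : B.IsSmoothSection s) (hx : x ∈ B.U i) :
    ∃ f : Fin n → M → A, (∀ a, ContMDiff 𝓘(ℝ, E) 𝓘(ℝ, A) ∞ (f a)) ∧
      (∀ a, f a =ᶠ[nhds x] fun y => (φ a).1 (B.triv i y (s y))) ∧
      ∀ᶠ y in nhds x, s y = ∑ a, B.localSection i x (e a) y <• f a y := by
  obtain ⟨χ, hχ, hχU, χ_eq_one⟩ :=
    exists_contMDiff_tsupport_subset_eventuallyEq_one (E := E) (B.isOpen_U i) hx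
  refine ⟨fun a y => χ y • (φ a).1 (B.triv i y (s y)), fun a y => ?_, fun a => ?_, ?_⟩
  · exact contMDiffAt_smul_of_tsupport hχ fun hy =>
      ((φ a).1.restrictScalars ℝ).contDiff.contMDiff.contMDiffAt.comp y
        ((hs i).contMDiffAt ((B.isOpen_U i).mem_nhds (hχU hy)))
  · filter_upwards [χ_eq_one] with y hy
    rw [hy, one_smul]
  · filter_upwards [χ_eq_one, (B.isOpen_U i).mem_nhds hx,
      Filter.eventually_all.2 fun a => localSection_eventuallyEq hx (e a)] with y hχy hyU he
    simp only [he, hχy, one_smul]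
    conv_lhs => rw [← B.symm_triv i y hyU (s y), ← hframe (B.triv i y (s y)), _root_.map_sum]
    exact Finset.sum_congr rfl fun a _ => (B.symm_hom i y hyU).map_smul _ _

namespace Connection

variable (D : B.Connection)

/-- The form `ω` such that the connection is `d + ω` in the trivialization `i`, computed from a
frame `(e, φ)` of `V i`; see `triv_toFun`. -/
def form (e : Fin n → V i) (φ : Fin n → HomA A (V i) A) : DForm E (fun _ : M => EndA A (V i)) 1 :=
  fun x => ∑ a, (EndA.rankOneL (φ a)).compContinuousAlternatingMap
    (B.trivForm i (D.toFun (B.localSection i x (e a))) x)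

lemma form_eventuallyEq (hx : x ∈ B.U i) :
    ∀ᶠ y in nhds x, D.form e φ y = ∑ a, (EndA.rankOneL (φ a)).compContinuousAlternatingMap
      (B.trivForm i (D.toFun (B.localSection i x (e a))) y) := by
  filter_upwards [(B.isOpen_U i).mem_nhds hx, Filter.eventually_all.2 fun a =>
    (localSection_eventuallyEq hx (e a)).eventually_nhds] with y hyU hy
  refine Finset.sum_congr rfl fun a _ => ?_
  rw [trivForm, trivForm, D.toFun_congr (isSmoothSection_localSection i y (e a))
    (isSmoothSection_localSection i x (e a))]
  filter_upwards [hy a, localSection_eventuallyEq hyU (e a)] with z hxz hyz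
  rw [hxz, hyz]

lemma smoothOn_form : (D.form e φ).SmoothOn (B.U i) := by
  refine DForm.smoothOn_of_locally fun x hx => ?_
  obtain ⟨O, form_eq, hO, hxO⟩ := eventually_nhds_iff.1 (D.form_eventuallyEq (e := e) (φ := φ) hx)
  refine ⟨O ∩ B.U i, hO.inter (B.isOpen_U i), ⟨hxO, hx⟩, ?_⟩
  refine DForm.SmoothOn.congr (DForm.SmoothOn.sum fun a _ => ?_)
    fun y hy => (Finset.sum_apply y Finset.univ _).trans (form_eq y hy.1).symm
  exact DForm.SmoothOn.comp_clm (EndA.rankOneL (φ a)) (DForm.SmoothOn.mono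
    (D.smooth _ (isSmoothSection_localSection i x (e a)) i) Set.inter_subset_right)

lemma triv_toFun (hframe : ∀ v, ∑ a, e a <• ((φ a).1 v) = v) (hs : B.IsSmoothSection s)
    (hx : x ∈ B.U i) (ξ : Fin 1 → TangentSpace 𝓘(ℝ, E) x) :
    B.triv i x (D.toFun s x ξ) =
      differential (E := E) (fun y => B.triv i y (s y)) x (ξ 0) +
        (D.form e φ x ξ).1 (B.triv i x (s x)) := by
  obtain ⟨f, hf, f_eq, s_eq⟩ := hs.exists_frame_expansion hframe hx
  have smooth_e (a : Fin n) := isSmoothSection_localSection (B := B) i x (e a)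
  have differential_f (a : Fin n) : differential (E := E) (f a) x (ξ 0) =
      (φ a).1 (differential (E := E) (fun y => B.triv i y (s y)) x (ξ 0)) := by
    rw [differential, (f_eq a).mfderiv_eq]
    exact differential_clm_comp ((φ a).1.restrictScalars ℝ) (hs.mdifferentiableAt_triv hx) (ξ 0)
  have toFun_s : D.toFun s x ξ =
      ∑ a, (B.localSection i x (e a) x <• differential (f a) x (ξ 0) +
        D.toFun (B.localSection i x (e a)) x ξ <• f a x) := by
    rw [D.toFun_congr hs (.sum _ fun a => (smooth_e a).op_smul (hf a)) s_eq,
      D.map_sum _ fun a => (smooth_e a).op_smul (hf a), ContinuousAlternatingMap.sum_apply]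
    exact Finset.sum_congr rfl fun a _ => D.leibniz _ _ (smooth_e a) (hf a) x ξ
  have form_apply : (D.form e φ x ξ).1 (B.triv i x (s x)) =
      ∑ a, B.triv i x (D.toFun (B.localSection i x (e a)) x ξ) <• (f a x) := by
    simp only [(f_eq _).self_of_nhds, ← EndA.action_apply]
    rw [form, ContinuousAlternatingMap.sum_apply, _root_.map_sum, _root_.sum_apply]
    rfl
  rw [toFun_s, form_apply, _root_.map_sum,
    ← hframe (differential (E := E) (fun y => B.triv i y (s y)) x (ξ 0)),
    ← Finset.sum_add_distrib]
  refine Finset.sum_congr rfl fun a _ => ?_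
  rw [_root_.map_add, (B.triv_hom i x hx).map_smul, (B.triv_hom i x hx).map_smul, differential_f,
    (localSection_eventuallyEq hx (e a)).self_of_nhds, B.triv_symm i x hx]

end Connection

end SmoothHilbertBundle

end ConnectionForm

section CovariantDerivative

variable {E V R : Type*} [NormedAddCommGroup E] [NormedSpace ℝ E] [NormedAddCommGroup V]
  [NormedSpace ℝ V] [NormedRing R] [NormedAlgebra ℝ R]

lemma extDeriv_apply_one {α : E → E [⋀^Fin 1]→L[ℝ] V} {y : E} (hα : DifferentiableAt ℝ α y)
    (u : Fin 2 → E) :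
    extDeriv α y u = fderiv ℝ α y (u 0) (fun _ => u 1) - fderiv ℝ α y (u 1) (fun _ => u 0) := by
  have removeNth_zero : Fin.removeNth 0 u = fun _ => u 1 := by funext i; fin_cases i; rfl
  have removeNth_one : Fin.removeNth 1 u = fun _ => u 0 := by funext i; fin_cases i; rfl
  rw [extDeriv_apply hα, Fin.sum_univ_two, removeNth_zero, removeNth_one]
  simp [fderiv_continuousAlternatingMap_apply_const_apply hα, sub_eq_add_neg]

/-- The covariant derivative `dS + γ S` of a function `S` with values in a representation `ρ` of
the algebra in which `γ` takes its values. -/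
def covariantDeriv (ρ : R →L[ℝ] V →L[ℝ] V) (γ : E → E [⋀^Fin 1]→L[ℝ] R) (S : E → V) (y : E) :
    E [⋀^Fin 1]→L[ℝ] V :=
  ContinuousAlternatingMap.ofSubsingleton ℝ E V (0 : Fin 1) (fderiv ℝ S y) +
    (ρ.flip (S y)).compContinuousAlternatingMap (γ y)

variable {ρ : R →L[ℝ] V →L[ℝ] V} {γ : E → E [⋀^Fin 1]→L[ℝ] R} {S : E → V} {y : E} {n : ℕ}
  {a : Fin n → E → E [⋀^Fin 1]→L[ℝ] ℝ} {t : Fin n → E → V}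

lemma covariantDeriv_apply (w : Fin 1 → E) :
    covariantDeriv ρ γ S y w = fderiv ℝ S y (w 0) + ρ (γ y w) (S y) := rfl

lemma fderiv_fderiv_add_eq_sum (hγ : DifferentiableAt ℝ γ y) (hS : ContDiffAt ℝ 2 S y)
    (ha : ∀ j, DifferentiableAt ℝ (a j) y) (ht : ∀ j, DifferentiableAt ℝ (t j) y)
    (hSa : ∀ᶠ z in nhds y, ∀ w, covariantDeriv ρ γ S z w = ∑ j, a j z w • t j z) (v w : E) :
    fderiv ℝ (fderiv ℝ S) y v w + (ρ (γ y fun _ => w) (fderiv ℝ S y v) +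
        ρ (fderiv ℝ γ y v fun _ => w) (S y)) =
      ∑ j, (a j y (fun _ => w) • fderiv ℝ (t j) y v + fderiv ℝ (a j) y v (fun _ => w) • t j y) := by
  have hasFDerivAt_covariantDeriv :=
    ((((hS.fderiv_right (m := 1) le_rfl).differentiableAt one_ne_zero).hasFDerivAt).clm_apply
      (hasFDerivAt_const w y)).add ((ρ.hasFDerivAt.comp y
        (hγ.hasFDerivAt.continuousAlternatingMap_apply_const fun _ => w)).clm_apply
          (hS.differentiableAt two_ne_zero).hasFDerivAt)
  have hasFDerivAt_sum := HasFDerivAt.fun_sum (u := Finset.univ) fun j _ =>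
    ((ha j).hasFDerivAt.continuousAlternatingMap_apply_const fun _ => w).smul (ht j).hasFDerivAt
  have fderiv_eq := hasFDerivAt_covariantDeriv.unique
    (hasFDerivAt_sum.congr_of_eventuallyEq (hSa.mono fun z hz => hz fun _ => w))
  simpa using DFunLike.congr_fun fderiv_eq v

lemma extDeriv_sum_smul_eq (hγ : DifferentiableAt ℝ γ y) (hS : ContDiffAt ℝ 2 S y)
    (ha : ∀ j, DifferentiableAt ℝ (a j) y) (ht : ∀ j, DifferentiableAt ℝ (t j) y)
    (hSa : ∀ᶠ z in nhds y, ∀ w, covariantDeriv ρ γ S z w = ∑ j, a j z w • t j z) (u : Fin 2 → E) :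
    ∑ j, (extDeriv (a j) y u • t j y - (a j y (fun _ => u 0) • fderiv ℝ (t j) y (u 1) -
        a j y (fun _ => u 1) • fderiv ℝ (t j) y (u 0))) =
      ρ (extDeriv γ y u) (S y) - (ρ (γ y fun _ => u 0) (fderiv ℝ S y (u 1)) -
        ρ (γ y fun _ => u 1) (fderiv ℝ S y (u 0))) := by
  have second_symm : fderiv ℝ (fderiv ℝ S) y (u 0) (u 1) = fderiv ℝ (fderiv ℝ S) y (u 1) (u 0) :=
    (hS.isSymmSndFDerivAt (by simp)).eq _ _
  have d01 := fderiv_fderiv_add_eq_sum hγ hS ha ht hSa (u 0) (u 1)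
  have d10 := fderiv_fderiv_add_eq_sum hγ hS ha ht hSa (u 1) (u 0)
  have antisymmetrized := congrArg₂ (· - ·) d01 d10
  rw [second_symm] at antisymmetrized
  simp only [add_sub_add_left_eq_sub, extDeriv_apply_one hγ, extDeriv_apply_one (ha _), sub_smul,
    map_sub, _root_.sub_apply, Finset.sum_sub_distrib, Finset.sum_add_distrib] at antisymmetrized ⊢
  linear_combination (norm := module) -antisymmetrized

lemma sum_smul_action_eq (hρ : ∀ a b v, ρ (a * b) v = ρ a (ρ b v))
    (hSa : ∀ w, covariantDeriv ρ γ S y w = ∑ j, a j y w • t j y) (u : Fin 2 → E) :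
    ∑ j, (a j y (fun _ => u 0) • ρ (γ y fun _ => u 1) (t j y) -
        a j y (fun _ => u 1) • ρ (γ y fun _ => u 0) (t j y)) =
      -ρ ((γ y ⋏ γ y) u) (S y) - (ρ (γ y fun _ => u 0) (fderiv ℝ S y (u 1)) -
        ρ (γ y fun _ => u 1) (fderiv ℝ S y (u 0))) := by
  have action_covariantDeriv (v w : E) : ∑ j, a j y (fun _ => w) • ρ (γ y fun _ => v) (t j y) =
      ρ (γ y fun _ => v) (fderiv ℝ S y w) + ρ (γ y fun _ => v) (ρ (γ y fun _ => w) (S y)) := by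
    simpa only [covariantDeriv_apply, map_add, map_sum, map_smul] using
      (congrArg (ρ (γ y fun _ => v)) (hSa fun _ => w)).symm
  rw [Finset.sum_sub_distrib, action_covariantDeriv, action_covariantDeriv, wedge_apply_one_one,
    ContinuousLinearMap.mul_apply', ContinuousLinearMap.mul_apply', map_sub, _root_.sub_apply,
    hρ, hρ]
  abel

/-- If `∇S = ∑ⱼ aⱼ ⊗ tⱼ`, then comparing `d(∇S) + γ ∧ ∇S` with the same expression for the right
hand side computes the second covariant derivative. -/
theorem sum_extDeriv_smul_sub_wedge_covariantDeriv (hρ : ∀ a b v, ρ (a * b) v = ρ a (ρ b v))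
    (hγ : DifferentiableAt ℝ γ y) (hS : ContDiffAt ℝ 2 S y)
    (ha : ∀ j, DifferentiableAt ℝ (a j) y) (ht : ∀ j, DifferentiableAt ℝ (t j) y)
    (hSa : ∀ᶠ z in nhds y, ∀ w, covariantDeriv ρ γ S z w = ∑ j, a j z w • t j z) (u : Fin 2 → E) :
    ∑ j, (extDeriv (a j) y u • t j y -
        wedge (ContinuousLinearMap.lsmul ℝ ℝ) (a j y) (covariantDeriv ρ γ (t j) y) u) =
      ρ (formCurvature γ y u) (S y) := by
  calc ∑ j, (extDeriv (a j) y u • t j y -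
        wedge (ContinuousLinearMap.lsmul ℝ ℝ) (a j y) (covariantDeriv ρ γ (t j) y) u)
    _ = ∑ j, (extDeriv (a j) y u • t j y - (a j y (fun _ => u 0) • fderiv ℝ (t j) y (u 1) -
          a j y (fun _ => u 1) • fderiv ℝ (t j) y (u 0))) -
        ∑ j, (a j y (fun _ => u 0) • ρ (γ y fun _ => u 1) (t j y) -
          a j y (fun _ => u 1) • ρ (γ y fun _ => u 0) (t j y)) := by
      rw [← Finset.sum_sub_distrib]
      refine Finset.sum_congr rfl fun j _ => ?_
      simp only [wedge_apply_one_one, covariantDeriv_apply, ContinuousLinearMap.lsmul_apply,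
        smul_add]
      abel
    _ = ρ (formCurvature γ y u) (S y) := by
      rw [extDeriv_sum_smul_eq hγ hS ha ht hSa, sum_smul_action_eq hρ hSa.self_of_nhds,
        formCurvature, ContinuousAlternatingMap.add_apply, map_add, _root_.add_apply]
      abel

end CovariantDerivative

section SecondCovariantDerivative

variable {A : Type*} [CStarAlgebra A] [PartialOrder A]
  {E : Type*} [NormedAddCommGroup E] [NormedSpace ℝ E]
  {M : Type*} [TopologicalSpace M] [ChartedSpace E M]
  {W : M → Type*} [∀ x, NormedAddCommGroup (W x)] [∀ x, NormedSpace ℂ (W x)]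
  [∀ x, Module Aᵐᵒᵖ (W x)] [∀ x, HilbertModule A (W x)]
  {ι : Type*} {V : ι → Type*} [∀ i, NormedAddCommGroup (V i)] [∀ i, NormedSpace ℂ (V i)]
  [∀ i, Module Aᵐᵒᵖ (V i)] [∀ i, HilbertModule A (V i)]

lemma DForm.inChart_apply_mfderiv [IsManifold 𝓘(ℝ, E) ∞ M] {F : Type*} [NormedAddCommGroup F]
    [NormedSpace ℝ F] {p : ℕ} (α : DForm E (fun _ : M => F) p) {c : OpenPartialHomeomorph M E}
    (hc : c ∈ atlas E M) {x : M} (hx : x ∈ c.source) (ξ : Fin p → TangentSpace 𝓘(ℝ, E) x) :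
    α.inChart c (c x) (fun j => mfderiv 𝓘(ℝ, E) 𝓘(ℝ, E) c x (ξ j)) = α x ξ :=
  DFunLike.congr_fun (inChart_compContinuousLinearMap_mfderiv α hc hx) ξ

namespace SmoothHilbertBundle

/-- The local representative of the section `s` in the trivialization `i` and the chart `c`. -/
def localRep (B : SmoothHilbertBundle A E W V) (i : ι) (c : OpenPartialHomeomorph M E)
    (s : ∀ x, W x) (y : E) : V i :=
  B.triv i (c.symm y) (s (c.symm y))

variable {B : SmoothHilbertBundle A E W V} {i : ι} {s : ∀ x, W x} {x : M}
  {c : OpenPartialHomeomorph M E} {y : E}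

lemma triv_wedge_lsmul (a : TangentSpace 𝓘(ℝ, E) x [⋀^Fin 1]→L[ℝ] ℝ) (β : DForm E W 1)
    (ξ : Fin 2 → TangentSpace 𝓘(ℝ, E) x) :
    B.triv i x (wedge (ContinuousLinearMap.lsmul ℝ ℝ) a (β x) ξ) =
      wedge (ContinuousLinearMap.lsmul ℝ ℝ) a (B.trivForm i β x) ξ := by
  have triv_smul (r : ℝ) (w : W x) : B.triv i x (r • w) = r • B.triv i x w :=
    (B.triv i x).map_smul_of_tower r w
  rw [wedge_apply_one_one, wedge_apply_one_one, _root_.map_sub]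
  exact congrArg₂ _ (triv_smul _ _) (triv_smul _ _)

lemma triv_sum_smul {m : ℕ} (r : Fin m → ℝ) (w : Fin m → W x) :
    B.triv i x (∑ j, r j • w j) = ∑ j, r j • B.triv i x (w j) :=
  map_sum ((B.triv i x).restrictScalars ℝ) _ _ |>.trans <|
    Finset.sum_congr rfl fun j _ => (B.triv i x).map_smul_of_tower (r j) (w j)

variable [IsManifold 𝓘(ℝ, E) ∞ M]

lemma IsSmoothSection.contDiffAt_localRep (hs : B.IsSmoothSection s) (hc : c ∈ atlas E M)
    (hy : y ∈ c.target ∩ c.symm ⁻¹' B.U i) : ContDiffAt ℝ ∞ (B.localRep i c s) y := by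
  have smooth_symm := contMDiffOn_symm_of_mem_maximalAtlas (I := 𝓘(ℝ, E)) (n := ∞)
    (IsManifold.subset_maximalAtlas hc)
  exact (((hs i).contMDiffAt ((B.isOpen_U i).mem_nhds hy.2)).comp y
    (smooth_symm.contMDiffAt (c.open_target.mem_nhds hy.1))).contDiffAt

lemma IsSmoothSection.fderiv_localRep (hs : B.IsSmoothSection s) (hc : c ∈ atlas E M)
    (hy : y ∈ c.target ∩ c.symm ⁻¹' B.U i) (w : E) :
    fderiv ℝ (B.localRep i c s) y w = differential (E := E) (fun x => B.triv i x (s x)) (c.symm y)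
      (mfderiv 𝓘(ℝ, E) 𝓘(ℝ, E) c.symm y w) := by
  rw [← mfderiv_eq_fderiv]
  exact DFunLike.congr_fun (mfderiv_comp y (hs.mdifferentiableAt_triv hy.2)
    ((DForm.mdifferentiable_chart hc).mdifferentiableAt_symm hy.1)) w

variable [StarOrderedRing A] [FiniteDimensional ℝ E] [T2Space M]

namespace Connection

variable (D : B.Connection) {n m : ℕ} {e : Fin n → V i} {φ : Fin n → HomA A (V i) A}
  {O : Set M} {α : Fin m → DForm E (fun _ : M => ℝ) 1} {t : Fin m → ∀ x, W x}

lemma inChart_trivForm_toFun (hframe : ∀ v, ∑ a, e a <• ((φ a).1 v) = v)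
    (hs : B.IsSmoothSection s) (hc : c ∈ atlas E M) (hy : y ∈ c.target ∩ c.symm ⁻¹' B.U i) :
    (B.trivForm i (D.toFun s)).inChart c y = covariantDeriv (EndA.action A (V i))
      (fun z => (D.form e φ).inChart c z) (B.localRep i c s) y := by
  ext w
  rw [covariantDeriv_apply, hs.fderiv_localRep hc hy]
  exact D.triv_toFun hframe hs hy.2 fun j => mfderiv 𝓘(ℝ, E) 𝓘(ℝ, E) c.symm y (w j)

lemma inChart_second_covariantDeriv (hframe : ∀ v, ∑ a, e a <• ((φ a).1 v) = v)
    (hs : B.IsSmoothSection s) (hO : IsOpen O) (hα : ∀ j, (α j).IsSmooth)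
    (ht : ∀ j, B.IsSmoothSection (t j))
    (toFun_eq : ∀ x ∈ O, ∀ ξ, D.toFun s x ξ = ∑ j, α j x ξ • t j x)
    (hc : c ∈ atlas E M) (hy : y ∈ c.target ∩ c.symm ⁻¹' B.U i) (hyO : c.symm y ∈ O)
    (u : Fin 2 → E) :
    ∑ j, ((α j).d.inChart c y u • B.localRep i c (t j) y -
      wedge (ContinuousLinearMap.lsmul ℝ ℝ) ((α j).inChart c y)
        ((B.trivForm i (D.toFun (t j))).inChart c y) u) =
      EndA.action A (V i) ((D.form e φ).curvature.inChart c y u) (B.localRep i c s y) := by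
  have smooth_α (j : Fin m) := DForm.isSmooth_iff_smoothOn_univ.1 (hα j)
  have smooth_form : (D.form e φ).SmoothOn (B.U i) := D.smoothOn_form
  have localRep_toFun : ∀ᶠ z in nhds y, ∀ w : Fin 1 → E, covariantDeriv (EndA.action A (V i))
      (fun z => (D.form e φ).inChart c z) (B.localRep i c s) z w =
        ∑ j, (α j).inChart c z w • B.localRep i c (t j) z := by
    filter_upwards [(c.symm.isOpen_inter_preimage (B.isOpen_U i)).mem_nhds hy,
      (c.symm.isOpen_inter_preimage hO).mem_nhds ⟨hy.1, hyO⟩] with z hz hzO w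
    rw [← D.inChart_trivForm_toFun hframe hs hc hz]
    exact (congrArg (B.triv i (c.symm z)) (toFun_eq _ hzO.2 _)).trans (triv_sum_smul _ _)
  have second_covariantDeriv := sum_extDeriv_smul_sub_wedge_covariantDeriv
    (fun _ _ _ => rfl)
    ((smooth_form.contDiffAt (B.isOpen_U i) hc hy).differentiableAt (by simp))
    ((hs.contDiffAt_localRep hc hy).of_le ENat.LEInfty.out)
    (fun j => ((smooth_α j).contDiffAt isOpen_univ hc
      ⟨hy.1, Set.mem_univ _⟩).differentiableAt (by simp))
    (fun j => ((ht j).contDiffAt_localRep hc hy).differentiableAt (by simp)) localRep_toFun u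
  rw [DForm.inChart_curvature (B.isOpen_U i) smooth_form hc hy]
  refine Eq.trans (Finset.sum_congr rfl fun j _ => ?_) second_covariantDeriv
  rw [DForm.inChart_d isOpen_univ (smooth_α j) hc ⟨hy.1, Set.mem_univ _⟩,
    D.inChart_trivForm_toFun hframe (ht j) hc hy]

lemma triv_second_covariantDeriv (hframe : ∀ v, ∑ a, e a <• ((φ a).1 v) = v)
    (hs : B.IsSmoothSection s) (hO : IsOpen O) (hα : ∀ j, (α j).IsSmooth)
    (ht : ∀ j, B.IsSmoothSection (t j))
    (toFun_eq : ∀ x ∈ O, ∀ ξ, D.toFun s x ξ = ∑ j, α j x ξ • t j x)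
    (hxO : x ∈ O) (hx : x ∈ B.U i) (ξ : Fin 2 → TangentSpace 𝓘(ℝ, E) x) :
    B.triv i x (∑ j, ((α j).d x ξ • t j x +
      (-1 : ℝ) ^ 1 • wedge (ContinuousLinearMap.lsmul ℝ ℝ) (α j x) (D.toFun (t j) x) ξ)) =
      ((D.form e φ).curvature x ξ).1 (B.triv i x (s x)) := by
  have hc := chart_mem_atlas E x
  have hxc := mem_chart_source E x
  have left_inv := (chartAt E x).left_inv hxc
  have localRep_apply (s : ∀ x, W x) :
      B.localRep i (chartAt E x) s (chartAt E x x) = B.triv i x (s x) := by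
    rw [localRep, left_inv]
  have in_chart := D.inChart_second_covariantDeriv hframe hs hO hα ht toFun_eq hc
    (DForm.chartAt_mem_target_inter_preimage (E := E) hx) (by rwa [left_inv])
    (fun j => mfderiv 𝓘(ℝ, E) 𝓘(ℝ, E) (chartAt E x) x (ξ j))
  rw [DForm.inChart_apply_mfderiv _ hc hxc, localRep_apply] at in_chart
  rw [← EndA.action_apply, ← in_chart, _root_.map_sum]
  refine Finset.sum_congr rfl fun j _ => ?_
  rw [_root_.map_add, pow_one, neg_one_smul, _root_.map_neg, ← sub_eq_add_neg, triv_wedge_lsmul,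
    ← DForm.inChart_wedge, DForm.inChart_apply_mfderiv _ hc hxc,
    DForm.inChart_apply_mfderiv _ hc hxc, localRep_apply]
  exact congrArg (· - _) ((B.triv i x).map_smul_of_tower _ _)

end Connection

end SmoothHilbertBundle

end SecondCovariantDerivative

section Decomposition

variable {E : Type*} [NormedAddCommGroup E] [NormedSpace ℝ E]
  {M : Type*} [TopologicalSpace M] [ChartedSpace E M] [IsManifold 𝓘(ℝ, E) ∞ M]
  {F : Type*} [NormedAddCommGroup F] [NormedSpace ℝ F]

namespace DForm

variable (E) in
/-- A function, as a form of degree zero. -/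
def ofFun (f : M → F) : DForm E (fun _ : M => F) 0 :=
  fun x => ContinuousAlternatingMap.constOfIsEmpty ℝ (TangentSpace 𝓘(ℝ, E) x) (Fin 0) (f x)

lemma isSmooth_ofFun {f : M → F} (hf : ContMDiff 𝓘(ℝ, E) 𝓘(ℝ, F) ∞ f) : (ofFun E f).IsSmooth := by
  refine .of_contDiffOn fun c hc => ?_
  have smooth_symm := contMDiffOn_symm_of_mem_maximalAtlas (I := 𝓘(ℝ, E)) (n := ∞)
    (IsManifold.subset_maximalAtlas hc)
  exact (ContinuousAlternatingMap.constOfIsEmptyLIE ℝ E F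
    (Fin 0)).toContinuousLinearEquiv.contDiff.comp_contDiffOn
      (contMDiffOn_iff_contDiffOn.1 (hf.comp_contMDiffOn smooth_symm))

lemma d_ofFun_apply {f : M → F} (hf : ContMDiff 𝓘(ℝ, E) 𝓘(ℝ, F) ∞ f)
    {c : OpenPartialHomeomorph M E} (hc : c ∈ atlas E M) {x : M} (hx : x ∈ c.source)
    (ξ : Fin 1 → TangentSpace 𝓘(ℝ, E) x) :
    (ofFun E f).d x ξ = fderiv ℝ (f ∘ c.symm) (c x) (mfderiv 𝓘(ℝ, E) 𝓘(ℝ, E) c x (ξ 0)) := by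
  rw [← inChart_apply_mfderiv _ hc hx, inChart_d isOpen_univ
    (isSmooth_iff_smoothOn_univ.1 (isSmooth_ofFun hf)) hc ⟨c.map_source hx, Set.mem_univ _⟩]
  exact DFunLike.congr_fun (extDeriv_constOfIsEmpty (f ∘ c.symm) (c x)) _

lemma exists_isSmooth_eventuallyEq_coordinate [FiniteDimensional ℝ E] [T2Space M] (x : M)
    (b : E →L[ℝ] ℝ) :
    ∃ α : DForm E (fun _ : M => ℝ) 1, α.IsSmooth ∧ ∀ᶠ y in nhds x,
      ∀ ξ, α y ξ = b (mfderiv 𝓘(ℝ, E) 𝓘(ℝ, E) (chartAt E x) y (ξ 0)) := by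
  set c := chartAt E x
  have hc : c ∈ atlas E M := chart_mem_atlas E x
  have hxc : x ∈ c.source := mem_chart_source E x
  obtain ⟨χ, hχ, hχc, χ_eq_one⟩ :=
    exists_contMDiff_tsupport_subset_eventuallyEq_one (E := E) c.open_source hxc
  have smooth_c : ContMDiffOn 𝓘(ℝ, E) 𝓘(ℝ, E) ∞ c c.source :=
    contMDiffOn_of_mem_maximalAtlas (IsManifold.subset_maximalAtlas hc)
  have smooth_cutoff : ContMDiff 𝓘(ℝ, E) 𝓘(ℝ, ℝ) ∞ (fun y => χ y • b (c y)) := fun y =>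
    contMDiffAt_smul_of_tsupport hχ fun hy => b.contDiff.contMDiff.contMDiffAt.comp y
      (smooth_c.contMDiffAt (c.open_source.mem_nhds (hχc hy)))
  refine ⟨(ofFun E fun y => χ y • b (c y)).d, isSmooth_iff_smoothOn_univ.2
    ((isSmooth_iff_smoothOn_univ.1 (isSmooth_ofFun smooth_cutoff)).d isOpen_univ), ?_⟩
  filter_upwards [χ_eq_one.eventually_nhds, c.open_source.mem_nhds hxc] with y hy hyc ξ
  have cutoff_eq : (fun y => χ y • b (c y)) ∘ c.symm =ᶠ[nhds (c y)] b := by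
    have tendsto_symm := c.continuousAt_symm (c.map_source hyc)
    rw [ContinuousAt, c.left_inv hyc] at tendsto_symm
    filter_upwards [tendsto_symm.eventually hy, c.open_target.mem_nhds (c.map_source hyc)]
      with z hz hzc
    rw [Function.comp_apply, hz, one_smul, c.right_inv hzc]
  rw [d_ofFun_apply smooth_cutoff hc hyc, cutoff_eq.fderiv_eq, b.fderiv]

end DForm

lemma alternating_apply_eq_sum_coord {κ : Type*} [Fintype κ] (b : Module.Basis κ ℝ E)
    (β : E [⋀^Fin 1]→L[ℝ] F) (w : Fin 1 → E) :
    β w = ∑ j, b.coord j (w 0) • β (fun _ => b j) := by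
  have w_eq : w = fun _ => w 0 := funext fun j => by rw [Subsingleton.elim j 0]
  rw [w_eq]
  let β' : E →L[ℝ] F := (ContinuousAlternatingMap.ofSubsingleton ℝ E F (0 : Fin 1)).symm β
  calc β' (w 0) = β' (∑ j, b.coord j (w 0) • b j) := congrArg β' (b.sum_repr (w 0)).symm
    _ = ∑ j, b.coord j (w 0) • β' (b j) := by simp only [map_sum, map_smul]

variable {A : Type*} [CStarAlgebra A] [PartialOrder A]
  {W : M → Type*} [∀ x, NormedAddCommGroup (W x)] [∀ x, NormedSpace ℂ (W x)]
  [∀ x, Module Aᵐᵒᵖ (W x)] [∀ x, HilbertModule A (W x)]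
  {ι : Type*} {V : ι → Type*} [∀ i, NormedAddCommGroup (V i)] [∀ i, NormedSpace ℂ (V i)]
  [∀ i, Module Aᵐᵒᵖ (V i)] [∀ i, HilbertModule A (V i)]
  [FiniteDimensional ℝ E] [T2Space M]

namespace SmoothHilbertBundle

variable {B : SmoothHilbertBundle A E W V}

lemma IsSmoothForm.exists_isSmoothSection_eventuallyEq_inChart {θ : DForm E W 1}
    (hθ : B.IsSmoothForm θ) {i : ι} {x : M} (hx : x ∈ B.U i) (v : E) :
    ∃ t, B.IsSmoothSection t ∧ ∀ᶠ y in nhds x, t y = B.symm i y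
      ((B.trivForm i θ).inChart (chartAt E x) (chartAt E x y) (fun _ => v)) := by
  set c := chartAt E x
  have hc : c ∈ atlas E M := chart_mem_atlas E x
  have smooth_θ : ContDiffOn ℝ ∞ (fun y => (B.trivForm i θ).inChart c y)
      (c.target ∩ c.symm ⁻¹' B.U i) := hθ i c hc
  refine exists_isSmoothSection_eventuallyEq_symm (c.open_source.inter (B.isOpen_U i))
    Set.inter_subset_right ⟨mem_chart_source E x, hx⟩ ?_
  refine (contMDiffOn_iff_contDiffOn.2 ((ContinuousAlternatingMap.apply ℝ E (V i)
    (fun _ : Fin 1 => v)).contDiff.comp_contDiffOn smooth_θ)).comp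
    ((contMDiffOn_of_mem_maximalAtlas (IsManifold.subset_maximalAtlas hc)).mono
      Set.inter_subset_left) fun y hy => ⟨c.map_source hy.1, ?_⟩
  rw [Set.mem_preimage, c.left_inv hy.1]
  exact hy.2

lemma IsSmoothForm.exists_eq_sum_smul {θ : DForm E W 1} (hθ : B.IsSmoothForm θ) (x : M) :
    ∃ (O : Set M) (m : ℕ) (α : Fin m → DForm E (fun _ : M => ℝ) 1) (t : Fin m → ∀ x, W x),
      IsOpen O ∧ x ∈ O ∧ (∀ j, (α j).IsSmooth) ∧ (∀ j, B.IsSmoothSection (t j)) ∧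
      ∀ y ∈ O, ∀ ξ, θ y ξ = ∑ j, α j y ξ • t j y := by
  obtain ⟨i, hi⟩ := B.exists_mem_U x
  let b := Module.finBasis ℝ E
  choose α hα α_eq using fun j => DForm.exists_isSmooth_eventuallyEq_coordinate (M := M) x
    (LinearMap.toContinuousLinearMap (b.coord j))
  choose t ht t_eq using fun j => hθ.exists_isSmoothSection_eventuallyEq_inChart hi (b j)
  suffices θ_eq : ∀ᶠ y in nhds x, ∀ ξ, θ y ξ = ∑ j, α j y ξ • t j y by
    obtain ⟨O, hO, isOpen_O, hxO⟩ := eventually_nhds_iff.1 θ_eq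
    exact ⟨O, _, α, t, isOpen_O, hxO, hα, ht, hO⟩
  filter_upwards [Filter.eventually_all.2 α_eq, Filter.eventually_all.2 t_eq,
    (chartAt E x).open_source.mem_nhds (mem_chart_source E x), (B.isOpen_U i).mem_nhds hi]
    with y hα ht hyc hyi ξ
  have in_chart : B.triv i y (θ y ξ) = _ :=
    (DForm.inChart_apply_mfderiv (B.trivForm i θ) (chart_mem_atlas E x) hyc ξ).symm
  rw [← B.symm_triv i y hyi (θ y ξ), in_chart]
  refine (congrArg (B.symm i y) (alternating_apply_eq_sum_coord b _ _)).trans ?_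
  rw [_root_.map_sum]
  refine Finset.sum_congr rfl fun j _ => ?_
  rw [hα, ht]
  exact (B.symm i y).map_smul_of_tower _ _

end SmoothHilbertBundle

end Decomposition

section CurvatureOfConnection

variable {A : Type*} [CStarAlgebra A] [PartialOrder A] [StarOrderedRing A]
  {E : Type*} [NormedAddCommGroup E] [NormedSpace ℝ E]
  {M : Type*} [TopologicalSpace M] [ChartedSpace E M]
  {W : M → Type*} [∀ x, NormedAddCommGroup (W x)] [∀ x, NormedSpace ℂ (W x)]
  [∀ x, Module Aᵐᵒᵖ (W x)] [∀ x, HilbertModule A (W x)]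
  {ι : Type*} {V : ι → Type*} [∀ i, NormedAddCommGroup (V i)] [∀ i, NormedSpace ℂ (V i)]
  [∀ i, Module Aᵐᵒᵖ (V i)] [∀ i, HilbertModule A (V i)]

namespace SmoothHilbertBundle

variable {B : SmoothHilbertBundle A E W V} {i : ι} {x : M}

lemma exists_frame_of_mem_U (hW : ∀ x, IsFGP A (W x)) (hx : x ∈ B.U i) :
    ∃ (n : ℕ) (e : Fin n → V i) (φ : Fin n → HomA A (V i) A),
      ∀ v, ∑ a, e a <• ((φ a).1 v) = v := by
  obtain ⟨n, e, φ, hframe⟩ := (hW x).exists_frame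
  exact ⟨n, _, _,
    frame_compHom hframe (B.triv_hom i x hx) (B.symm_hom i x hx) (B.triv_symm i x hx)⟩

lemma exists_mem_U_and_frame (B : SmoothHilbertBundle A E W V) (hW : ∀ x, IsFGP A (W x)) (x : M) :
    ∃ (i : ι) (n : ℕ) (e : Fin n → V i) (φ : Fin n → HomA A (V i) A),
      x ∈ B.U i ∧ ∀ v, ∑ a, e a <• ((φ a).1 v) = v := by
  obtain ⟨i, hx⟩ := B.exists_mem_U x
  obtain ⟨n, e, φ, hframe⟩ := exists_frame_of_mem_U hW hx
  exact ⟨i, n, e, φ, hx, hframe⟩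

/-- An endomorphism of a fibre, read in a trivialization, as an endomorphism of the model; unlike
`endTriv`, it takes values in the algebra `EndA A (V i)` and is only defined over `B.U i`. -/
def trivEnd (B : SmoothHilbertBundle A E W V) (hx : x ∈ B.U i) :
    EndA A (W x) →L[ℝ] EndA A (V i) :=
  EndA.conj (B.symm_hom i x hx) (B.triv_hom i x hx)

lemma trivEnd_injective (hx : x ∈ B.U i) : Function.Injective (B.trivEnd hx) :=
  EndA.conj_injective _ _ (B.symm_triv i x hx)

variable [FiniteDimensional ℝ E] [T2Space M] [IsManifold 𝓘(ℝ, E) ∞ M]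

namespace Connection

variable (D : B.Connection) {n : ℕ} {e : Fin n → V i} {φ : Fin n → HomA A (V i) A}
  {Ω : DForm E (fun x => EndA A (W x)) 2}

theorem trivEnd_of_extends (hframe : ∀ v, ∑ a, e a <• ((φ a).1 v) = v)
    (hΩ : ∀ s, B.IsSmoothSection s → D.Extends (D.toFun s) (endApply Ω s)) (hx : x ∈ B.U i) :
    (B.trivEnd hx).compContinuousAlternatingMap (Ω x) = (D.form e φ).curvature x := by
  ext ξ v
  obtain ⟨s, hs, s_eq⟩ := B.exists_isSmoothSection_apply_eq x (B.symm i x v)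
  obtain ⟨O, m, α, t, hO, hxO, hα, ht, toFun_eq⟩ := (D.smooth s hs).exists_eq_sum_smul x
  have second_derivative := D.triv_second_covariantDeriv hframe hs hO hα ht toFun_eq hxO hx ξ
  rw [← hΩ s hs O m α t hO hα ht toFun_eq x hxO ξ, s_eq, B.triv_symm i x hx] at second_derivative
  rw [← second_derivative]
  exact congrArg (fun w => B.triv i x ((Ω x ξ).1 w)) s_eq.symm

lemma extends_of_trivEnd
    (hΩ : ∀ x, ∃ (i : ι) (n : ℕ) (e : Fin n → V i) (φ : Fin n → HomA A (V i) A) (hx : x ∈ B.U i),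
      (∀ v, ∑ a, e a <• ((φ a).1 v) = v) ∧
        (B.trivEnd hx).compContinuousAlternatingMap (Ω x) = (D.form e φ).curvature x)
    {s : ∀ x, W x} (hs : B.IsSmoothSection s) : D.Extends (D.toFun s) (endApply Ω s) := by
  intro O m α t hO hα ht toFun_eq x hxO ξ
  obtain ⟨i, n, e, φ, hx, hframe, Ω_eq⟩ := hΩ x
  have second_derivative := D.triv_second_covariantDeriv hframe hs hO hα ht toFun_eq hxO hx ξ
  rw [← Ω_eq] at second_derivative
  rw [← B.symm_triv i x hx (∑ j, _), second_derivative]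
  change _ = B.symm i x (B.triv i x ((Ω x ξ).1 (B.symm i x (B.triv i x (s x)))))
  rw [B.symm_triv i x hx, B.symm_triv i x hx]
  rfl

lemma isSmoothEndForm_of_extends (hW : ∀ x, IsFGP A (W x))
    (hΩ : ∀ s, B.IsSmoothSection s → D.Extends (D.toFun s) (endApply Ω s)) :
    B.IsSmoothEndForm Ω := by
  intro i c hc y hy
  obtain ⟨n, e, φ, hframe⟩ := exists_frame_of_mem_U hW hy.2
  have smooth_form : (D.form e φ).SmoothOn (B.U i) := D.smoothOn_form
  have smooth_curvature := (smooth_form.curvature (B.isOpen_U i)).comp_clm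
    ((EndA.incl A (V i)).restrictScalars ℝ)
  refine ((smooth_curvature c hc).congr fun z hz => ?_) y hy
  have Ω_eq := D.trivEnd_of_extends hframe hΩ hz.2
  ext u v
  exact congrArg (fun T : EndA A (V i) => T.1 v)
    (DFunLike.congr_fun Ω_eq fun j => mfderiv 𝓘(ℝ, E) 𝓘(ℝ, E) c.symm z (u j))

theorem existsUnique_isCurvature (hW : ∀ x, IsFGP A (W x)) : ∃! Ω, D.IsCurvature Ω := by
  choose i n e φ hi hframe using B.exists_mem_U_and_frame hW
  let Ω : DForm E (fun x => EndA A (W x)) 2 := fun x =>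
    (EndA.conj (B.triv_hom (i x) x (hi x)) (B.symm_hom (i x) x
      (hi x))).compContinuousAlternatingMap ((D.form (e x) (φ x)).curvature x)
  have trivEnd_Ω (x : M) : (B.trivEnd (hi x)).compContinuousAlternatingMap (Ω x) =
      (D.form (e x) (φ x)).curvature x :=
    ContinuousAlternatingMap.ext fun ξ => EndA.conj_conj _ _ (B.triv_symm (i x) x (hi x)) _
  have extends_Ω (s : ∀ x, W x) (hs : B.IsSmoothSection s) :
      D.Extends (D.toFun s) (endApply Ω s) :=
    D.extends_of_trivEnd (fun x => ⟨i x, n x, e x, φ x, hi x, hframe x, trivEnd_Ω x⟩) hs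
  refine ⟨Ω, ⟨D.isSmoothEndForm_of_extends hW extends_Ω, extends_Ω⟩, fun Ω' hΩ' => ?_⟩
  funext x
  ext ξ : 1
  exact trivEnd_injective (hi x) (DFunLike.congr_fun
    ((D.trivEnd_of_extends (hframe x) hΩ'.2 (hi x)).trans (trivEnd_Ω x).symm) ξ)

end Connection

end SmoothHilbertBundle

end CurvatureOfConnection

section AlgebraHom

variable {T R S : Type*} [AddCommGroup T] [Module ℝ T] [TopologicalSpace T]
  [NormedRing R] [NormedAlgebra ℝ R] [NormedRing S] [NormedAlgebra ℝ S] {f : R →L[ℝ] S}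

lemma compContinuousAlternatingMap_wedge (map_mul : ∀ a b, f (a * b) = f a * f b) {p q : ℕ}
    (α : T [⋀^Fin p]→L[ℝ] R) (β : T [⋀^Fin q]→L[ℝ] R) :
    f.compContinuousAlternatingMap (α ⋏ β) =
      f.compContinuousAlternatingMap α ⋏ f.compContinuousAlternatingMap β := by
  ext v
  simp only [wedge_apply, ContinuousLinearMap.compContinuousAlternatingMap_coe,
    Function.comp_apply, map_smul, map_sum, Units.smul_def, map_zsmul,
    ContinuousLinearMap.mul_apply', map_mul]

lemma compContinuousAlternatingMap_wedgePow (map_mul : ∀ a b, f (a * b) = f a * f b)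
    (map_one : f 1 = 1) (Φ : T [⋀^Fin 2]→L[ℝ] R) (k : ℕ) :
    f.compContinuousAlternatingMap (wedgePow Φ k) =
      wedgePow (f.compContinuousAlternatingMap Φ) k := by
  induction k with
  | zero => exact ContinuousAlternatingMap.ext fun _ => map_one
  | succ k ih =>
    rw [wedgePow, wedgePow, ← ih]
    exact compContinuousAlternatingMap_wedge map_mul _ _

lemma compContinuousAlternatingMap_expForm (map_mul : ∀ a b, f (a * b) = f a * f b)
    (map_one : f 1 = 1) (Φ : T [⋀^Fin 2]→L[ℝ] R) (k : ℕ) :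
    f.compContinuousAlternatingMap (expForm Φ k) =
      expForm (f.compContinuousAlternatingMap Φ) k := by
  rw [expForm, expForm, ← compContinuousAlternatingMap_wedgePow map_mul map_one]
  exact ContinuousAlternatingMap.ext fun _ => map_smul f _ _

end AlgebraHom

section CurvatureFamilies

variable {E : Type*} [NormedAddCommGroup E] [NormedSpace ℝ E]
  {M : Type*} [TopologicalSpace M] [ChartedSpace E M]
  {F R : Type*} [NormedAddCommGroup F] [NormedSpace ℝ F] [NormedRing R] [NormedAlgebra ℝ R]

namespace DForm

variable (E M F) in
/-- The differentials of smooth `p`-forms on `M` with values in `F`. -/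
def exact (p : ℕ) : Submodule ℝ (DForm E (fun _ : M => F) (p + 1)) where
  carrier := {β | ∃ η : DForm E (fun _ : M => F) p, η.IsSmooth ∧ η.d = β}
  add_mem' := by
    rintro _ _ ⟨η, hη, rfl⟩ ⟨θ, hθ, rfl⟩
    exact ⟨η + θ, hη.add hθ, d_add hη hθ⟩
  zero_mem' := ⟨0, isSmooth_zero, d_zero⟩
  smul_mem' := by
    rintro c _ ⟨η, hη, rfl⟩
    exact ⟨c • η, hη.smul c, d_smul η c⟩

lemma sub_mem_exact_of_hasDerivAt {p N : ℕ} {P Q : ℝ → DForm E (fun _ : M => F) (p + 1)}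
    (hP : ∀ x v, (fun t => P t x v) ∈ polynomialCurves F N)
    (hPQ : ∀ x v t, HasDerivAt (fun s => P s x v) (Q t x v) t)
    (hQ : ∀ t, Q t ∈ exact E M F p) : P 1 - P 0 ∈ exact E M F p := by
  obtain ⟨w, hw⟩ := exists_weights_sub_eq_sum_deriv F N
  have sub_eq_sum : P 1 - P 0 = ∑ j : Fin N, w j • Q j := by
    funext x
    ext v
    rw [Finset.sum_apply, ContinuousAlternatingMap.sum_apply]
    refine (hw _ (hP x v)).trans (Finset.sum_congr rfl fun j _ => ?_)
    rw [(hPQ x v j).deriv]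
    rfl
  rw [sub_eq_sum]
  exact Submodule.sum_mem _ fun j _ => Submodule.smul_mem _ _ (hQ j)

variable {U : Set M} {γ θ : DForm E (fun _ : M => R) 1} {x : M}

lemma curvature_add_smul (hU : IsOpen U) (hγ : γ.SmoothOn U) (hθ : θ.SmoothOn U) (t : ℝ)
    (hx : x ∈ U) :
    (γ + t • θ).curvature x = (γ.d x + t • θ.d x) + (γ x + t • θ x) ⋏ (γ x + t • θ x) := by
  rw [curvature, d_add_apply hU hγ (hθ.const_smul t) hx, d_smul]
  rfl

lemma hasDerivAt_curvature (hU : IsOpen U) (hγ : γ.SmoothOn U) (hθ : θ.SmoothOn U) (t : ℝ)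
    (hx : x ∈ U) :
    HasDerivAt (fun s : ℝ => ((γ + s • θ).curvature x : E [⋀^Fin 2]→L[ℝ] R))
      (θ.d x + (γ + t • θ) x ⋏ θ x + θ x ⋏ (γ + t • θ) x) t := by
  have hasDerivAt_line {p : ℕ} (a b : E [⋀^Fin p]→L[ℝ] R) :
      HasDerivAt (fun s : ℝ => a + s • b) b t := by
    simpa only [one_smul] using! ((hasDerivAt_id t).smul_const b).const_add a
  simp only [curvature_add_smul hU hγ hθ _ hx, add_assoc (θ.d x)]
  have hasDerivAt_form := hasDerivAt_line (γ x) (θ x)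
  exact (hasDerivAt_line (γ.d x) (θ.d x)).add
    (hasDerivAt_wedge (E := E) hasDerivAt_form hasDerivAt_form)

lemma curvature_add_smul_mem_polynomialCurves (hU : IsOpen U) (hγ : γ.SmoothOn U)
    (hθ : θ.SmoothOn U) (hx : x ∈ U) :
    (fun t : ℝ => (γ + t • θ).curvature x) ∈
      polynomialCurves (TangentSpace 𝓘(ℝ, E) x [⋀^Fin 2]→L[ℝ] R) 2 := by
  simp only [curvature_add_smul hU hγ hθ _ hx]
  have line_mem := add_smul_mem_polynomialCurves le_rfl (γ x) (θ x)
  exact Submodule.add_mem _ (add_smul_mem_polynomialCurves one_le_two (γ.d x) (θ.d x))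
    (bilinear_mem_polynomialCurves (wedgeₗ (ContinuousLinearMap.mul ℝ R)) line_mem line_mem)

variable (T : R →L[ℝ] F)

/-- The degree `2k` part `T(Ωᵏ / k!)` of the Chern character form of the connection `d + γ` on a
trivial bundle, with curvature `Ω` and with respect to a trace `T`. -/
def localChern (k : ℕ) (γ : DForm E (fun _ : M => R) 1) : DForm E (fun _ : M => F) (2 * k) :=
  fun x => T.compContinuousAlternatingMap (expForm (γ.curvature x) k)

/-- The form `T(Ωᵏ / k! ∧ θ)`, whose differential is the derivative of the Chern character form
when the connection form `γ` moves in the direction `θ`. -/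
def localTransgression (k : ℕ) (γ θ : DForm E (fun _ : M => R) 1) :
    DForm E (fun _ : M => F) (2 * k + 1) :=
  fun x => T.compContinuousAlternatingMap (expForm (γ.curvature x) k ⋏ θ x)

lemma localChern_eq_smul (k : ℕ) (γ : DForm E (fun _ : M => R) 1) :
    localChern T k γ = (k.factorial : ℝ)⁻¹ • (fun x => T.compContinuousAlternatingMap
      (wedgePow (γ.curvature x) k) : DForm E (fun _ : M => F) (2 * k)) :=
  funext fun _ => ContinuousAlternatingMap.ext fun _ => map_smul T _ _

lemma localTransgression_eq_smul (k : ℕ) (γ θ : DForm E (fun _ : M => R) 1) :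
    localTransgression T k γ θ = (k.factorial : ℝ)⁻¹ • (fun x => T.compContinuousAlternatingMap
      (wedgePow (γ.curvature x) k ⋏ θ x) : DForm E (fun _ : M => F) (2 * k + 1)) := by
  funext x
  have wedge_smul := LinearMap.map_smul₂ (wedgeₗ (ContinuousLinearMap.mul ℝ R))
    (k.factorial : ℝ)⁻¹ (wedgePow (γ.curvature x) k) (θ x)
  ext v
  exact (congrArg (fun α : TangentSpace 𝓘(ℝ, E) x [⋀^Fin (2 * k + 1)]→L[ℝ] R => T (α v))
    wedge_smul).trans (map_smul T _ _)

lemma localChern_add_smul_mem_polynomialCurves (hU : IsOpen U) (hγ : γ.SmoothOn U)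
    (hθ : θ.SmoothOn U) (hx : x ∈ U) (k : ℕ) (v : Fin (2 * k) → TangentSpace 𝓘(ℝ, E) x) :
    (fun t : ℝ => localChern T k (γ + t • θ) x v) ∈ polynomialCurves F (k * 2) := by
  simp only [localChern_eq_smul]
  exact linearMap_mem_polynomialCurves
    ((k.factorial : ℝ)⁻¹ • T ∘L ContinuousAlternatingMap.apply ℝ E R v :
      E [⋀^Fin (2 * k)]→L[ℝ] R →L[ℝ] F).toLinearMap
    (wedgePow_mem_polynomialCurves (curvature_add_smul_mem_polynomialCurves hU hγ hθ hx) k)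

variable [IsManifold 𝓘(ℝ, E) ∞ M]

lemma SmoothOn.localChern (hU : IsOpen U) (hγ : γ.SmoothOn U) (k : ℕ) :
    (localChern T k γ).SmoothOn U := by
  rw [localChern_eq_smul]
  exact (((hγ.curvature hU).wedgePow k).comp_clm T).const_smul _

lemma SmoothOn.localTransgression (hU : IsOpen U) (hγ : γ.SmoothOn U) (hθ : θ.SmoothOn U)
    (k : ℕ) : (localTransgression T k γ θ).SmoothOn U := by
  rw [localTransgression_eq_smul]
  exact ((((hγ.curvature hU).wedgePow k).wedge _ hθ).comp_clm T).const_smul _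

variable (hT : ∀ a b, T (a * b) = T (b * a))
include hT

lemma d_localChern (hU : IsOpen U) (hγ : γ.SmoothOn U) (hx : x ∈ U) (k : ℕ) :
    (localChern T k γ).d x = 0 := by
  rw [localChern_eq_smul, d_smul, Pi.smul_apply, d_trace_wedgePow_curvature T hT hU hγ k hx,
    smul_zero]

theorem hasDerivAt_localChern (hU : IsOpen U) (hγ : γ.SmoothOn U) (hθ : θ.SmoothOn U)
    (hx : x ∈ U) (k : ℕ) (t : ℝ) (v : Fin (2 * (k + 1)) → TangentSpace 𝓘(ℝ, E) x) :
    HasDerivAt (fun s : ℝ => localChern T (k + 1) (γ + s • θ) x v)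
      ((localTransgression T k (γ + t • θ) θ).d x v) t := by
  have factorial_eq : (k.factorial : ℝ)⁻¹ =
      ((k + 1).factorial : ℝ)⁻¹ * ((k + 1 : ℕ) : ℝ) := by
    rw [Nat.factorial_succ]
    field_simp
    push_cast
    ring
  rw [localTransgression_eq_smul, d_smul, Pi.smul_apply,
    d_trace_wedgePow_curvature_wedge T hT hU (hγ.add (hθ.const_smul t)) hθ k hx, factorial_eq,
    mul_smul]
  simp only [localChern_eq_smul]
  have deriv_trace := hasDerivAt_trace_wedgePow (E := E) T hT
    (hasDerivAt_curvature hU hγ hθ t hx) k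
  exact ((ContinuousAlternatingMap.apply ℝ E F v).hasFDerivAt.comp_hasDerivAt t
    deriv_trace).const_smul _

end DForm

end CurvatureFamilies

section ChernForm

variable {A : Type*} [CStarAlgebra A] [PartialOrder A] [StarOrderedRing A]
  {Z : Type*} [NonUnitalCommCStarAlgebra Z] {τ : A →L[ℂ] Z}
  {E : Type*} [NormedAddCommGroup E] [NormedSpace ℝ E]
  {M : Type*} [TopologicalSpace M] [ChartedSpace E M]
  {W : M → Type*} [∀ x, NormedAddCommGroup (W x)] [∀ x, NormedSpace ℂ (W x)]
  [∀ x, Module Aᵐᵒᵖ (W x)] [∀ x, HilbertModule A (W x)]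
  {ι : Type*} {V : ι → Type*} [∀ i, NormedAddCommGroup (V i)] [∀ i, NormedSpace ℂ (V i)]
  [∀ i, Module Aᵐᵒᵖ (V i)] [∀ i, HilbertModule A (V i)]

namespace SmoothHilbertBundle

variable {B : SmoothHilbertBundle A E W V} {i : ι} {n : ℕ} {e : Fin n → V i}
  {φ : Fin n → HomA A (V i) A} {x : M} (hτ : ∀ a b : A, τ (a * b) = τ (b * a))
  (hW : ∀ x, IsFGP A (W x))

lemma traceEv_comp_eq_frameTrace_comp_trivEnd (hframe : ∀ v, ∑ a, e a <• ((φ a).1 v) = v)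
    (hx : x ∈ B.U i) {p : ℕ} (α : TangentSpace 𝓘(ℝ, E) x [⋀^Fin p]→L[ℝ] EndA A (W x)) :
    ((traceEv τ hτ (hW x)).restrictScalars ℝ).compContinuousAlternatingMap α =
      (frameTrace τ e φ).compContinuousAlternatingMap
        ((B.trivEnd hx).compContinuousAlternatingMap α) :=
  ContinuousAlternatingMap.ext fun ξ => traceEv_eq_frameTrace_conj τ hτ (hW x) hframe
    (B.symm_hom i x hx) (B.triv_hom i x hx) (B.symm_triv i x hx) (α ξ)

lemma trivEnd_mul (hx : x ∈ B.U i) (S T : EndA A (W x)) :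
    B.trivEnd hx (S * T) = B.trivEnd hx S * B.trivEnd hx T :=
  EndA.conj_mul _ _ (B.symm_triv i x hx) S T

lemma trivEnd_one (hx : x ∈ B.U i) : B.trivEnd hx 1 = 1 :=
  EndA.conj_one _ _ (B.triv_symm i x hx)

variable [FiniteDimensional ℝ E] [T2Space M] [IsManifold 𝓘(ℝ, E) ∞ M]

namespace Connection

variable (D : B.Connection) {Ω : DForm E (fun x => EndA A (W x)) 2}

lemma trivEnd_expForm (hframe : ∀ v, ∑ a, e a <• ((φ a).1 v) = v) (hΩ : D.IsCurvature Ω)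
    (hx : x ∈ B.U i) (k : ℕ) :
    (B.trivEnd hx).compContinuousAlternatingMap (expForm (Ω x) k) =
      expForm ((D.form e φ).curvature x) k :=
  (compContinuousAlternatingMap_expForm (trivEnd_mul hx) (trivEnd_one hx) (Ω x) k).trans
    (congrArg (expForm · k) (D.trivEnd_of_extends hframe hΩ.2 hx))

lemma chernForm_eq_localChern (hframe : ∀ v, ∑ a, e a <• ((φ a).1 v) = v) (hΩ : D.IsCurvature Ω)
    (hx : x ∈ B.U i) (k : ℕ) :
    chernForm τ hτ hW Ω k x =
      DForm.localChern (R := EndA A (V i)) (frameTrace τ e φ) k (D.form e φ) x :=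
  (traceEv_comp_eq_frameTrace_comp_trivEnd hτ hW hframe hx _).trans
    (congrArg (frameTrace τ e φ).compContinuousAlternatingMap (D.trivEnd_expForm hframe hΩ hx k))

lemma smoothOn_chernForm (hframe : ∀ v, ∑ a, e a <• ((φ a).1 v) = v) (hΩ : D.IsCurvature Ω)
    (k : ℕ) : (chernForm τ hτ hW Ω k).SmoothOn (B.U i) := by
  have smooth_form : (D.form e φ).SmoothOn (B.U i) := D.smoothOn_form
  have smooth_localChern := DForm.SmoothOn.localChern (R := EndA A (V i)) (F := Z)
    (frameTrace τ e φ) (B.isOpen_U i) smooth_form k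
  exact smooth_localChern.congr fun x hx =>
    (D.chernForm_eq_localChern hτ hW hframe hΩ hx k).symm

lemma d_chernForm (hframe : ∀ v, ∑ a, e a <• ((φ a).1 v) = v) (hΩ : D.IsCurvature Ω)
    (hx : x ∈ B.U i) (k : ℕ) : (chernForm τ hτ hW Ω k).d x = 0 := by
  have smooth_form : (D.form e φ).SmoothOn (B.U i) := D.smoothOn_form
  have d_localChern := DForm.d_localChern (R := EndA A (V i)) (F := Z) (frameTrace τ e φ)
    (frameTrace_mul_comm τ hτ hframe) (B.isOpen_U i) smooth_form hx k
  exact (DForm.d_congr (B.isOpen_U i)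
    (fun y hy => D.chernForm_eq_localChern hτ hW hframe hΩ hy k) hx).trans d_localChern

theorem chernForm_mem_closedForms (hΩ : D.IsCurvature Ω) (k : ℕ) :
    chernForm τ hτ hW Ω k ∈ closedForms E M Z (2 * k) := by
  choose i n e φ hx hframe using B.exists_mem_U_and_frame hW
  exact ⟨DForm.isSmooth_iff_smoothOn_univ.2 (DForm.smoothOn_of_locally fun x _ =>
      ⟨B.U (i x), B.isOpen_U (i x), hx x, D.smoothOn_chernForm hτ hW (hframe x) hΩ k⟩),
    funext fun x => D.d_chernForm hτ hW (hframe x) hΩ (hx x) k⟩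

end Connection

end SmoothHilbertBundle

end ChernForm

section Interpolation

variable {A : Type*} [CStarAlgebra A] [PartialOrder A]
  {E : Type*} [NormedAddCommGroup E] [NormedSpace ℝ E]
  {M : Type*} [TopologicalSpace M] [ChartedSpace E M]
  {W : M → Type*} [∀ x, NormedAddCommGroup (W x)] [∀ x, NormedSpace ℂ (W x)]
  [∀ x, Module Aᵐᵒᵖ (W x)] [∀ x, HilbertModule A (W x)]
  {ι : Type*} {V : ι → Type*} [∀ i, NormedAddCommGroup (V i)] [∀ i, NormedSpace ℂ (V i)]
  [∀ i, Module Aᵐᵒᵖ (V i)] [∀ i, HilbertModule A (V i)]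

namespace SmoothHilbertBundle

variable {B : SmoothHilbertBundle A E W V} {i : ι}

lemma trivForm_add_smul_sub {p : ℕ} (t : ℝ) (α β : DForm E W p) :
    B.trivForm i (α + t • (β - α)) =
      B.trivForm i α + t • (B.trivForm i β - B.trivForm i α) := by
  funext x
  ext ξ
  change B.triv i x (α x ξ + t • (β x ξ - α x ξ)) =
    B.triv i x (α x ξ) + t • (B.triv i x (β x ξ) - B.triv i x (α x ξ))
  rw [_root_.map_add, (B.triv i x).map_smul_of_tower, _root_.map_sub]

namespace Connection

variable [StarOrderedRing A]

/-- The affine path `D + t (D' - D)` of connections from `D` to `D'`. -/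
def interpolate (D D' : B.Connection) (t : ℝ) : B.Connection where
  toFun s := D.toFun s + t • (D'.toFun s - D.toFun s)
  smooth s hs i := by
    have smooth_D : (B.trivForm i (D.toFun s)).SmoothOn (B.U i) := D.smooth s hs i
    have smooth_D' : (B.trivForm i (D'.toFun s)).SmoothOn (B.U i) := D'.smooth s hs i
    have smooth_path := smooth_D.add ((smooth_D'.sub smooth_D).const_smul t)
    rw [← trivForm_add_smul_sub] at smooth_path
    exact smooth_path
  map_add s s' hs hs' := by
    funext x
    rw [D.map_add s s' hs hs', D'.map_add s s' hs hs']
    change D.toFun s x + D.toFun s' x +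
        t • (D'.toFun s x + D'.toFun s' x - (D.toFun s x + D.toFun s' x)) =
      D.toFun s x + t • (D'.toFun s x - D.toFun s x) +
        (D.toFun s' x + t • (D'.toFun s' x - D.toFun s' x))
    module
  leibniz s f hs hf x ξ := by
    simp only [Pi.add_apply, Pi.smul_apply, Pi.sub_apply, ContinuousAlternatingMap.add_apply,
      ContinuousAlternatingMap.smul_apply, ContinuousAlternatingMap.sub_apply,
      D.leibniz s f hs hf, D'.leibniz s f hs hf]
    rw [add_sub_add_left_eq_sub, smul_add, add_assoc, ← smul_sub]
    congr 2
    exact (isBoundedBilinearMap_op_smul.smul_left t _ (f x)).symm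

variable (D D' : B.Connection)

lemma interpolate_zero : D.interpolate D' 0 = D := by
  simp only [interpolate, zero_smul, add_zero]

lemma interpolate_one : D.interpolate D' 1 = D' := by
  simp only [interpolate, one_smul, add_sub_cancel]

variable [FiniteDimensional ℝ E] [T2Space M] [IsManifold 𝓘(ℝ, E) ∞ M]
  {n : ℕ} {e : Fin n → V i} {φ : Fin n → HomA A (V i) A} {x : M}

lemma form_interpolate (t : ℝ) :
    (D.interpolate D' t).form e φ = D.form e φ + t • (D'.form e φ - D.form e φ) := by
  have trivForm_interpolate (s : ∀ x, W x) : B.trivForm i ((D.interpolate D' t).toFun s) =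
      B.trivForm i (D.toFun s) + t • (B.trivForm i (D'.toFun s) - B.trivForm i (D.toFun s)) :=
    trivForm_add_smul_sub t _ _
  funext x
  ext ξ : 1
  simp only [form, trivForm_interpolate, Pi.add_apply, Pi.sub_apply,
    Pi.smul_apply, ContinuousAlternatingMap.add_apply, ContinuousAlternatingMap.smul_apply,
    ContinuousAlternatingMap.sub_apply, ContinuousAlternatingMap.sum_apply,
    ContinuousLinearMap.compContinuousAlternatingMap_coe, Function.comp_apply, _root_.map_add,
    _root_.map_sub, map_smul, Finset.sum_add_distrib, ← Finset.smul_sum, Finset.sum_sub_distrib]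

lemma triv_sub_toFun (hframe : ∀ v, ∑ a, e a <• ((φ a).1 v) = v) {s : ∀ x, W x}
    (hs : B.IsSmoothSection s) (hx : x ∈ B.U i) (ξ : Fin 1 → TangentSpace 𝓘(ℝ, E) x) :
    B.triv i x (D'.toFun s x ξ - D.toFun s x ξ) =
      (D'.form e φ x ξ - D.form e φ x ξ).1 (B.triv i x (s x)) := by
  rw [_root_.map_sub, D.triv_toFun hframe hs hx, D'.triv_toFun hframe hs hx,
    add_sub_add_left_eq_sub]
  rfl

variable {D D'} {θ : DForm E (fun x => EndA A (W x)) 1}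
  (hθ : ∀ s, B.IsSmoothSection s → D'.toFun s - D.toFun s = endApply θ s)

include hθ in
lemma trivEnd_of_sub_eq_endApply (hframe : ∀ v, ∑ a, e a <• ((φ a).1 v) = v) (hx : x ∈ B.U i) :
    (B.trivEnd hx).compContinuousAlternatingMap (θ x) = (D'.form e φ - D.form e φ) x := by
  ext ξ v
  obtain ⟨s, hs, s_eq⟩ := B.exists_isSmoothSection_apply_eq x (B.symm i x v)
  have triv_sub := D.triv_sub_toFun D' hframe hs hx ξ
  rw [s_eq, B.triv_symm i x hx] at triv_sub
  refine Eq.trans ?_ triv_sub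
  have sub_apply : D'.toFun s x ξ - D.toFun s x ξ = (θ x ξ).1 (s x) :=
    DFunLike.congr_fun (congrFun (hθ s hs) x) ξ
  rw [sub_apply, s_eq]
  rfl

variable (D D') in
lemma exists_sub_eq_endApply (hW : ∀ x, IsFGP A (W x)) :
    ∃ θ : DForm E (fun x => EndA A (W x)) 1,
      ∀ s, B.IsSmoothSection s → D'.toFun s - D.toFun s = endApply θ s := by
  choose i n e φ hi hframe using B.exists_mem_U_and_frame hW
  refine ⟨fun x => (EndA.conj (B.triv_hom (i x) x (hi x)) (B.symm_hom (i x) x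
    (hi x))).compContinuousAlternatingMap ((D'.form (e x) (φ x) - D.form (e x) (φ x)) x),
    fun s hs => ?_⟩
  funext x
  ext ξ
  have triv_sub := D.triv_sub_toFun D' (hframe x) hs (hi x) ξ
  exact (B.symm_triv (i x) x (hi x) _).symm.trans (congrArg (B.symm (i x) x) triv_sub)

end Connection

end SmoothHilbertBundle

end Interpolation

section Transgression

variable {A : Type*} [CStarAlgebra A] [PartialOrder A] [StarOrderedRing A]
  {Z : Type*} [NonUnitalCommCStarAlgebra Z] {τ : A →L[ℂ] Z}
  {E : Type*} [NormedAddCommGroup E] [NormedSpace ℝ E]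
  {M : Type*} [TopologicalSpace M] [ChartedSpace E M]
  {W : M → Type*} [∀ x, NormedAddCommGroup (W x)] [∀ x, NormedSpace ℂ (W x)]
  [∀ x, Module Aᵐᵒᵖ (W x)] [∀ x, HilbertModule A (W x)]
  {ι : Type*} {V : ι → Type*} [∀ i, NormedAddCommGroup (V i)] [∀ i, NormedSpace ℂ (V i)]
  [∀ i, Module Aᵐᵒᵖ (V i)] [∀ i, HilbertModule A (V i)]

namespace SmoothHilbertBundle

variable (hτ : ∀ a b : A, τ (a * b) = τ (b * a)) (hW : ∀ x, IsFGP A (W x))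

/-- The form `τ(ev(Ωᵏ / k! ∧ θ))`, whose differential is the derivative of the Chern character form
along a path of connections with derivative `θ` and curvature `Ω`. -/
def transgression (Ω : DForm E (fun x => EndA A (W x)) 2) (θ : DForm E (fun x => EndA A (W x)) 1)
    (k : ℕ) : DForm E (fun _ : M => Z) (2 * k + 1) :=
  fun x => ((traceEv τ hτ (hW x)).restrictScalars ℝ).compContinuousAlternatingMap
    (expForm (Ω x) k ⋏ θ x)

variable [FiniteDimensional ℝ E] [T2Space M] [IsManifold 𝓘(ℝ, E) ∞ M]
  {B : SmoothHilbertBundle A E W V}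

namespace Connection

variable {i : ι} {n : ℕ} {e : Fin n → V i} {φ : Fin n → HomA A (V i) A} {x : M}
  (D D' : B.Connection) {Ω : DForm E (fun x => EndA A (W x)) 2}
  {θ : DForm E (fun x => EndA A (W x)) 1}

lemma transgression_eq_localTransgression (hframe : ∀ v, ∑ a, e a <• ((φ a).1 v) = v)
    (hΩ : D.IsCurvature Ω) (hx : x ∈ B.U i) {δ : DForm E (fun _ : M => EndA A (V i)) 1}
    (hδ : (B.trivEnd hx).compContinuousAlternatingMap (θ x) = δ x) (k : ℕ) :
    transgression hτ hW Ω θ k x =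
      DForm.localTransgression (R := EndA A (V i)) (F := Z) (frameTrace τ e φ) k
        (D.form e φ) δ x :=
  (traceEv_comp_eq_frameTrace_comp_trivEnd hτ hW hframe hx _).trans
    (congrArg (frameTrace τ e φ).compContinuousAlternatingMap
      ((compContinuousAlternatingMap_wedge (trivEnd_mul hx) _ _).trans
        (congrArg₂ (wedge (ContinuousLinearMap.mul ℝ (EndA A (V i))))
          (D.trivEnd_expForm hframe hΩ hx k) hδ)))

variable {D D'}
  (hθ : ∀ s, B.IsSmoothSection s → D'.toFun s - D.toFun s = endApply θ s)

include hθ in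
lemma isSmooth_transgression {t : ℝ} (hΩ : (D.interpolate D' t).IsCurvature Ω) (k : ℕ) :
    (transgression hτ hW Ω θ k).IsSmooth := by
  refine DForm.isSmooth_iff_smoothOn_univ.2 (DForm.smoothOn_of_locally fun x _ => ?_)
  obtain ⟨i, n, e, φ, hx, hframe⟩ := B.exists_mem_U_and_frame hW x
  have smooth_form (D'' : B.Connection) : (D''.form e φ).SmoothOn (B.U i) := D''.smoothOn_form
  have smooth_local := DForm.SmoothOn.localTransgression (R := EndA A (V i)) (F := Z)
    (frameTrace τ e φ) (B.isOpen_U i) (smooth_form (D.interpolate D' t))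
    ((smooth_form D').sub (smooth_form D)) k
  exact ⟨B.U i, B.isOpen_U i, hx, smooth_local.congr fun y hy =>
    (transgression_eq_localTransgression hτ hW _ hframe hΩ hy
      (trivEnd_of_sub_eq_endApply hθ hframe hy) k).symm⟩

lemma chernForm_interpolate (hframe : ∀ v, ∑ a, e a <• ((φ a).1 v) = v) {t : ℝ}
    (hΩ : (D.interpolate D' t).IsCurvature Ω) (hx : x ∈ B.U i) (k : ℕ) :
    chernForm τ hτ hW Ω k x = DForm.localChern (R := EndA A (V i)) (F := Z) (frameTrace τ e φ) k
      (D.form e φ + t • (D'.form e φ - D.form e φ)) x :=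
  (chernForm_eq_localChern hτ hW _ hframe hΩ hx k).trans
    (congrArg (fun γ => DForm.localChern (R := EndA A (V i)) (F := Z) (frameTrace τ e φ) k γ x)
      (D.form_interpolate D' t))

section Path

variable {Ω : ℝ → DForm E (fun x => EndA A (W x)) 2}
  (hΩ : ∀ t, (D.interpolate D' t).IsCurvature (Ω t))
include hΩ

lemma chernForm_interpolate_mem_polynomialCurves (k : ℕ) (x : M)
    (v : Fin (2 * k) → TangentSpace 𝓘(ℝ, E) x) :
    (fun t => chernForm τ hτ hW (Ω t) k x v) ∈ polynomialCurves Z (k * 2) := by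
  obtain ⟨i, n, e, φ, hx, hframe⟩ := B.exists_mem_U_and_frame hW x
  have smooth_form (D'' : B.Connection) : (D''.form e φ).SmoothOn (B.U i) := D''.smoothOn_form
  have mem_polynomialCurves := DForm.localChern_add_smul_mem_polynomialCurves
    (R := EndA A (V i)) (F := Z) (frameTrace τ e φ) (B.isOpen_U i) (smooth_form D)
    ((smooth_form D').sub (smooth_form D)) hx k v
  have chernForm_eq := funext fun t =>
    DFunLike.congr_fun (chernForm_interpolate hτ hW hframe (hΩ t) hx k) v
  exact chernForm_eq ▸ mem_polynomialCurves

include hθ in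
lemma hasDerivAt_chernForm_interpolate (k : ℕ) (x : M)
    (v : Fin (2 * (k + 1)) → TangentSpace 𝓘(ℝ, E) x) (t : ℝ) :
    HasDerivAt (fun s => chernForm τ hτ hW (Ω s) (k + 1) x v)
      ((transgression hτ hW (Ω t) θ k).d x v) t := by
  obtain ⟨i, n, e, φ, hx, hframe⟩ := B.exists_mem_U_and_frame hW x
  have smooth_form (D'' : B.Connection) : (D''.form e φ).SmoothOn (B.U i) := D''.smoothOn_form
  have hasDerivAt_localChern := DForm.hasDerivAt_localChern (R := EndA A (V i)) (F := Z)
    (frameTrace τ e φ) (frameTrace_mul_comm τ hτ hframe) (B.isOpen_U i) (smooth_form D)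
    ((smooth_form D').sub (smooth_form D)) hx k t v
  have chernForm_eq (s : ℝ) :=
    DFunLike.congr_fun (chernForm_interpolate hτ hW hframe (hΩ s) hx (k + 1)) v
  have d_transgression := DForm.d_congr (B.isOpen_U i) (fun y hy =>
    transgression_eq_localTransgression hτ hW _ hframe (hΩ t) hy
      (trivEnd_of_sub_eq_endApply hθ hframe hy) k) hx
  rw [d_transgression, form_interpolate]
  exact hasDerivAt_localChern.congr_of_eventuallyEq (.of_forall chernForm_eq)

end Path

theorem chernForm_sub_mem_exact {Ω Ω' : DForm E (fun x => EndA A (W x)) 2}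
    (hΩ : D.IsCurvature Ω) (hΩ' : D'.IsCurvature Ω') (k : ℕ) :
    (chernForm τ hτ hW Ω' (k + 1) - chernForm τ hτ hW Ω (k + 1) :
      DForm E (fun _ : M => Z) (2 * k + 1 + 1)) ∈ DForm.exact E M Z (2 * k + 1) := by
  obtain ⟨θ, hθ⟩ := D.exists_sub_eq_endApply D' hW
  choose Ωt hΩt using fun t => ((D.interpolate D' t).existsUnique_isCurvature hW).exists
  have Ωt_zero : Ωt 0 = Ω :=
    (D.existsUnique_isCurvature hW).unique (D.interpolate_zero D' ▸ hΩt 0) hΩ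
  have Ωt_one : Ωt 1 = Ω' :=
    (D'.existsUnique_isCurvature hW).unique (D.interpolate_one D' ▸ hΩt 1) hΩ'
  rw [← Ωt_zero, ← Ωt_one]
  exact DForm.sub_mem_exact_of_hasDerivAt (p := 2 * k + 1)
    (P := fun t => chernForm τ hτ hW (Ωt t) (k + 1))
    (chernForm_interpolate_mem_polynomialCurves hτ hW hΩt (k + 1))
    (hasDerivAt_chernForm_interpolate hτ hW hθ hΩt k)
    fun t => ⟨_, isSmooth_transgression hτ hW hθ (hΩt t) k, rfl⟩

end Connection

end SmoothHilbertBundle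

end Transgression

end

theorem mainTheorem12
    {A : Type*} [CStarAlgebra A] [PartialOrder A] [StarOrderedRing A]
    {Z : Type*} [NonUnitalCommCStarAlgebra Z]
    (τ : A →L[ℂ] Z) (hτ : ∀ a b : A, τ (a * b) = τ (b * a))
    {E : Type*} [NormedAddCommGroup E] [NormedSpace ℝ E] [FiniteDimensional ℝ E]
    {M : Type*} [TopologicalSpace M] [T2Space M] [ChartedSpace E M] [IsManifold 𝓘(ℝ, E) ∞ M]
    {W : M → Type*} [∀ x, NormedAddCommGroup (W x)] [∀ x, NormedSpace ℂ (W x)]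
    [∀ x, Module Aᵐᵒᵖ (W x)] [∀ x, HilbertModule A (W x)]
    {ι : Type*} {V : ι → Type*} [∀ i, NormedAddCommGroup (V i)] [∀ i, NormedSpace ℂ (V i)]
    [∀ i, Module Aᵐᵒᵖ (V i)] [∀ i, HilbertModule A (V i)]
    (B : SmoothHilbertBundle A E W V) (hW : ∀ x, IsFGP A (W x)) :
    -- every connection has a well-defined curvature
    (∀ D : B.Connection, ∃! Ω, D.IsCurvature Ω) ∧
    -- the forms `ch_τ(Ω)` are (smooth and) closed
    (∀ (D : B.Connection) (Ω : DForm E (fun x => EndA A (W x)) 2), D.IsCurvature Ω →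
      ∀ k, chernForm τ hτ hW Ω k ∈ closedForms E M Z (2 * k)) ∧
    -- their cohomology classes do not depend on the connection
    (∀ (D D' : B.Connection) (Ω Ω' : DForm E (fun x => EndA A (W x)) 2),
      D.IsCurvature Ω → D'.IsCurvature Ω' →
      ∀ k (h : chernForm τ hτ hW Ω k ∈ closedForms E M Z (2 * k))
        (h' : chernForm τ hτ hW Ω' k ∈ closedForms E M Z (2 * k)),
        deRhamClass (chernForm τ hτ hW Ω k) h = deRhamClass (chernForm τ hτ hW Ω' k) h') := by
  refine ⟨fun D => D.existsUnique_isCurvature hW,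
    fun D Ω hΩ k => D.chernForm_mem_closedForms hτ hW hΩ k, fun D D' Ω Ω' hΩ hΩ' k h h' => ?_⟩
  cases k with
  | zero => rfl
  | succ k =>
    exact (Submodule.Quotient.eq _).2
      (SmoothHilbertBundle.Connection.chernForm_sub_mem_exact hτ hW hΩ' hΩ k)
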